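/- **Setting.** Let $n,q,c$ be natural numbers and let $X$ be a set of $n$ balls, each having one of $c$ possible colours (not all colours need occur); the colouring is unknown. For a set $Y$ of balls, a ball $x\in Y$ is a *majority ball* of $Y$ if more than $|Y|/2$ balls of $Y$ have the colour of $x$; a *non-minority ball* of $Y$ if at least $|Y|/2$ balls of $Y$ have the colour of $x$; a *plurality ball* of $Y$ if $Y$ contains more balls of the colour of $x$ than of any other colour; and an *almost-plurality ball* of $Y$ if it is a plurality ball or a non-minority ball of $Y$. A *majority query* (resp. *plurality query*) of size $q$ is a set $Q\subseteq X$ with $|Q|=q$. The answer to it is NO if $Q$ has no majority (resp. plurality) ball; otherwise the answer is YES together with some majority (resp. plurality) ball of $Q$, which one being out of our control. Let $MB(n,q,c)$ be the least $k$ for which there is a deterministic adaptive algorithm that, for every such colouring and all correct answers, asks at most $k$ majority queries of size $q$ and then either presents a non-minority ball of $X$ or correctly states that there is none (and $\infty$ if there is no such $k$). Let $MC(n,q,c)$ be defined in the same way with almost-plurality balls of $X$ instead of non-minority balls, and let $PB(n,q,c)$ and $PC(n,q,c)$ be defined like $MB$ and $MC$, respectively, with plurality queries instead of majority queries. **Theorem.**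 For all integers $q\ge 2$ and $c\ge 0$ there exist an integer $n_0=n_0(q,c)$ and a constant $K=K(q,c)$ such that for all $n\ge n_0$ $$MB(n,q,c),\ MC(n,q,c),\ PB(n,q,c),\ PC(n,q,c)\ \le\ Kn .$$ -/

import Mathlib

/-- The number of balls of colour `d` in the set `X`, under the colouring `χ`. -/
def colourCount {n c : ℕ} (χ : Fin n → Fin c) (X : Finset (Fin n)) (d : Fin c) : ℕ :=
  (X.filter fun y => χ y = d).card

/-- `x ∈ X` and more than `|X|/2` balls of `X` have the colour of `x`. -/
def IsMajorityBall {n c : ℕ} (χ : Fin n → Fin c) (X : Finset (Fin n)) (x : Fin n) : Prop :=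
  x ∈ X ∧ X.card < 2 * colourCount χ X (χ x)

/-- `x ∈ X` and at least `|X|/2` balls of `X` have the colour of `x`. -/
def IsNonMinorityBall {n c : ℕ} (χ : Fin n → Fin c) (X : Finset (Fin n)) (x : Fin n) : Prop :=
  x ∈ X ∧ X.card ≤ 2 * colourCount χ X (χ x)

/-- `x ∈ X` and `X` has more balls of the colour of `x` than of any other colour. -/
def IsPluralityBall {n c : ℕ} (χ : Fin n → Fin c) (X : Finset (Fin n)) (x : Fin n) : Prop :=
  x ∈ X ∧ ∀ d : Fin c, d ≠ χ x → colourCount χ X d < colourCount χ X (χ x)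

/-- A plurality ball or a non-minority ball. -/
def IsAlmostPluralityBall {n c : ℕ} (χ : Fin n → Fin c) (X : Finset (Fin n)) (x : Fin n) :
    Prop :=
  IsPluralityBall χ X x ∨ IsNonMinorityBall χ X x

/-- A kind of ball: given a colouring and a set of balls, which balls of the set are of that
kind. -/
abbrev BallKind (n c : ℕ) : Type :=
  (Fin n → Fin c) → Finset (Fin n) → Fin n → Prop

/-- `some x` is a correct reply about `X` if `x` is a ball of the given kind in `X`; `none`
(that is, "NO") is a correct reply if `X` has no ball of that kind. -/
def IsCorrectReply {n c : ℕ} (kind : BallKind n c) (χ : Fin n → Fin c) (X : Finset (Fin n)) :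
    Option (Fin n) → Prop
  | some x => kind χ X x
  | none => ∀ x, ¬ kind χ X x

/-- An adaptive algorithm (decision tree) on `n` balls whose queries are `q`-element sets of
balls: it either halts with a final claim, or asks a query and continues depending on the reply.
A reply or a claim is `some x` (the ball `x` is presented) or `none` (there is no such ball). -/
inductive Algorithm (n q : ℕ) : Type
  | halt (claim : Option (Fin n)) : Algorithm n q
  | ask (Q : Finset (Fin n)) (hQ : Q.card = q) (next : Option (Fin n) → Algorithm n q) :
      Algorithm n q

/-- On the colouring `χ`, when every query receives an arbitrary correct reply about balls of the
kind `ans`, the algorithm always halts after at most `k` queries, with a correct final claim about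
balls of the kind `goal` in the set of all balls. -/
def Algorithm.SucceedsWithin {n q c : ℕ} (ans goal : BallKind n c) (χ : Fin n → Fin c) :
    Algorithm n q → ℕ → Prop
  | .halt claim, _ => IsCorrectReply goal χ Finset.univ claim
  | .ask _ _ _, 0 => False
  | .ask Q _ next, k + 1 =>
      ∀ r, IsCorrectReply ans χ Q r → (next r).SucceedsWithin ans goal χ k

/-- The least number `k` such that some algorithm asking queries of size `q` solves the problem
within `k` queries for every colouring of `n` balls with (at most) `c` colours; it is `⊤` if there
is no such `k`. -/
noncomputable def queryComplexity (n q c : ℕ) (ans goal : BallKind n c) : ℕ∞ :=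
  ⨅ (k : ℕ) (_ : ∃ A : Algorithm n q, ∀ χ : Fin n → Fin c, A.SucceedsWithin ans goal χ k),
    (k : ℕ∞)

/-- Majority queries, to find a non-minority ball. -/
noncomputable def MB (n q c : ℕ) : ℕ∞ := queryComplexity n q c IsMajorityBall IsNonMinorityBall

/-- Majority queries, to find an almost-plurality ball. -/
noncomputable def MC (n q c : ℕ) : ℕ∞ :=
  queryComplexity n q c IsMajorityBall IsAlmostPluralityBall

/-- Plurality queries, to find a non-minority ball. -/
noncomputable def PB (n q c : ℕ) : ℕ∞ := queryComplexity n q c IsPluralityBall IsNonMinorityBall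

/-- Plurality queries, to find an almost-plurality ball. -/
noncomputable def PC (n q c : ℕ) : ℕ∞ :=
  queryComplexity n q c IsPluralityBall IsAlmostPluralityBall

/-! The state of an algorithm is the set `Γ` of colourings compatible with the replies so far.
Asking all queries inside a bounded set costs a constant, and asking all queries inside `insert x S`
for every ball `x` costs O(n) when `S` is bounded. Apart from one even-size argument, only three
facts about replies are used: a colour with more than half of the query forces a YES with a ball of
that colour, a tie for the lead forces NO, and a presented ball shares its colour with another ball
of the query.

Core. In a large set with all queries answered, some ball is known to have a colour that occurs more
than `L` times (`exists_heavy`). Scanning the balls and discarding such a ball whenever the stored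
set grows too large leaves a bounded set `S` containing at least min(L, m) balls of every colour of
multiplicity m (`reach_isCore`).

Rich case. If some possible colouring has two frequent colours in `S` and, for odd `q`, a third
colour, then nearly balanced queries with blocks of the two colours test whether a ball has one of
these colours. All possible colourings then have the same classes of size at least `L`
(`agree_of_isRich`), which determines the claim.

Otherwise each possible colouring either is dominated, with at most one frequent colour, or has
exactly two colours and `q = 2a + 1`. If all are dominated, a heavy ball is a non-minority ball. Let
`O` be the set of two-coloured ones. For these every query has a majority, and a combinatorial
argument on families of 0-1 functions yields sets `A`, `B` of size `a` known to have opposite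
colours (`exists_isFrame`). Padding two balls with nearly all of `A ∪ B` computes their conjunction
and disjunction. Since a reply is itself a ball, this either orders the two balls by implication or
shows that they are opposite (`IsFrame.compare`). Linear-time selection then finds a median `w`:
depending on its colour, everything above it or everything below it shares that colour, so `w` is a
non-minority ball. An opposite pair met on the way either sorts all balls into four classes, which
also gives a non-minority ball, or gets resolved, at a cost charged to balls whose colour becomes
known (`IsFrame.reach_orient`).

The ball `w` is justified only on `O`. Queries around it (`reach_twins`) show that its colour is
frequent in all colourings, or collect many balls of its colour on `O`, among which a heavy ball
works for the dominated colourings too. -/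

/-- Starting from the knowledge that the colouring lies in `Γ`, some strategy asking at most `k`
further queries always ends with a knowledge satisfying `P`. -/
def Reach {n c : ℕ} (q : ℕ) (ans : BallKind n c) (P : Set (Fin n → Fin c) → Prop) :
    ℕ → Set (Fin n → Fin c) → Prop
  | 0, Γ => P Γ
  | k + 1, Γ => P Γ ∨ ∃ Q : Finset (Fin n), Q.card = q ∧
      ∀ r, Reach q ans P k (Γ ∩ {χ | IsCorrectReply ans χ Q r})

/-- Some reply to the query `Q` is correct for all colourings in `Γ`. -/
def Resolved {n c : ℕ} (ans : BallKind n c) (Γ : Set (Fin n → Fin c)) (Q : Finset (Fin n)) : Prop :=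
  ∃ r, ∀ χ ∈ Γ, IsCorrectReply ans χ Q r

/-- All queries of size `q` inside `S` are resolved. -/
def ResolvedOn {n c : ℕ} (q : ℕ) (ans : BallKind n c) (Γ : Set (Fin n → Fin c))
    (S : Finset (Fin n)) : Prop :=
  ∀ Q ⊆ S, Q.card = q → Resolved ans Γ Q

/-! ### Strategies as transformations of knowledge. -/

section reach

variable {n c q : ℕ} {ans : BallKind n c} {P P' : Set (Fin n → Fin c) → Prop}
  {Γ Γ' : Set (Fin n → Fin c)} {k l : ℕ}

theorem Resolved.mono {Q : Finset (Fin n)} (h : Resolved ans Γ Q) (hΓ : Γ' ⊆ Γ) :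
    Resolved ans Γ' Q :=
  h.imp fun _ hr χ hχ => hr χ (hΓ hχ)

theorem ResolvedOn.mono {S : Finset (Fin n)} (h : ResolvedOn q ans Γ S) (hΓ : Γ' ⊆ Γ) :
    ResolvedOn q ans Γ' S :=
  fun Q hQ hc => (h Q hQ hc).mono hΓ

theorem ResolvedOn.subset {S T : Finset (Fin n)} (h : ResolvedOn q ans Γ S) (hT : T ⊆ S) :
    ResolvedOn q ans Γ T :=
  fun Q hQ hc => h Q (hQ.trans hT) hc

theorem Reach.of_holds (h : P Γ) : Reach q ans P k Γ := by
  cases k with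
  | zero => exact h
  | succ k => exact Or.inl h

theorem Reach.mono_steps (h : Reach q ans P k Γ) (hkl : k ≤ l) : Reach q ans P l Γ := by
  induction k generalizing l Γ with
  | zero => exact Reach.of_holds h
  | succ k ih =>
    obtain ⟨l, rfl⟩ : ∃ m, l = m + 1 := ⟨l - 1, by omega⟩
    rcases h with h | ⟨Q, hQ, h⟩
    · exact Reach.of_holds h
    · exact Or.inr ⟨Q, hQ, fun r => ih (h r) (by omega)⟩

theorem Reach.bind (h : Reach q ans P k Γ)
    (h' : ∀ Γ' ⊆ Γ, P Γ' → Reach q ans P' l Γ') : Reach q ans P' (k + l) Γ := by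
  induction k generalizing Γ with
  | zero => exact (h' Γ subset_rfl h).mono_steps (by omega)
  | succ k ih =>
    rcases h with h | ⟨Q, hQ, h⟩
    · exact (h' Γ subset_rfl h).mono_steps (by omega)
    · rw [Nat.succ_add_eq_add_succ]
      exact Or.inr ⟨Q, hQ, fun r => ih (h r) fun Γ' hΓ' =>
        h' Γ' (hΓ'.trans Set.inter_subset_left)⟩

theorem Reach.ask {Q : Finset (Fin n)} (hQ : Q.card = q)
    (h : ∀ Γ' ⊆ Γ, Resolved ans Γ' Q → Reach q ans P k Γ') : Reach q ans P (k + 1) Γ :=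
  Or.inr ⟨Q, hQ, fun r => h _ Set.inter_subset_left ⟨r, fun _ hχ => hχ.2⟩⟩

theorem Reach.askAll (F : Finset (Finset (Fin n))) (hF : ∀ Q ∈ F, Q.card = q)
    (h : ∀ Γ' ⊆ Γ, (∀ Q ∈ F, Resolved ans Γ' Q) → Reach q ans P k Γ') :
    Reach q ans P (k + F.card) Γ := by
  induction F using Finset.induction_on generalizing Γ with
  | empty => exact h Γ subset_rfl (by simp)
  | insert Q F hQF ih =>
    rw [Finset.card_insert_of_notMem hQF, ← add_assoc]
    refine Reach.ask (hF Q (by simp)) fun Γ₁ h₁ hr => ih (fun Q' hQ' => hF Q' (by simp [hQ'])) ?_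
    intro Γ₂ h₂ hr₂
    refine h Γ₂ (h₂.trans h₁) fun Q' hQ' => ?_
    rcases Finset.mem_insert.1 hQ' with rfl | hQ'
    · exact hr.mono h₂
    · exact hr₂ Q' hQ'

theorem Reach.askOn (S : Finset (Fin n))
    (h : ∀ Γ' ⊆ Γ, ResolvedOn q ans Γ' S → Reach q ans P k Γ') :
    Reach q ans P (k + 2 ^ S.card) Γ := by
  have := Reach.askAll (q := q) (ans := ans) (P := P) (k := k) (Γ := Γ) (S.powersetCard q)
    (fun Q hQ => (Finset.mem_powersetCard.1 hQ).2) fun Γ' hΓ' hr => h Γ' hΓ' fun Q hQ hc =>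
      hr Q (Finset.mem_powersetCard.2 ⟨hQ, hc⟩)
  refine this.mono_steps ?_
  rw [Finset.card_powersetCard]
  have := Nat.choose_le_two_pow S.card q
  omega

theorem Reach.askOnStar (S : Finset (Fin n)) (T : Finset (Fin n))
    (h : ∀ Γ' ⊆ Γ, (∀ x ∈ T, ResolvedOn q ans Γ' (insert x S)) → Reach q ans P k Γ') :
    Reach q ans P (k + T.card * 2 ^ (S.card + 1)) Γ := by
  induction T using Finset.induction_on generalizing Γ with
  | empty => exact (h Γ subset_rfl (by simp)).mono_steps (by omega)
  | insert x T hx ih =>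
    rw [Finset.card_insert_of_notMem hx]
    have key : Reach q ans P (k + T.card * 2 ^ (S.card + 1) + 2 ^ (insert x S).card) Γ := by
      refine Reach.askOn _ fun Γ₁ h₁ hr => ih fun Γ₂ h₂ hr₂ => h Γ₂ (h₂.trans h₁) fun y hy => ?_
      rcases Finset.mem_insert.1 hy with rfl | hy
      · exact hr.mono h₂
      · exact hr₂ y hy
    refine key.mono_steps ?_
    have : 2 ^ (insert x S).card ≤ 2 ^ (S.card + 1) :=
      Nat.pow_le_pow_right (by norm_num) (Finset.card_insert_le _ _)
    rw [add_mul, one_mul]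
    omega

/-- Some claim is correct for all colourings in `Γ`. -/
def HasClaim (goal : BallKind n c) (Γ : Set (Fin n → Fin c)) : Prop :=
  ∃ claim, ∀ χ ∈ Γ, IsCorrectReply goal χ Finset.univ claim

theorem Reach.exists_algorithm {goal : BallKind n c} (h : Reach q ans (HasClaim goal) k Γ) :
    ∃ A : Algorithm n q, ∀ χ ∈ Γ, A.SucceedsWithin ans goal χ k := by
  induction k generalizing Γ with
  | zero =>
    obtain ⟨claim, hc⟩ := h
    exact ⟨.halt claim, fun χ hχ => hc χ hχ⟩
  | succ k ih =>
    rcases h with ⟨claim, hc⟩ | ⟨Q, hQ, h⟩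
    · exact ⟨.halt claim, fun χ hχ => hc χ hχ⟩
    · choose A hA using fun r => ih (h r)
      exact ⟨.ask Q hQ A, fun χ hχ r hr => hA r χ ⟨hχ, hr⟩⟩

theorem queryComplexity_le {goal : BallKind n c}
    (h : Reach q ans (HasClaim goal) k Set.univ) : queryComplexity n q c ans goal ≤ k := by
  obtain ⟨A, hA⟩ := h.exists_algorithm
  exact iInf₂_le k ⟨A, fun χ => hA χ (Set.mem_univ χ)⟩

end reach

/-! ### Colour counts and forced replies. -/

/-- Every majority ball is of the kind `ans`, and every ball of the kind `ans` is a plurality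
ball. -/
structure IsAnswerKind {n c : ℕ} (ans : BallKind n c) : Prop where
  of_majority : ∀ χ Q x, IsMajorityBall χ Q x → ans χ Q x
  plurality : ∀ χ Q x, ans χ Q x → IsPluralityBall χ Q x

section counting

variable {n c : ℕ} {ans : BallKind n c} {χ : Fin n → Fin c} {Q D E : Finset (Fin n)}

theorem colourCount_union_of_disjoint (h : Disjoint D E) (d : Fin c) :
    colourCount χ (D ∪ E) d = colourCount χ D d + colourCount χ E d := by
  unfold colourCount
  rw [Finset.filter_union, Finset.card_union_of_disjoint (Finset.disjoint_filter_filter h)]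

theorem colourCount_insert_of_notMem {x : Fin n} (hx : x ∉ D) (d : Fin c) :
    colourCount χ (insert x D) d = colourCount χ D d + if χ x = d then 1 else 0 := by
  unfold colourCount
  rw [Finset.filter_insert]
  split_ifs with h
  · exact Finset.card_insert_of_notMem fun h' => hx (Finset.mem_filter.1 h').1
  · rfl

theorem colourCount_mono (h : D ⊆ E) (d : Fin c) : colourCount χ D d ≤ colourCount χ E d :=
  Finset.card_le_card (Finset.filter_subset_filter _ h)

theorem colourCount_eq_card {d : Fin c} (h : ∀ x ∈ D, χ x = d) : colourCount χ D d = D.card := by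
  unfold colourCount; rw [Finset.filter_true_of_mem h]

theorem colourCount_eq_zero {d : Fin c} (h : ∀ x ∈ D, χ x ≠ d) : colourCount χ D d = 0 := by
  unfold colourCount; rw [Finset.filter_false_of_mem h, Finset.card_empty]

theorem card_le_colourCount {d : Fin c} (hD : D ⊆ Q) (h : ∀ x ∈ D, χ x = d) :
    D.card ≤ colourCount χ Q d :=
  Finset.card_le_card fun x hx => Finset.mem_filter.2 ⟨hD hx, h x hx⟩

theorem colourCount_add_colourCount_le {d e : Fin c} (h : d ≠ e) :
    colourCount χ Q d + colourCount χ Q e ≤ Q.card := by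
  unfold colourCount
  rw [← Finset.card_union_of_disjoint]
  · exact Finset.card_le_card (Finset.union_subset (Finset.filter_subset _ _)
      (Finset.filter_subset _ _))
  · exact Finset.disjoint_filter.2 fun x _ hd he => h (hd.symm.trans he)

theorem sum_colourCount : ∑ d, colourCount χ Q d = Q.card :=
  (Finset.card_eq_sum_card_fiberwise (fun x _ => Finset.mem_coe.2 (Finset.mem_univ (χ x)))).symm

theorem colourCount_pos {d : Fin c} : 0 < colourCount χ Q d ↔ ∃ x ∈ Q, χ x = d := by
  unfold colourCount
  rw [Finset.card_pos, Finset.filter_nonempty_iff]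

theorem isAnswerKind_majority : IsAnswerKind (IsMajorityBall : BallKind n c) := by
  refine ⟨fun _ _ _ h => h, fun χ Q x h => ⟨h.1, fun d hd => ?_⟩⟩
  have := colourCount_add_colourCount_le (χ := χ) (Q := Q) hd
  have := h.2
  omega

theorem isAnswerKind_plurality : IsAnswerKind (IsPluralityBall : BallKind n c) :=
  ⟨fun χ Q x h => isAnswerKind_majority.plurality χ Q x h, fun _ _ _ h => h⟩

/-- If more than half of the balls of `Q` have colour `d`, then a correct reply to `Q` presents a
ball of colour `d`. -/
theorem IsAnswerKind.reply_of_majority (hans : IsAnswerKind ans) {d : Fin c} {r : Option (Fin n)}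
    (h : Q.card < 2 * colourCount χ Q d) (hr : IsCorrectReply ans χ Q r) :
    ∃ x ∈ Q, r = some x ∧ χ x = d := by
  obtain ⟨y, hy, hyd⟩ := colourCount_pos.1 (show 0 < colourCount χ Q d by omega)
  cases r with
  | none => exact absurd (hans.of_majority χ Q y ⟨hy, by rwa [hyd]⟩) (hr y)
  | some x =>
    have hx := hans.plurality χ Q x hr
    refine ⟨x, hx.1, rfl, ?_⟩
    by_contra hne
    have h₁ := hx.2 d (Ne.symm hne)
    have h₂ := colourCount_add_colourCount_le (χ := χ) (Q := Q) hne
    omega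

/-- If two colours are tied for the lead in `Q`, the only correct reply is `none`. -/
theorem IsAnswerKind.reply_of_tie (hans : IsAnswerKind ans) {d e : Fin c} {r : Option (Fin n)}
    (hde : d ≠ e) (heq : colourCount χ Q d = colourCount χ Q e)
    (hle : ∀ f, f ≠ d → f ≠ e → colourCount χ Q f ≤ colourCount χ Q d)
    (hr : IsCorrectReply ans χ Q r) : r = none := by
  cases r with
  | none => rfl
  | some x =>
    have hx := (hans.plurality χ Q x hr).2
    exfalso
    by_cases h₁ : d = χ x
    · have := hx e (h₁ ▸ hde.symm)
      rw [← h₁] at this; omega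
    · have h₂ := hx d h₁
      by_cases h₃ : e = χ x
      · rw [← h₃] at h₂; omega
      · have := hle (χ x) (Ne.symm h₁) (Ne.symm h₃); omega

/-- A ball presented as the reply to a query of size at least two shares its colour with another
ball of the query. -/
theorem IsAnswerKind.exists_ne_of_reply (hans : IsAnswerKind ans) {x : Fin n} (hQ : 2 ≤ Q.card)
    (hr : ans χ Q x) : ∃ y ∈ Q, y ≠ x ∧ χ y = χ x := by
  have hx := hans.plurality χ Q x hr
  obtain ⟨y, hy, hyx⟩ := Finset.exists_mem_ne (by omega : 1 < Q.card) x
  by_cases h : χ y = χ x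
  · exact ⟨y, hy, hyx, h⟩
  have h₁ := hx.2 _ h
  have h₂ : 0 < colourCount χ Q (χ y) := colourCount_pos.2 ⟨y, hy, rfl⟩
  obtain ⟨z, hz, hzx⟩ := Finset.exists_mem_ne
    (show 1 < (Q.filter fun w => χ w = χ x).card by unfold colourCount at *; omega) x
  exact ⟨z, (Finset.mem_filter.1 hz).1, hzx, (Finset.mem_filter.1 hz).2⟩

end counting

/-! ### Heavy balls and the bounded core. -/

/-- In a digraph with out-degrees at most `L`, any `m * (2 * L + 1)` vertices contain an
independent set of size `m`. -/
theorem exists_independent {α : Type*} [DecidableEq α] (C : α → Finset α) (L m : ℕ) (U : Finset α)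
    (hC : ∀ u ∈ U, (C u).card ≤ L) (hU : m * (2 * L + 1) ≤ U.card) :
    ∃ I ⊆ U, I.card = m ∧ ∀ u ∈ I, ∀ w ∈ I, u ≠ w → w ∉ C u := by
  induction m generalizing U with
  | zero => exact ⟨∅, by simp, rfl, by simp⟩
  | succ m ih =>
    have hne : U.Nonempty := Finset.card_pos.1 (by nlinarith)
    -- The average in-degree is at most the maximal out-degree `L`, so some `w` has at most `L`
    -- in-neighbours. Deleting `w` with all its neighbours costs at most `2 * L + 1` vertices.
    have hsum : ∑ w ∈ U, (U.filter fun u => w ∈ C u).card ≤ U.card * L := by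
      have := Finset.sum_card_bipartiteAbove_eq_sum_card_bipartiteBelow
        (s := U) (t := U) (fun w u => w ∈ C u)
      simp only [Finset.bipartiteAbove, Finset.bipartiteBelow] at this
      rw [this]
      refine Finset.sum_le_card_nsmul _ _ _ fun u hu => ?_
      refine le_trans (Finset.card_le_card fun w hw => ?_) (hC u hu)
      exact (Finset.mem_filter.1 hw).2
    obtain ⟨w, hw, hwL⟩ : ∃ w ∈ U, (U.filter fun u => w ∈ C u).card ≤ L := by
      by_contra! hcon
      have : ∑ _w ∈ U, L < ∑ w ∈ U, (U.filter fun u => w ∈ C u).card :=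
        Finset.sum_lt_sum_of_nonempty hne hcon
      rw [Finset.sum_const, smul_eq_mul] at this
      omega
    set V := U \ insert w (C w ∪ U.filter fun u => w ∈ C u) with hV
    have hVcard : m * (2 * L + 1) ≤ V.card := by
      have h₁ := Finset.le_card_sdiff (insert w (C w ∪ U.filter fun u => w ∈ C u)) U
      rw [← hV] at h₁
      have h₂ := Finset.card_insert_le w (C w ∪ U.filter fun u => w ∈ C u)
      have h₃ := Finset.card_union_le (C w) (U.filter fun u => w ∈ C u)
      have h₄ := hC w hw
      have h₅ : (m + 1) * (2 * L + 1) = m * (2 * L + 1) + (2 * L + 1) := by ring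
      omega
    obtain ⟨I, hI, hIm, hind⟩ := ih V (fun u hu => hC u (Finset.mem_sdiff.1 hu).1) hVcard
    have hout : ∀ x ∈ I, x ≠ w ∧ x ∉ C w ∧ w ∉ C x := by
      intro x hx
      have := Finset.mem_sdiff.1 (hI hx)
      simp only [Finset.mem_insert, Finset.mem_union, Finset.mem_filter, not_or, not_and] at this
      exact ⟨this.2.1, this.2.2.1, this.2.2.2 this.1⟩
    refine ⟨insert w I, Finset.insert_subset hw (hI.trans Finset.sdiff_subset), ?_, ?_⟩
    · rw [Finset.card_insert_of_notMem fun h => (hout w h).1 rfl, hIm]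
    · intro u hu x hx hux
      rcases Finset.mem_insert.1 hu with rfl | hu' <;> rcases Finset.mem_insert.1 hx with rfl | hx'
      · exact absurd rfl hux
      · exact (hout x hx').2.1
      · exact (hout u hu').2.2
      · exact hind u hu' x hx' hux

section heavy

variable {n c q : ℕ} {ans : BallKind n c} {Γ : Set (Fin n → Fin c)}
  {P : Set (Fin n → Fin c) → Prop}

theorem exists_monochromatic (χ : Fin n → Fin c) {I : Finset (Fin n)} {m : ℕ}
    (hI : c * m ≤ I.card) (hpos : 0 < I.card) :
    ∃ Q ⊆ I, Q.card = m ∧ ∃ d, ∀ x ∈ Q, χ x = d := by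
  obtain ⟨x₀, hx₀⟩ := Finset.card_pos.1 hpos
  have hne : (Finset.univ : Finset (Fin c)).Nonempty := ⟨χ x₀, Finset.mem_univ _⟩
  obtain ⟨d, -, hd⟩ : ∃ d ∈ (Finset.univ : Finset (Fin c)), m ≤ colourCount χ I d := by
    refine Finset.exists_le_of_sum_le hne ?_
    rw [sum_colourCount]
    simpa using hI
  obtain ⟨Q, hQ, hQm⟩ := Finset.exists_subset_card_eq hd
  exact ⟨Q, hQ.trans (Finset.filter_subset _ _), hQm, d, fun x hx => (Finset.mem_filter.1 (hQ hx)).2⟩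

/-- If all queries inside a large set `U` are resolved, then some ball of `U` shares its colour with
many balls of `U`, for all colourings that are still possible. -/
theorem exists_heavy (hans : IsAnswerKind ans) (hq : 2 ≤ q) (L : ℕ) {U : Finset (Fin n)}
    (hres : ResolvedOn q ans Γ U) (hU : (c * q) * (2 * L + 1) ≤ U.card) (hpos : 0 < U.card) :
    ∃ u ∈ U, ∀ χ ∈ Γ, L < colourCount χ U (χ u) := by
  by_contra! hcon
  by_cases hΓ : Γ = ∅
  · subst hΓ
    obtain ⟨u, hu⟩ := Finset.card_pos.1 hpos
    obtain ⟨χ, hχ, -⟩ := hcon u hu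
    exact hχ
  obtain ⟨χ₀, hχ₀⟩ := Set.nonempty_iff_ne_empty.2 hΓ
  have hc : 0 < c := by
    obtain ⟨u, hu⟩ := Finset.card_pos.1 hpos
    exact (χ₀ u).pos
  have hcon' : ∀ u : Fin n, ∃ χ, u ∈ U → χ ∈ Γ ∧ colourCount χ U (χ u) ≤ L := by
    intro u
    by_cases hu : u ∈ U
    · obtain ⟨χ, h⟩ := hcon u hu
      exact ⟨χ, fun _ => h⟩
    · exact ⟨χ₀, fun h => absurd h hu⟩
  choose f hf using hcon'
  -- Here `f u` is a possible colouring in which the colour of `u` is rare in `U`, and `u` points to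
  -- its colour class under `f u`. An independent set of size `c * q` contains a query that is
  -- monochromatic under `χ₀`, so its reply is some ball `x`. This reply must also be correct under
  -- `f x`, where `x` then shares its colour with another ball of the query, against independence.
  obtain ⟨I, hIU, hIcard, hind⟩ := exists_independent
    (fun u => U.filter fun y => f u y = f u u) L (c * q) U (fun u hu => (hf u hu).2) hU
  have hcq : 0 < c * q := Nat.mul_pos hc (by omega)
  obtain ⟨Q, hQI, hQ, d, hd⟩ := exists_monochromatic χ₀ hIcard.ge (by omega)
  obtain ⟨r, hr⟩ := hres Q (hQI.trans hIU) hQ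
  obtain ⟨x, hx, rfl, -⟩ := hans.reply_of_majority (d := d)
    (by rw [colourCount_eq_card hd]; omega) (hr χ₀ hχ₀)
  have hxU := hIU (hQI hx)
  obtain ⟨y, hy, hyx, hyc⟩ := hans.exists_ne_of_reply (by omega) (hr _ (hf x hxU).1)
  exact hind x (hQI hx) y (hQI hy) hyx.symm (Finset.mem_filter.2 ⟨hIU (hQI hy), hyc⟩)

/-- `S` contains at least `min L m` balls of each colour that occurs `m` times in `T`. -/
def IsCore (L : ℕ) (Γ : Set (Fin n → Fin c)) (S T : Finset (Fin n)) : Prop :=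
  ∀ χ ∈ Γ, ∀ d, min L (colourCount χ T d) ≤ colourCount χ S d

theorem IsCore.mono {L : ℕ} {Γ' : Set (Fin n → Fin c)} {S T : Finset (Fin n)}
    (h : IsCore L Γ S T) (hΓ : Γ' ⊆ Γ) : IsCore L Γ' S T :=
  fun χ hχ => h χ (hΓ hχ)

/-- The balls of `T` are added one at a time. When the stored set exceeds `N` balls, all its queries
are asked and a heavy ball is dropped. -/
theorem reach_isCore (hans : IsAnswerKind ans) (hq : 2 ≤ q) {L N k : ℕ}
    (hN : (c * q) * (2 * L + 1) ≤ N) (T : Finset (Fin n))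
    (h : ∀ Γ' ⊆ Γ, ∀ S : Finset (Fin n), S.card ≤ N → S ⊆ T → IsCore L Γ' S T → Reach q ans P k Γ') :
    Reach q ans P (k + T.card * 2 ^ (N + 1)) Γ := by
  induction T using Finset.induction_on generalizing Γ k with
  | empty => exact (h Γ subset_rfl ∅ (by simp) (by simp) (by simp [IsCore, colourCount])).mono_steps (by omega)
  | insert x T hx ih =>
    rw [Finset.card_insert_of_notMem hx, add_mul, one_mul, add_comm (T.card * _), ← add_assoc]
    refine ih fun Γ₁ h₁ S hS hST hcore => ?_
    have hsub : insert x S ⊆ insert x T := Finset.insert_subset_insert x hST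
    have hins : IsCore L Γ₁ (insert x S) (insert x T) := by
      intro χ hχ d
      have h₂ := hcore χ hχ d
      rw [colourCount_insert_of_notMem hx, colourCount_insert_of_notMem fun h => hx (hST h)]
      omega
    by_cases hcard : (insert x S).card ≤ N
    · exact (h Γ₁ h₁ _ hcard hsub hins).mono_steps (Nat.le_add_right _ _)
    have hle := Finset.card_insert_le x S
    have hcard' : (insert x S).card = N + 1 := by omega
    rw [← hcard']
    refine Reach.askOn _ fun Γ₂ h₂ hres => ?_
    -- The colour of `u` occurs more than `L` times under every possible colouring, so at least `L`
    -- balls of it survive the removal of `u`.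
    obtain ⟨u, hu, hheavy⟩ := exists_heavy hans hq L hres (by omega) (by omega)
    refine h Γ₂ (h₂.trans h₁) ((insert x S).erase u) ?_
      ((Finset.erase_subset _ _).trans hsub) ?_
    · rw [Finset.card_erase_of_mem hu]; omega
    · intro χ hχ d
      have hd := hins.mono h₂ χ hχ d
      by_cases hud : χ u = d
      · have := hheavy χ hχ
        rw [hud] at this
        have h₃ : colourCount χ ((insert x S).erase u) d + 1 = colourCount χ (insert x S) d := by
          unfold colourCount
          rw [Finset.filter_erase, Finset.card_erase_add_one]
          exact Finset.mem_filter.2 ⟨hu, hud⟩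
        omega
      · have : colourCount χ ((insert x S).erase u) d = colourCount χ (insert x S) d := by
          unfold colourCount
          rw [Finset.filter_erase, Finset.erase_eq_of_notMem]
          simp [hud]
        omega

end heavy

/-! ### Knowledge that determines the large colour classes. -/

section agree

variable {n c q : ℕ} {ans : BallKind n c} {Γ : Set (Fin n → Fin c)}

/-- All colourings in `Γ` have the same colour classes of size at least `L`. -/
def Agree (L : ℕ) (Γ : Set (Fin n → Fin c)) : Prop :=
  ∀ χ ∈ Γ, ∀ χ' ∈ Γ, ∀ x, L ≤ colourCount χ Finset.univ (χ x) → ∀ y, χ y = χ x ↔ χ' y = χ' x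

theorem Agree.colourCount_eq {L : ℕ} (h : Agree L Γ) {χ χ' : Fin n → Fin c} (hχ : χ ∈ Γ)
    (hχ' : χ' ∈ Γ) {x : Fin n} (hx : L ≤ colourCount χ Finset.univ (χ x)) :
    colourCount χ' Finset.univ (χ' x) = colourCount χ Finset.univ (χ x) := by
  unfold colourCount
  congr 1
  ext y
  simp [h χ hχ χ' hχ' x hx y]

theorem hasClaim_of_transfer {goal : BallKind n c}
    (h : ∀ χ ∈ Γ, ∀ χ' ∈ Γ, ∀ x, goal χ Finset.univ x → goal χ' Finset.univ x) :
    HasClaim goal Γ := by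
  by_cases hg : ∃ χ ∈ Γ, ∃ x, goal χ Finset.univ x
  · obtain ⟨χ, hχ, x, hx⟩ := hg
    exact ⟨some x, fun χ' hχ' => h χ hχ χ' hχ' x hx⟩
  · push Not at hg
    exact ⟨none, hg⟩

theorem Agree.nonMinority {L : ℕ} (h : Agree L Γ) (hn : 2 * L ≤ n) {χ χ' : Fin n → Fin c}
    (hχ : χ ∈ Γ) (hχ' : χ' ∈ Γ) {x : Fin n} (hx : IsNonMinorityBall χ Finset.univ x) :
    IsNonMinorityBall χ' Finset.univ x := by
  have h₁ := hx.2
  rw [Finset.card_univ, Fintype.card_fin] at h₁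
  refine ⟨hx.1, ?_⟩
  rw [h.colourCount_eq hχ hχ' (x := x) (by omega)]
  exact hx.2

/-- A plurality class has at least n/c ≥ `L` balls, so it is also a class of `χ'`. A rival class of
`χ'` either has at least `L` balls, and then is a class of `χ` as well, or is too small to matter.
-/
theorem Agree.plurality {L : ℕ} (h : Agree L Γ) (hn : c * L ≤ n) {χ χ' : Fin n → Fin c}
    (hχ : χ ∈ Γ) (hχ' : χ' ∈ Γ) {x : Fin n} (hx : IsPluralityBall χ Finset.univ x) :
    IsPluralityBall χ' Finset.univ x := by
  have hle : ∀ d, colourCount χ Finset.univ d ≤ colourCount χ Finset.univ (χ x) := by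
    intro d
    by_cases hd : d = χ x
    · rw [hd]
    · exact (hx.2 d hd).le
  have hL : L ≤ colourCount χ Finset.univ (χ x) := by
    have h₁ : n ≤ c * colourCount χ Finset.univ (χ x) := by
      have h₂ := sum_colourCount (χ := χ) (Q := Finset.univ)
      rw [Finset.card_univ, Fintype.card_fin] at h₂
      have h₃ := Finset.sum_le_card_nsmul Finset.univ
        (fun d => colourCount χ Finset.univ d) _ fun d _ => hle d
      rw [h₂, Finset.card_univ, Fintype.card_fin, smul_eq_mul] at h₃
      exact h₃
    exact Nat.le_of_mul_le_mul_left (hn.trans h₁) (χ x).pos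
  refine ⟨hx.1, fun d hd => ?_⟩
  rw [h.colourCount_eq hχ hχ' hL]
  by_cases hd0 : colourCount χ' Finset.univ d = 0
  · rw [hd0]; exact colourCount_pos.2 ⟨x, hx.1, rfl⟩
  obtain ⟨y, -, rfl⟩ := colourCount_pos.1 (Nat.pos_of_ne_zero hd0)
  by_cases hyL : L ≤ colourCount χ' Finset.univ (χ' y)
  · rw [← h.colourCount_eq hχ' hχ hyL]
    exact hx.2 _ fun h' => hd ((h χ hχ χ' hχ' x hL y).1 h')
  · omega

theorem Agree.hasClaim_nonMinority {L : ℕ} (h : Agree L Γ) (hn : 2 * L ≤ n) :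
    HasClaim IsNonMinorityBall Γ :=
  hasClaim_of_transfer fun _ hχ _ hχ' _ hx => h.nonMinority hn hχ hχ' hx

theorem Agree.hasClaim_almostPlurality {L : ℕ} (h : Agree L Γ) (hn : 2 * L ≤ n)
    (hn' : c * L ≤ n) : HasClaim IsAlmostPluralityBall Γ :=
  hasClaim_of_transfer fun _ hχ _ hχ' _ hx =>
    hx.imp (h.plurality hn' hχ hχ') (h.nonMinority hn hχ hχ')

end agree

/-! ### Testing a ball against two monochromatic blocks. -/

section blocks

variable {n c q : ℕ} {ans : BallKind n c}

theorem colourCount_of_mono {χ : Fin n → Fin c} {D : Finset (Fin n)} {e : Fin c}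
    (h : ∀ x ∈ D, χ x = e) (d : Fin c) :
    colourCount χ D d = if e = d then D.card else 0 := by
  split_ifs with hd
  · exact colourCount_eq_card fun x hx => (h x hx).trans hd
  · exact colourCount_eq_zero fun x hx hx' => hd ((h x hx).symm.trans hx')

/-- The sets `R` and `B` are monochromatic with different colours `r` and `b`. -/
structure IsBlockPair (χ : Fin n → Fin c) (R B : Finset (Fin n)) (r b : Fin c) : Prop where
  left : ∀ x ∈ R, χ x = r
  right : ∀ x ∈ B, χ x = b
  ne : r ≠ b

namespace IsBlockPair

variable {χ : Fin n → Fin c} {R B R' B' : Finset (Fin n)} {r b : Fin c}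

theorem symm (h : IsBlockPair χ R B r b) : IsBlockPair χ B R b r :=
  ⟨h.right, h.left, h.ne.symm⟩

theorem mono (h : IsBlockPair χ R B r b) (hR : R' ⊆ R) (hB : B' ⊆ B) : IsBlockPair χ R' B' r b :=
  ⟨fun x hx => h.left x (hR hx), fun x hx => h.right x (hB hx), h.ne⟩

theorem disjoint (h : IsBlockPair χ R B r b) : Disjoint R B :=
  Finset.disjoint_left.2 fun x hR hB => h.ne ((h.left x hR).symm.trans (h.right x hB))

theorem colourCount_union (h : IsBlockPair χ R B r b) (d : Fin c) :
    colourCount χ (R ∪ B) d = (if r = d then R.card else 0) + if b = d then B.card else 0 := by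
  rw [colourCount_union_of_disjoint h.disjoint, colourCount_of_mono h.left,
    colourCount_of_mono h.right]

theorem colourCount_insert (h : IsBlockPair χ R B r b) {x : Fin n} (hx : x ∉ R ∪ B) (d : Fin c) :
    colourCount χ (insert x (R ∪ B)) d =
      (if r = d then R.card else 0) + (if b = d then B.card else 0) + if χ x = d then 1 else 0 := by
  rw [colourCount_insert_of_notMem hx, h.colourCount_union]

end IsBlockPair

theorem exists_subset_erase {R : Finset (Fin n)} {m : ℕ} (hR : m + 1 ≤ R.card) (x : Fin n) :
    ∃ R' ⊆ R, R'.card = m ∧ x ∉ R' := by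
  have : m ≤ (R.erase x).card := by
    have := Finset.pred_card_le_card_erase (s := R) (a := x)
    omega
  obtain ⟨R', hR', hm⟩ := Finset.exists_subset_card_eq this
  exact ⟨R', hR'.trans (Finset.erase_subset _ _), hm, fun hx => Finset.notMem_erase x R (hR' hx)⟩

/-- For queries of even size: a ball sharing its colour with the block `R` under one colouring
shares it under every colouring compatible with the same replies. -/
theorem colour_eq_of_block_even {a : ℕ} (ha : 1 ≤ a)
    (hans : ans = IsMajorityBall ∨ ans = IsPluralityBall)
    {χ χ' : Fin n → Fin c} {R B : Finset (Fin n)} {r b r' b' : Fin c}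
    (hR : a + 1 ≤ R.card) (hB : a + 1 ≤ B.card)
    (h : IsBlockPair χ R B r b) (h' : IsBlockPair χ' R B r' b') {x : Fin n}
    (hres : ResolvedOn (2 * a) ans {χ, χ'} (insert x (R ∪ B))) (hx : χ x = r) : χ' x = r' := by
  have hkind : IsAnswerKind ans := by
    rcases hans with rfl | rfl
    · exact isAnswerKind_majority
    · exact isAnswerKind_plurality
  by_contra hne
  -- The query consists of `x`, `a` balls of `R` and `a - 1` balls of `B`. Under `χ` the colour `r`
  -- has `a + 1` of its `2 * a` balls, so the reply is YES.
  obtain ⟨R₁, hR₁, hR₁c, hxR₁⟩ := exists_subset_erase hR x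
  obtain ⟨B₁, hB₁, hB₁c, hxB₁⟩ := exists_subset_erase (m := a - 1) (R := B) (by omega) x
  have hb := h.mono hR₁ hB₁
  have hb' := h'.mono hR₁ hB₁
  have hxu : x ∉ R₁ ∪ B₁ := by simp [hxR₁, hxB₁]
  have hQ : (insert x (R₁ ∪ B₁)).card = 2 * a := by
    rw [Finset.card_insert_of_notMem hxu, Finset.card_union_of_disjoint hb.disjoint]; omega
  obtain ⟨ρ, hρ⟩ := hres (insert x (R₁ ∪ B₁))
    (Finset.insert_subset_insert _ (Finset.union_subset_union hR₁ hB₁)) hQ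
  obtain ⟨w, hw, rfl, -⟩ := hkind.reply_of_majority (d := r)
    (by rw [hb.colourCount_insert hxu, hQ, if_pos rfl, if_pos hx]; omega) (hρ χ (by simp))
  have hw' := hρ χ' (by simp)
  by_cases hxb : χ' x = b'
  · have := hkind.reply_of_tie hb'.ne
      (by rw [hb'.colourCount_insert hxu, hb'.colourCount_insert hxu]
          simp [hb'.ne, hb'.ne.symm, hxb]; omega)
      (fun f hf hf' => by
          rw [hb'.colourCount_insert hxu, hb'.colourCount_insert hxu]
          simp [hf.symm, hf'.symm, hxb]) hw'
    simp at this
  rcases hans with rfl | rfl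
  · have h₁ := hw'.2
    rw [hQ, hb'.colourCount_insert hxu] at h₁
    have := hb'.ne
    split_ifs at h₁ <;> omega
  -- For plurality replies and `x` of a third colour, `r'` leads the first query when `a ≥ 2`, so
  -- that query does not separate the colourings. The mirrored one, with `a - 1` balls of `R` and
  -- `a` of `B`, does: it is tied under `χ`, while `b'` leads under `χ'`. For `a = 1` the first
  -- query is already tied under `χ'`.
  · by_cases ha1 : a = 1
    · have := hkind.reply_of_tie (Ne.symm hne : r' ≠ χ' x)
        (by rw [hb'.colourCount_insert hxu, hb'.colourCount_insert hxu]
            simp [hb'.ne.symm, hne, Ne.symm hne, Ne.symm hxb]; omega)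
        (fun f hf hf' => by
            rw [hb'.colourCount_insert hxu, hb'.colourCount_insert hxu]
            simp [hf.symm, hf'.symm, hB₁c, ha1]) hw'
      simp at this
    obtain ⟨R₂, hR₂, hR₂c, hxR₂⟩ := exists_subset_erase (m := a - 1) (R := R) (by omega) x
    obtain ⟨B₂, hB₂, hB₂c, hxB₂⟩ := exists_subset_erase hB x
    have hc := h.mono hR₂ hB₂
    have hc' := h'.mono hR₂ hB₂
    have hxu₂ : x ∉ R₂ ∪ B₂ := by simp [hxR₂, hxB₂]
    have hQ₂ : (insert x (R₂ ∪ B₂)).card = 2 * a := by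
      rw [Finset.card_insert_of_notMem hxu₂, Finset.card_union_of_disjoint hc.disjoint]; omega
    obtain ⟨ρ₂, hρ₂⟩ := hres (insert x (R₂ ∪ B₂))
      (Finset.insert_subset_insert _ (Finset.union_subset_union hR₂ hB₂)) hQ₂
    have := hkind.reply_of_tie hc.ne
      (by rw [hc.colourCount_insert hxu₂, hc.colourCount_insert hxu₂]
          simp [hc.ne, hc.ne.symm, hx]; omega)
      (fun f hf hf' => by
          rw [hc.colourCount_insert hxu₂, hc.colourCount_insert hxu₂]
          simp [hf.symm, hf'.symm, hx]) (hρ₂ χ (by simp))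
    subst this
    obtain ⟨y, hy⟩ := Finset.card_pos.1 (by omega : 0 < B₂.card)
    refine hρ₂ χ' (by simp) y ⟨by simp [hy], fun d hd => ?_⟩
    rw [hc'.right y hy] at hd ⊢
    rw [hc'.colourCount_insert hxu₂, hc'.colourCount_insert hxu₂, if_neg hc'.ne, if_pos rfl,
      if_neg (Ne.symm hd), if_neg hxb]
    split_ifs <;> omega

/-- For queries of odd size, in the presence of a ball `g` of a third colour: a ball sharing its
colour with the block `R` under one colouring shares it under every colouring compatible with the
same replies. -/
theorem colour_eq_of_block_odd {a : ℕ} (ha : 1 ≤ a) (hans : IsAnswerKind ans)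
    {χ χ' : Fin n → Fin c} {R B : Finset (Fin n)} {r b r' b' : Fin c} {g : Fin n}
    (hR : a + 1 ≤ R.card) (hB : a + 1 ≤ B.card)
    (h : IsBlockPair χ R B r b) (h' : IsBlockPair χ' R B r' b')
    (hgr : χ g ≠ r) (hgb : χ g ≠ b) (hgr' : χ' g ≠ r') (hgb' : χ' g ≠ b') {x : Fin n}
    (hres : ResolvedOn (2 * a + 1) ans {χ, χ'} (insert x (insert g (R ∪ B)))) (hx : χ x = r) :
    χ' x = r' := by
  have hxb' : χ' x = r' ∨ χ' x = b' := by
    by_contra! hne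
    -- The query of `x` with `a` balls from each block has a majority under `χ`, but is tied under
    -- `χ'` if `x` has neither block colour there.
    obtain ⟨R₁, hR₁, hR₁c, hxR₁⟩ := exists_subset_erase hR x
    obtain ⟨B₁, hB₁, hB₁c, hxB₁⟩ := exists_subset_erase hB x
    have hb := h.mono hR₁ hB₁
    have hb' := h'.mono hR₁ hB₁
    have hxu : x ∉ R₁ ∪ B₁ := by simp [hxR₁, hxB₁]
    have hQ : (insert x (R₁ ∪ B₁)).card = 2 * a + 1 := by
      rw [Finset.card_insert_of_notMem hxu, Finset.card_union_of_disjoint hb.disjoint]; omega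
    obtain ⟨ρ, hρ⟩ := hres (insert x (R₁ ∪ B₁)) (Finset.insert_subset_insert _
      ((Finset.union_subset_union hR₁ hB₁).trans (Finset.subset_insert _ _))) hQ
    obtain ⟨w, hw, rfl, -⟩ := hans.reply_of_majority (d := r)
      (by rw [hb.colourCount_insert hxu, hQ, if_pos rfl, if_pos hx]; omega) (hρ χ (by simp))
    have := hans.reply_of_tie hb'.ne
      (by rw [hb'.colourCount_insert hxu, hb'.colourCount_insert hxu]
          simp [hb'.ne, hb'.ne.symm, hne]; omega)
      (fun f hf hf' => by
          rw [hb'.colourCount_insert hxu, hb'.colourCount_insert hxu]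
          simp only [hf.symm, hf'.symm, if_true, if_false]
          split_ifs <;> omega) (hρ χ' (by simp))
    simp at this
  rcases hxb' with hxr | hxb
  · exact hxr
  exfalso
  have hxg : x ≠ g := fun hxg => hgr (hxg ▸ hx)
  -- The ball `g` corrects the parity: with `x`, `g`, `a` balls of `R` and `a - 1` of `B`, colour
  -- `r` has a majority under `χ`, whereas `r'` and `b'` are tied at `a` under `χ'` if `x` has
  -- colour `b'`.
  obtain ⟨R₁, hR₁, hR₁c, hxR₁⟩ := exists_subset_erase hR x
  obtain ⟨B₁, hB₁, hB₁c, hxB₁⟩ := exists_subset_erase (m := a - 1) (R := B) (by omega) x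
  have hb := h.mono hR₁ hB₁
  have hb' := h'.mono hR₁ hB₁
  have hg : g ∉ R₁ ∪ B₁ := by
    rw [Finset.mem_union]
    rintro (hg | hg)
    · exact hgr (hb.left g hg)
    · exact hgb (hb.right g hg)
  have hxu : x ∉ insert g (R₁ ∪ B₁) := by simp [hxg, hxR₁, hxB₁]
  have hQ : (insert x (insert g (R₁ ∪ B₁))).card = 2 * a + 1 := by
    rw [Finset.card_insert_of_notMem hxu, Finset.card_insert_of_notMem hg,
      Finset.card_union_of_disjoint hb.disjoint]; omega
  obtain ⟨ρ, hρ⟩ := hres (insert x (insert g (R₁ ∪ B₁))) (Finset.insert_subset_insert _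
    (Finset.insert_subset_insert _ (Finset.union_subset_union hR₁ hB₁))) hQ
  obtain ⟨w, hw, rfl, -⟩ := hans.reply_of_majority (d := r)
    (by rw [colourCount_insert_of_notMem hxu, hb.colourCount_insert hg, hQ, if_pos rfl, if_pos hx]
        omega) (hρ χ (by simp))
  have := hans.reply_of_tie hb'.ne
    (by rw [colourCount_insert_of_notMem hxu, colourCount_insert_of_notMem hxu,
          hb'.colourCount_insert hg, hb'.colourCount_insert hg]
        simp [hb'.ne, hb'.ne.symm, hgr', hgb', hxb]; omega)
    (fun f hf hf' => by
        rw [colourCount_insert_of_notMem hxu, colourCount_insert_of_notMem hxu,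
          hb'.colourCount_insert hg, hb'.colourCount_insert hg]
        simp only [hf.symm, hf'.symm, hxb, if_true, if_false]
        split_ifs <;> omega) (hρ χ' (by simp))
  simp at this

end blocks

/-! ### Rich colourings determine all frequent classes. -/

section rich

variable {n c q : ℕ} {ans : BallKind n c} {Γ : Set (Fin n → Fin c)}

theorem isAnswerKind_of_eq (hans : ans = IsMajorityBall ∨ ans = IsPluralityBall) :
    IsAnswerKind ans := by
  rcases hans with rfl | rfl
  · exact isAnswerKind_majority
  · exact isAnswerKind_plurality

/-- Two colours that are frequent in `S` (and, for odd `q`, accompanied by a third colour) have the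
same classes under all colourings compatible with the same replies. -/
theorem exists_same_classes (hans : ans = IsMajorityBall ∨ ans = IsPluralityBall) (hq : 2 ≤ q)
    {L : ℕ} (hL : c * (q + 1) ≤ L) (hL0 : 0 < L) {S : Finset (Fin n)}
    (hres : ∀ x, ResolvedOn q ans Γ (insert x S)) {χ χ' : Fin n → Fin c} (hχ : χ ∈ Γ) (hχ' : χ' ∈ Γ)
    {r b : Fin c} (hrb : r ≠ b) (hr : L ≤ colourCount χ S r) (hb : L ≤ colourCount χ S b)
    (hodd : Odd q → ∃ g ∈ S, χ g ≠ r ∧ χ g ≠ b) :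
    ∃ r' b', r' ≠ b' ∧ (∀ y, χ y = r ↔ χ' y = r') ∧ ∀ y, χ y = b ↔ χ' y = b' := by
  have hkind := isAnswerKind_of_eq hans
  -- The hypothesis `c * (q + 1) ≤ L` lets the pigeonhole principle pick, inside each of the two
  -- classes of `χ`, a block of `q + 1` balls that is monochromatic under `χ'` too.
  obtain ⟨R, hRS, hRc, r', hr'⟩ := exists_monochromatic χ' (hL.trans hr) (by unfold colourCount at hr; omega)
  obtain ⟨B, hBS, hBc, b', hb'⟩ := exists_monochromatic χ' (hL.trans hb) (by unfold colourCount at hb; omega)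
  have hblock : IsBlockPair χ R B r b :=
    ⟨fun x hx => (Finset.mem_filter.1 (hRS hx)).2, fun x hx => (Finset.mem_filter.1 (hBS hx)).2, hrb⟩
  have hRBS : R ∪ B ⊆ S := Finset.union_subset (hRS.trans (Finset.filter_subset _ _))
    (hBS.trans (Finset.filter_subset _ _))
  have hpair : ({χ, χ'} : Set (Fin n → Fin c)) ⊆ Γ := by
    rintro ψ (rfl | rfl) <;> assumption
  have hpair' : ({χ', χ} : Set (Fin n → Fin c)) ⊆ Γ := by
    rintro ψ (rfl | rfl) <;> assumption
  rcases Nat.even_or_odd' q with ⟨a, rfl | rfl⟩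
  · have hne : r' ≠ b' := by
      rintro rfl
      -- A balanced query from the blocks is answered NO because of `χ`, which is wrong for `χ'` if
      -- the blocks have equal colours there.
      obtain ⟨R₁, hR₁, hR₁c⟩ := Finset.exists_subset_card_eq (show a ≤ R.card by omega)
      obtain ⟨B₁, hB₁, hB₁c⟩ := Finset.exists_subset_card_eq (show a ≤ B.card by omega)
      have hb₁ := hblock.mono hR₁ hB₁
      have hQ : (R₁ ∪ B₁).card = 2 * a := by
        rw [Finset.card_union_of_disjoint hb₁.disjoint]; omega
      obtain ⟨x, -⟩ := Finset.card_pos.1 (show 0 < R.card by omega)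
      obtain ⟨ρ, hρ⟩ := hres x (R₁ ∪ B₁)
        (((Finset.union_subset_union hR₁ hB₁).trans hRBS).trans (Finset.subset_insert _ _)) hQ
      have h₁ := hkind.reply_of_tie hrb
        (by rw [hb₁.colourCount_union, hb₁.colourCount_union]; simp [hrb, hrb.symm]; omega)
        (fun f hf hf' => by
          rw [hb₁.colourCount_union, hb₁.colourCount_union]; simp [hf.symm, hf'.symm])
        (hρ χ hχ)
      have h₂ : ∀ x ∈ R₁ ∪ B₁, χ' x = r' := by
        intro x hx
        rcases Finset.mem_union.1 hx with hx | hx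
        · exact hr' x (hR₁ hx)
        · exact hb' x (hB₁ hx)
      obtain ⟨w, -, hw, -⟩ := hkind.reply_of_majority (d := r')
        (by rw [colourCount_eq_card h₂]; omega) (hρ χ' hχ')
      simp [h₁] at hw
    have hblock' : IsBlockPair χ' R B r' b' := ⟨hr', hb', hne⟩
    have hres' : ∀ x, ResolvedOn (2 * a) ans Γ (insert x (R ∪ B)) := fun x =>
      (hres x).subset (Finset.insert_subset_insert _ hRBS)
    have hcomm : ∀ x, ResolvedOn (2 * a) ans Γ (insert x (B ∪ R)) := fun x => by
      rw [Finset.union_comm]; exact hres' x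
    refine ⟨r', b', hne, fun y => ⟨fun hy => ?_, fun hy => ?_⟩, fun y => ⟨fun hy => ?_, fun hy => ?_⟩⟩
    · exact colour_eq_of_block_even (by omega) hans (by omega) (by omega) hblock hblock'
        ((hres' y).mono hpair) hy
    · exact colour_eq_of_block_even (by omega) hans (by omega) (by omega) hblock' hblock
        ((hres' y).mono hpair') hy
    · exact colour_eq_of_block_even (by omega) hans (by omega) (by omega) hblock.symm hblock'.symm
        ((hcomm y).mono hpair) hy
    · exact colour_eq_of_block_even (by omega) hans (by omega) (by omega) hblock'.symm hblock.symm
        ((hcomm y).mono hpair') hy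
  · obtain ⟨g, hgS, hgr, hgb⟩ := hodd ⟨a, rfl⟩
    -- The query of `g` with `a` balls from each block is tied under `χ`, hence answered NO and
    -- without majority under `χ'`. Any coincidence among `r'`, `b'` and `χ' g` would create a
    -- majority, so the three are distinct.
    obtain ⟨R₁, hR₁, hR₁c⟩ := Finset.exists_subset_card_eq (show a ≤ R.card by omega)
    obtain ⟨B₁, hB₁, hB₁c⟩ := Finset.exists_subset_card_eq (show a ≤ B.card by omega)
    have hb₁ := hblock.mono hR₁ hB₁
    have hg : g ∉ R₁ ∪ B₁ := by
      rw [Finset.mem_union]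
      rintro (hg | hg)
      · exact hgr (hb₁.left g hg)
      · exact hgb (hb₁.right g hg)
    have hQ : (insert g (R₁ ∪ B₁)).card = 2 * a + 1 := by
      rw [Finset.card_insert_of_notMem hg, Finset.card_union_of_disjoint hb₁.disjoint]; omega
    obtain ⟨ρ, hρ⟩ := hres g (insert g (R₁ ∪ B₁)) (Finset.insert_subset_insert _
      ((Finset.union_subset_union hR₁ hB₁).trans hRBS)) hQ
    have hnone := hkind.reply_of_tie hrb
      (by rw [hb₁.colourCount_insert hg, hb₁.colourCount_insert hg]
          simp [hrb, hrb.symm, hgr, hgb]; omega)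
      (fun f hf hf' => by
        rw [hb₁.colourCount_insert hg, hb₁.colourCount_insert hg]
        simp only [hf.symm, hf'.symm, if_true, if_false]
        split_ifs <;> omega)
      (hρ χ hχ)
    have hmaj : ∀ d, ¬ (insert g (R₁ ∪ B₁)).card < 2 * colourCount χ' (insert g (R₁ ∪ B₁)) d := by
      intro d hd
      obtain ⟨w, -, hw, -⟩ := hkind.reply_of_majority hd (hρ χ' hχ')
      simp [hnone] at hw
    have hcount : ∀ d, colourCount χ' (insert g (R₁ ∪ B₁)) d =
        (if r' = d then a else 0) + (if b' = d then a else 0) + if χ' g = d then 1 else 0 := by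
      intro d
      rw [colourCount_insert_of_notMem hg, colourCount_union_of_disjoint hb₁.disjoint,
        colourCount_of_mono fun x hx => hr' x (hR₁ hx),
        colourCount_of_mono fun x hx => hb' x (hB₁ hx), hR₁c, hB₁c]
    have hne : r' ≠ b' := by
      rintro rfl
      refine hmaj r' ?_
      rw [hcount, hQ]; simp; omega
    have hgr' : χ' g ≠ r' := by
      intro h
      refine hmaj r' ?_
      rw [hcount, hQ]; simp [h]; omega
    have hgb' : χ' g ≠ b' := by
      intro h
      refine hmaj b' ?_
      rw [hcount, hQ]; simp [h]; omega
    have hblock' : IsBlockPair χ' R B r' b' := ⟨hr', hb', hne⟩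
    have hres' : ∀ x, ResolvedOn (2 * a + 1) ans Γ (insert x (insert g (R ∪ B))) := fun x =>
      (hres x).subset (Finset.insert_subset_insert _ (Finset.insert_subset hgS hRBS))
    have hcomm : ∀ x, ResolvedOn (2 * a + 1) ans Γ (insert x (insert g (B ∪ R))) := fun x => by
      rw [Finset.union_comm]; exact hres' x
    refine ⟨r', b', hne, fun y => ⟨fun hy => ?_, fun hy => ?_⟩, fun y => ⟨fun hy => ?_, fun hy => ?_⟩⟩
    · exact colour_eq_of_block_odd (by omega) hkind (by omega) (by omega) hblock hblock'
        hgr hgb hgr' hgb' ((hres' y).mono hpair) hy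
    · exact colour_eq_of_block_odd (by omega) hkind (by omega) (by omega) hblock' hblock
        hgr' hgb' hgr hgb ((hres' y).mono hpair') hy
    · exact colour_eq_of_block_odd (by omega) hkind (by omega) (by omega) hblock.symm hblock'.symm
        hgb hgr hgb' hgr' ((hcomm y).mono hpair) hy
    · exact colour_eq_of_block_odd (by omega) hkind (by omega) (by omega) hblock'.symm hblock.symm
        hgb' hgr' hgb hgr ((hcomm y).mono hpair') hy

/-- Two colours are frequent in `S` and, for odd `q`, a third colour occurs in `S`. -/
def IsRich (q L : ℕ) (S : Finset (Fin n)) (χ : Fin n → Fin c) : Prop :=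
  ∃ r b, r ≠ b ∧ L ≤ colourCount χ S r ∧ L ≤ colourCount χ S b ∧
    (Odd q → ∃ g ∈ S, χ g ≠ r ∧ χ g ≠ b)

/-- Richness of one possible colouring passes to all others, since the two frequent classes and the
third ball are preserved. Then any class of size at least `L` can be paired with another frequent
one and compared between any two colourings. -/
theorem agree_of_isRich (hans : ans = IsMajorityBall ∨ ans = IsPluralityBall) (hq : 2 ≤ q)
    {L : ℕ} (hL : c * (q + 1) ≤ L) (hL0 : 0 < L) {S : Finset (Fin n)}
    (hcore : IsCore L Γ S Finset.univ) (hres : ∀ x, ResolvedOn q ans Γ (insert x S))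
    {χ₀ : Fin n → Fin c} (hχ₀ : χ₀ ∈ Γ) (hrich : IsRich q L S χ₀) : Agree L Γ := by
  have hall : ∀ χ' ∈ Γ, IsRich q L S χ' := by
    intro χ' hχ'
    obtain ⟨r, b, hrb, hr, hb, hodd⟩ := hrich
    obtain ⟨r', b', hne, hr', hb'⟩ :=
      exists_same_classes hans hq hL hL0 hres hχ₀ hχ' hrb hr hb hodd
    refine ⟨r', b', hne, ?_, ?_, fun ho => ?_⟩
    · unfold colourCount at *; simpa only [hr'] using hr
    · unfold colourCount at *; simpa only [hb'] using hb
    · obtain ⟨g, hg, h₁, h₂⟩ := hodd ho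
      exact ⟨g, hg, fun h => h₁ ((hr' g).2 h), fun h => h₂ ((hb' g).2 h)⟩
  intro χ hχ χ' hχ' x hx y
  have hxS : L ≤ colourCount χ S (χ x) := by
    have := hcore χ hχ (χ x)
    omega
  obtain ⟨e, hne, he, hodd⟩ : ∃ e, χ x ≠ e ∧ L ≤ colourCount χ S e ∧
      (Odd q → ∃ g ∈ S, χ g ≠ χ x ∧ χ g ≠ e) := by
    obtain ⟨r, b, hrb, hr, hb, hodd⟩ := hall χ hχ
    by_cases hxr : χ x = r
    · subst hxr
      exact ⟨b, hrb, hb, hodd⟩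
    by_cases hxb : χ x = b
    · subst hxb
      exact ⟨r, hxr, hr, fun ho => (hodd ho).imp fun g hg => ⟨hg.1, hg.2.2, hg.2.1⟩⟩
    -- If the colour of `x` is a third one, it is paired with `r`, and a ball of colour `b` serves
    -- as the ball of a further colour.
    · obtain ⟨g, hg, hgb⟩ := colourCount_pos.1 (hL0.trans_le hb)
      exact ⟨r, hxr, hr, fun _ => ⟨g, hg, hgb ▸ Ne.symm hxb, hgb ▸ hrb.symm⟩⟩
  obtain ⟨r', b', -, hr', -⟩ := exists_same_classes hans hq hL hL0 hres hχ hχ' hne hxS he hodd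
  rw [hr' y, ← (hr' x).1 rfl]

end rich

/-! ### Families of 0-1 functions with common majority elements. -/

section twoColours

variable {ι α : Type*}

/-- The number of elements of `Q` with value `b` under `f`. -/
def boolCount (f : α → Bool) (Q : Finset α) (b : Bool) : ℕ :=
  (Q.filter fun y => f y = b).card

/-- `u ∈ Q` has the majority value in `Q` under each of the functions `v i`. -/
def IsSureMajority (v : ι → α → Bool) (Q : Finset α) (u : α) : Prop :=
  u ∈ Q ∧ ∀ i, Q.card < 2 * boolCount (v i) Q (v i u)

/-- Every subset of `S` of size `2 * a + 1` contains a sure majority element. -/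
def HasMajorities (v : ι → α → Bool) (a : ℕ) (S : Finset α) : Prop :=
  ∀ Q ⊆ S, Q.card = 2 * a + 1 → ∃ u, IsSureMajority v Q u

/-- Both values are taken exactly `a` times on `W`, under each of the functions `v i`. -/
def IsBalanced (v : ι → α → Bool) (a : ℕ) (W : Finset α) : Prop :=
  W.card = 2 * a ∧ ∀ i b, boolCount (v i) W b = a

theorem boolCount_add_not (f : α → Bool) (Q : Finset α) (b : Bool) :
    boolCount f Q b + boolCount f Q (!b) = Q.card := by
  unfold boolCount
  rw [← Finset.card_filter_add_card_filter_not (s := Q) (fun y => f y = b)]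
  congr 3
  ext y
  cases f y <;> cases b <;> simp

theorem boolCount_mono (f : α → Bool) {Q R : Finset α} (h : Q ⊆ R) (b : Bool) :
    boolCount f Q b ≤ boolCount f R b :=
  Finset.card_le_card (Finset.filter_subset_filter _ h)

theorem card_le_boolCount (f : α → Bool) {Q R : Finset α} (h : Q ⊆ R) {b : Bool}
    (hb : ∀ x ∈ Q, f x = b) : Q.card ≤ boolCount f R b :=
  Finset.card_le_card fun x hx => Finset.mem_filter.2 ⟨h hx, hb x hx⟩

theorem HasMajorities.subset {v : ι → α → Bool} {a : ℕ} {S T : Finset α} (h : HasMajorities v a S) (hT : T ⊆ S) :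
    HasMajorities v a T :=
  fun Q hQ => h Q (hQ.trans hT)

variable [DecidableEq α]

theorem boolCount_insert (f : α → Bool) {Q : Finset α} {x : α} (hx : x ∉ Q) (b : Bool) :
    boolCount f (insert x Q) b = boolCount f Q b + if f x = b then 1 else 0 := by
  unfold boolCount
  rw [Finset.filter_insert]
  split_ifs with h
  · exact Finset.card_insert_of_notMem fun h' => hx (Finset.mem_filter.1 h').1
  · rfl

theorem boolCount_erase (f : α → Bool) {Q : Finset α} {x : α} (hx : x ∈ Q) (b : Bool) :
    boolCount f Q b = boolCount f (Q.erase x) b + if f x = b then 1 else 0 := by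
  rw [← boolCount_insert f (Finset.notMem_erase x Q), Finset.insert_erase hx]

theorem boolCount_union (f : α → Bool) {Q R : Finset α} (h : Disjoint Q R) (b : Bool) :
    boolCount f (Q ∪ R) b = boolCount f Q b + boolCount f R b := by
  unfold boolCount
  rw [Finset.filter_union, Finset.card_union_of_disjoint (Finset.disjoint_filter_filter h)]

variable {v : ι → α → Bool} {a : ℕ} {S : Finset α}

/-- Sure majority elements are removed one at a time until `2 * a` elements remain. The value of a
removed element was taken at least `a + 1` times, so both values keep at least `a` occurrences. -/
theorem HasMajorities.exists_balanced (h : HasMajorities v a S) (hS : 2 * a ≤ S.card)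
    (hcount : ∀ i b, a ≤ boolCount (v i) S b) : ∃ W ⊆ S, IsBalanced v a W := by
  induction hk : S.card - 2 * a generalizing S with
  | zero =>
    refine ⟨S, subset_rfl, by omega, fun i b => ?_⟩
    have h₁ := hcount i b
    have h₂ := hcount i (!b)
    have h₃ := boolCount_add_not (v i) S b
    omega
  | succ k ih =>
    obtain ⟨Q, hQS, hQ⟩ := Finset.exists_subset_card_eq (show 2 * a + 1 ≤ S.card by omega)
    obtain ⟨u, huQ, hu⟩ := h Q hQS hQ
    have huS := hQS huQ
    obtain ⟨W, hW, hb⟩ := ih (S := S.erase u) (h.subset (Finset.erase_subset _ _))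
      (by rw [Finset.card_erase_of_mem huS]; omega)
      (fun i b => by
        have h₁ := boolCount_erase (v i) huS b
        have h₂ := hcount i b
        split_ifs at h₁ with hub
        · have h₃ := hu i
          rw [hub] at h₃
          have h₄ := boolCount_mono (v i) hQS b
          omega
        · omega)
      (by rw [Finset.card_erase_of_mem huS]; omega)
    exact ⟨W, hW.trans (Finset.erase_subset _ _), hb⟩

/-- The majority value in a balanced set with `w` replaced by `x` and `y`. -/
theorem IsBalanced.exists_gate {W : Finset α} (hW : IsBalanced v a W) (hWS : W ⊆ S)
    (h : HasMajorities v a S) {w x y : α} (hw : w ∈ W) (hx : x ∉ W) (hy : y ∉ W) (hxy : x ≠ y)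
    (hxS : x ∈ S) (hyS : y ∈ S) :
    ∃ u, (u = x ∨ u = y ∨ u ∈ W ∧ u ≠ w) ∧
      ∀ i, v i u = v i w ↔ v i x = v i w ∧ v i y = v i w := by
  have hy' : y ∉ W.erase w := fun h => hy (Finset.mem_of_mem_erase h)
  have hx' : x ∉ insert y (W.erase w) := by
    simp only [Finset.mem_insert, not_or]
    exact ⟨hxy, fun h => hx (Finset.mem_of_mem_erase h)⟩
  have hpos : 0 < W.card := Finset.card_pos.2 ⟨w, hw⟩
  have hcard : (insert x (insert y (W.erase w))).card = 2 * a + 1 := by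
    rw [Finset.card_insert_of_notMem hx', Finset.card_insert_of_notMem hy',
      Finset.card_erase_of_mem hw]
    have := hW.1
    omega
  obtain ⟨u, hu, hmaj⟩ := h (insert x (insert y (W.erase w)))
    (Finset.insert_subset hxS (Finset.insert_subset hyS ((Finset.erase_subset _ _).trans hWS))) hcard
  refine ⟨u, ?_, fun i => ?_⟩
  · simp only [Finset.mem_insert, Finset.mem_erase] at hu
    tauto
  -- Without `w` the value of `w` occurs `a - 1` times and the other one `a` times, so it wins among
  -- `2 * a + 1` elements only with both `x` and `y`.
  · have h₁ := hmaj i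
    have h₂ := hW.2 i (v i u)
    rw [hcard, boolCount_insert _ hx', boolCount_insert _ hy'] at h₁
    rw [boolCount_erase _ hw] at h₂
    constructor
    · intro huw
      rw [huw] at h₁ h₂
      rw [if_pos rfl] at h₂
      split_ifs at h₁ <;> first | omega | exact ⟨by assumption, by assumption⟩
    · rintro ⟨hxw, hyw⟩
      by_contra hne
      rw [hxw, hyw, if_neg (Ne.symm hne)] at h₁
      omega

/-- The invariant of the conjunction argument: `t` agrees with `r` exactly if all elements of `I`
do. -/
structure IsMeet (v : ι → α → Bool) (a : ℕ) (S W' : Finset α) (r : α) (W : Finset α) (t : α)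
    (I : Finset α) : Prop where
  balanced : IsBalanced v a W
  subset : W ⊆ S
  mem : r ∈ W
  mem_t : t ∈ S
  notMem : t ∉ W
  sub : I ⊆ W'
  disj : Disjoint (W' \ I) W
  notMem' : t ∉ W' \ I
  meet : ∀ i, v i t = v i r ↔ ∀ x ∈ I, v i x = v i r

/-- Replacing `r` by `t` and `x` gives an element `u` that computes the conjunction of `t` and `x`
relative to `r`. It can serve as the new `t` unless it lies in `W`. In that case a second gate, at
`u`, gives an element `u'`, and either `u` can be freed from `W` or one learns that `t` or `x`
always agrees with `r`. -/
theorem IsMeet.step {W' W I : Finset α} {r t x : α} (hS : HasMajorities v a S) (hW' : W' ⊆ S)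
    (h : IsMeet v a S W' r W t I) (hx : x ∈ W' \ I) :
    (∃ W₁ t₁, IsMeet v a S W' r W₁ t₁ (insert x I)) ∨ ∀ i, v i t = v i r ∨ v i x = v i r := by
  have hxW : x ∉ W := Finset.disjoint_left.1 h.disj hx
  have hxW' := (Finset.mem_sdiff.1 hx).1
  have hxS := hW' hxW'
  have htx : t ≠ x := fun e => h.notMem' (e ▸ hx)
  have hsub : insert x I ⊆ W' := Finset.insert_subset hxW' h.sub
  have hsd : W' \ insert x I ⊆ W' \ I := Finset.sdiff_subset_sdiff subset_rfl (Finset.subset_insert _ _)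
  have hmeet : ∀ s, (∀ i, v i s = v i r ↔ v i t = v i r ∧ v i x = v i r) →
      ∀ i, v i s = v i r ↔ ∀ y ∈ insert x I, v i y = v i r := by
    intro s hs i
    rw [hs i, Finset.forall_mem_insert, h.meet i, and_comm]
  have hkeep : ∀ s, s = t ∨ s = x → (∀ i, v i s = v i r ↔ v i t = v i r ∧ v i x = v i r) →
      ∃ W₁ t₁, IsMeet v a S W' r W₁ t₁ (insert x I) := by
    intro s hs hm
    refine ⟨W, s, h.balanced, h.subset, h.mem, ?_, ?_, hsub, h.disj.mono_left hsd, ?_, hmeet s hm⟩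
    · rcases hs with rfl | rfl
      · exact h.mem_t
      · exact hxS
    · rcases hs with rfl | rfl
      · exact h.notMem
      · exact hxW
    · rcases hs with rfl | rfl
      · exact fun h' => h.notMem' (hsd h')
      · simp
  obtain ⟨u, hu, hum⟩ := h.balanced.exists_gate h.subset hS h.mem h.notMem hxW htx h.mem_t hxS
  rcases hu with rfl | rfl | ⟨huW, hur⟩
  · exact Or.inl (hkeep _ (Or.inl rfl) hum)
  · exact Or.inl (hkeep _ (Or.inr rfl) hum)
  obtain ⟨u', hu', hum'⟩ := h.balanced.exists_gate h.subset hS huW h.notMem hxW htx h.mem_t hxS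
  rcases hu' with rfl | rfl | ⟨hu'W, hu'u⟩
  · refine Or.inl (hkeep x (Or.inr rfl) fun i => ?_)
    have h₁ := hum i
    have h₂ := hum' i
    revert h₁ h₂
    cases v i u' <;> cases v i x <;> cases v i u <;> cases v i r <;> simp
  · refine Or.inl (hkeep t (Or.inl rfl) fun i => ?_)
    have h₁ := hum i
    have h₂ := hum' i
    revert h₁ h₂
    cases v i u' <;> cases v i t <;> cases v i u <;> cases v i r <;> simp
  -- If `t` and `x` both differed from `r`, then `u` would have their common value, and so would
  -- `u'`. Hence `u' = r` excludes this.
  by_cases hu'r : u' = r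
  · right
    intro i
    have h₁ := hum i
    have h₂ := hum' i
    rw [hu'r] at h₂
    revert h₁ h₂
    cases v i t <;> cases v i x <;> cases v i u <;> cases v i r <;> simp
  left
  have hu'W₀ : u' ∈ W.erase u := Finset.mem_erase.2 ⟨hu'u, hu'W⟩
  have ht' : t ∉ (W.erase u).erase u' := fun h' =>
    h.notMem (Finset.mem_of_mem_erase (Finset.mem_of_mem_erase h'))
  have hx' : x ∉ insert t ((W.erase u).erase u') := by
    simp only [Finset.mem_insert, not_or]
    exact ⟨htx.symm, fun h' => hxW (Finset.mem_of_mem_erase (Finset.mem_of_mem_erase h'))⟩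
  -- Relative to `r`, `u` is the conjunction and `u'` the disjunction of `t` and `x`, so both pairs
  -- have the same multiset of values. Exchanging them keeps `W` balanced and frees `u`.
  refine ⟨insert x (insert t ((W.erase u).erase u')), u, ⟨?_, ?_⟩, ?_, ?_, h.subset huW, ?_, hsub, ?_,
    ?_, hmeet u hum⟩
  · have h₁ := h.balanced.1
    have h₂ := Finset.card_pos.2 ⟨_, hu'W₀⟩
    rw [Finset.card_erase_of_mem huW] at h₂
    rw [Finset.card_insert_of_notMem hx', Finset.card_insert_of_notMem ht',
      Finset.card_erase_of_mem hu'W₀, Finset.card_erase_of_mem huW]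
    omega
  · intro i b
    have h₁ := hum i
    have h₂ := hum' i
    have h₃ := h.balanced.2 i b
    rw [boolCount_erase _ huW, boolCount_erase _ hu'W₀] at h₃
    rw [boolCount_insert _ hx', boolCount_insert _ ht']
    revert h₁ h₂ h₃
    cases v i t <;> cases v i x <;> cases v i u <;> cases v i u' <;> cases v i r <;> cases b <;>
      simp
  · refine Finset.insert_subset hxS (Finset.insert_subset h.mem_t ?_)
    exact ((Finset.erase_subset _ _).trans (Finset.erase_subset _ _)).trans h.subset
  · simp only [Finset.mem_insert, Finset.mem_erase]
    exact Or.inr (Or.inr ⟨Ne.symm hu'r, Ne.symm hur, h.mem⟩)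
  · simp only [Finset.mem_insert, Finset.mem_erase, not_or]
    refine ⟨fun e => hxW (e ▸ huW), fun e => h.notMem (e ▸ huW), by simp⟩
  · rw [Finset.disjoint_left]
    intro y hy hy'
    have hyI := hsd hy
    simp only [Finset.mem_insert, Finset.mem_erase] at hy'
    rcases hy' with rfl | rfl | ⟨-, -, hyW⟩
    · simp at hy
    · exact h.notMem' hyI
    · exact Finset.disjoint_left.1 h.disj hyI hyW
  · exact fun h' => Finset.disjoint_left.1 h.disj (hsd h') huW

/-- The set `I` is enlarged while possible. When stuck, `t` or `x` always agrees with `r`, for every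
remaining `x`; so either all of `I` or all of `W' \ I` agrees with `r`. As `W'` is balanced, the
agreeing part has at most `a` elements, and comparing `I.card` with `a` settles each case. -/
theorem IsMeet.exists_opposite {W' : Finset α} {r : α} (ha : 1 ≤ a) (hS : HasMajorities v a S)
    (hW' : W' ⊆ S) (hbal : IsBalanced v a W') {W I : Finset α} {t : α}
    (h : IsMeet v a S W' r W t I) : ∃ p ∈ S, ∃ m ∈ S, ∀ i, v i p ≠ v i m := by
  induction hk : (W' \ I).card using Nat.strong_induction_on generalizing W t I with
  | _ k ih =>
  have hnext : ∀ x ∈ W' \ I, ∀ W₁ t₁, IsMeet v a S W' r W₁ t₁ (insert x I) →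
      ∃ p ∈ S, ∃ m ∈ S, ∀ i, v i p ≠ v i m := by
    intro x hx W₁ t₁ h₁
    refine ih _ ?_ h₁ rfl
    rw [← hk]
    refine Finset.card_lt_card (Finset.ssubset_iff_of_subset
      (Finset.sdiff_subset_sdiff subset_rfl (Finset.subset_insert _ _)) |>.2 ⟨x, hx, by simp⟩)
  by_cases hgood : ∃ x ∈ W' \ I, ∃ W₁ t₁, IsMeet v a S W' r W₁ t₁ (insert x I)
  · obtain ⟨x, hx, W₁, t₁, h₁⟩ := hgood
    exact hnext x hx W₁ t₁ h₁
  have hbad : ∀ x ∈ W' \ I, ∀ i, v i t = v i r ∨ v i x = v i r := fun x hx =>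
    (h.step hS hW' hx).resolve_left fun h' => hgood ⟨x, hx, h'⟩
  have hcard : I.card + (W' \ I).card = 2 * a := by
    rw [← hbal.1, add_comm]
    exact Finset.card_sdiff_add_card_eq_card h.sub
  have hI : ∀ i, v i t = v i r → I.card ≤ a := fun i hi => by
    rw [← hbal.2 i (v i r)]
    exact card_le_boolCount _ h.sub ((h.meet i).1 hi)
  have hJ : ∀ i, v i t ≠ v i r → (W' \ I).card ≤ a := fun i hi => by
    rw [← hbal.2 i (v i r)]
    exact card_le_boolCount _ Finset.sdiff_subset fun x hx => (hbad x hx i).resolve_left hi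
  rcases lt_trichotomy I.card a with hlt | heq | hgt
  -- The complement of `I` is too large to agree with `r` throughout, so `t` always agrees with `r`,
  -- and so does all of `I`. Then the conjunction over `insert x I` is `x` itself, and the induction
  -- continues.
  · obtain ⟨x, hx⟩ := Finset.card_pos.1 (show 0 < (W' \ I).card by omega)
    have ht : ∀ i, v i t = v i r := fun i => by
      by_contra hi
      have := hJ i hi
      omega
    have hsd : W' \ insert x I ⊆ W' \ I :=
      Finset.sdiff_subset_sdiff subset_rfl (Finset.subset_insert _ _)
    have hxW' := (Finset.mem_sdiff.1 hx).1
    refine hnext x hx W x ⟨h.balanced, h.subset, h.mem, hW' hxW',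
      Finset.disjoint_left.1 h.disj hx, Finset.insert_subset hxW' h.sub, h.disj.mono_left hsd,
      by simp, fun i => ?_⟩
    rw [Finset.forall_mem_insert]
    exact ⟨fun hi => ⟨hi, (h.meet i).1 (ht i)⟩, fun hi => hi.1⟩
  -- Now `I` and its complement are always the two value classes of `W'`.
  · obtain ⟨p, hp⟩ := Finset.card_pos.1 (show 0 < I.card by omega)
    obtain ⟨m, hm⟩ := Finset.card_pos.1 (show 0 < (W' \ I).card by omega)
    have hm' := Finset.mem_sdiff.1 hm
    refine ⟨p, hW' (h.sub hp), m, hW' hm'.1, fun i hpm => ?_⟩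
    by_cases hi : v i t = v i r
    · have hpr := (h.meet i).1 hi p hp
      have h₁ : (insert m I).card ≤ boolCount (v i) W' (v i r) := by
        refine card_le_boolCount _ (Finset.insert_subset hm'.1 h.sub) ?_
        rw [Finset.forall_mem_insert]
        exact ⟨hpm ▸ hpr, (h.meet i).1 hi⟩
      rw [hbal.2, Finset.card_insert_of_notMem hm'.2] at h₁
      omega
    · have hmr := (hbad m hm i).resolve_left hi
      have h₁ : (insert p (W' \ I)).card ≤ boolCount (v i) W' (v i r) := by
        refine card_le_boolCount _ (Finset.insert_subset (h.sub hp) Finset.sdiff_subset) ?_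
        rw [Finset.forall_mem_insert]
        exact ⟨hpm ▸ hmr, fun x hx => (hbad x hx i).resolve_left hi⟩
      rw [hbal.2, Finset.card_insert_of_notMem (by simp [hp])] at h₁
      omega
  -- Here `I` is too large to agree with `r` throughout, so `t` is always opposite to `r`.
  · refine ⟨t, h.mem_t, r, h.subset h.mem, fun i hi => ?_⟩
    have := hI i hi
    omega

/-- If both values are frequent in `S`, then some two elements of `S` always have different
values. -/
theorem HasMajorities.exists_opposite (ha : 1 ≤ a) (h : HasMajorities v a S)
    (hS : 4 * a ≤ S.card) (hcount : ∀ i b, 2 * a ≤ boolCount (v i) S b) :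
    ∃ p ∈ S, ∃ m ∈ S, ∀ i, v i p ≠ v i m := by
  obtain ⟨W, hWS, hW⟩ := h.exists_balanced (by omega) fun i b => by have := hcount i b; omega
  obtain ⟨W', hW'S, hW'⟩ := (h.subset (T := S \ W) Finset.sdiff_subset).exists_balanced
    (by
      have h₁ := Finset.card_sdiff_add_card_eq_card hWS
      have h₂ := hW.1
      omega)
    fun i b => by
      have h₁ := boolCount_union (v i) (Finset.sdiff_disjoint (s := W) (t := S)) b
      rw [Finset.sdiff_union_of_subset hWS, hW.2] at h₁
      have h₂ := hcount i b
      omega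
  obtain ⟨r, hr⟩ := Finset.card_pos.1 (show 0 < W.card by have := hW.1; omega)
  obtain ⟨x, hx⟩ := Finset.card_pos.1 (show 0 < W'.card by have := hW'.1; omega)
  have hdisj : Disjoint W' W := Finset.disjoint_of_subset_left hW'S Finset.sdiff_disjoint
  have hW'S' := hW'S.trans Finset.sdiff_subset
  refine IsMeet.exists_opposite (r := r) (W := W) (t := x) (I := {x}) ha h hW'S' hW' ?_
  exact ⟨hW, hWS, hr, hW'S' hx, Finset.disjoint_left.1 hdisj hx, by simpa using hx,
    hdisj.mono_left Finset.sdiff_subset, by simp, fun i => by simp⟩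

/-- Many disjoint pairs of elements of `S` that always have different values. -/
theorem HasMajorities.exists_opposite_pairs [Nonempty ι] (ha : 1 ≤ a) (k : ℕ)
    (h : HasMajorities v a S) (hS : 4 * a + 2 * k ≤ S.card)
    (hcount : ∀ i b, 2 * a + k ≤ boolCount (v i) S b) :
    ∃ e : ℕ → Bool → α, (∀ j < k, ∀ b, e j b ∈ S) ∧
      (∀ j < k, ∀ j' < k, ∀ b b', e j b = e j' b' → j = j' ∧ b = b') ∧
      ∀ j < k, ∀ i, v i (e j false) = !v i (e j true) := by
  induction k generalizing S with
  | zero =>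
    obtain ⟨x, -⟩ := Finset.card_pos.1 (show 0 < S.card by omega)
    exact ⟨fun _ _ => x, by simp, by simp, by simp⟩
  | succ k ih =>
    obtain ⟨p, hp, m, hm, hpm⟩ := h.exists_opposite ha (by omega)
      fun i b => by have := hcount i b; omega
    obtain ⟨i₀⟩ := ‹Nonempty ι›
    have hne : m ≠ p := fun e => hpm i₀ (e ▸ rfl)
    have hm' : m ∈ S.erase p := Finset.mem_erase.2 ⟨hne, hm⟩
    have hsub : (S.erase p).erase m ⊆ S := (Finset.erase_subset _ _).trans (Finset.erase_subset _ _)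
    obtain ⟨e, heS, hinj, hopp⟩ := ih (h.subset hsub)
      (by rw [Finset.card_erase_of_mem hm', Finset.card_erase_of_mem hp]; omega)
      fun i b => by
        have h₁ := hcount i b
        rw [boolCount_erase _ hp, boolCount_erase _ hm'] at h₁
        have h₂ := hpm i
        revert h₁ h₂
        cases v i p <;> cases v i m <;> cases b <;> simp <;> omega
    have hout : ∀ j < k, ∀ b, e j b ≠ p ∧ e j b ≠ m := fun j hj b => by
      have := heS j hj b
      simp only [Finset.mem_erase] at this
      exact ⟨this.2.1, this.1⟩
    refine ⟨fun j b => if j = k then (if b then p else m) else e j b, ?_, ?_, ?_⟩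
    · intro j hj b
      by_cases hjk : j = k
      · cases b <;> simp [hjk, hp, hm]
      · simpa [hjk] using hsub (heS j (by omega) b)
    · intro j hj j' hj' b b' heq
      by_cases hjk : j = k <;> by_cases hjk' : j' = k
      · refine ⟨hjk.trans hjk'.symm, ?_⟩
        simp only [hjk, hjk', if_true] at heq
        revert heq
        cases b <;> cases b' <;> simp [hne, hne.symm]
      · exfalso
        simp only [hjk, hjk', if_true, if_false] at heq
        have := hout j' (by omega) b'
        split_ifs at heq
        · exact this.1 heq.symm
        · exact this.2 heq.symm
      · exfalso
        simp only [hjk, hjk', if_true, if_false] at heq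
        have := hout j (by omega) b
        split_ifs at heq
        · exact this.1 heq
        · exact this.2 heq
      · simp only [hjk, hjk', if_false] at heq
        exact hinj j (by omega) j' (by omega) b b' heq
    · intro j hj i
      by_cases hjk : j = k
      · have := hpm i
        simp only [hjk, if_true, Bool.false_eq_true, if_false]
        revert this
        cases v i p <;> cases v i m <;> simp
      · simpa [hjk] using hopp j (by omega) i

/-- The majority of three Boolean values. -/
def majority3 (x y z : Bool) : Bool := (x && y) || (y && z) || (x && z)

theorem boolCount_opposite_pairs {f : α → Bool} {e : ℕ → Bool → α} {J : Finset ℕ}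
    (hinj : ∀ j ∈ J, ∀ j' ∈ J, ∀ b b', e j b = e j' b' → j = j' ∧ b = b')
    (hopp : ∀ j ∈ J, f (e j false) = !f (e j true)) (b : Bool) :
    boolCount f (J.biUnion fun j => {e j true, e j false}) b = J.card := by
  induction J using Finset.induction_on with
  | empty => simp [boolCount]
  | insert j J hj ih =>
    have hsub : ∀ j' ∈ J, j' ∈ insert j J := fun j' h => Finset.mem_insert_of_mem h
    have hne : e j true ≠ e j false := fun h => by
      simpa using (hinj j (by simp) j (by simp) _ _ h).2
    have hdisj : Disjoint ({e j true, e j false} : Finset α)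
        (J.biUnion fun j => {e j true, e j false}) := by
      rw [Finset.disjoint_left]
      intro x hx hx'
      obtain ⟨j', hj', hx'⟩ := Finset.mem_biUnion.1 hx'
      simp only [Finset.mem_insert, Finset.mem_singleton] at hx hx'
      have hjj' : j ≠ j' := fun h => hj (h ▸ hj')
      rcases hx with rfl | rfl <;> rcases hx' with hx' | hx' <;>
        exact hjj' (hinj j (by simp) j' (hsub j' hj') _ _ hx').1
    rw [Finset.biUnion_insert, boolCount_union _ hdisj,
      ih (fun j' h' j'' h'' => hinj j' (hsub j' h') j'' (hsub j'' h''))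
        (fun j' h' => hopp j' (hsub j' h')), Finset.card_insert_of_notMem hj,
      ← insert_empty_eq (e j false), boolCount_insert _ (by simpa using hne),
      boolCount_insert _ (by simp), hopp j (by simp)]
    cases f (e j true) <;> cases b <;> simp [boolCount] <;> omega

/-- If both values are frequent in `S`, then `S` contains two sets `A` and `B` of size `a` such that
always one value is constant on `A` and the other one on `B`. -/
theorem HasMajorities.exists_opposite_sets [Nonempty ι] (ha : 1 ≤ a)
    (h : HasMajorities v a S) (hS : 10 * a ≤ S.card)
    (hcount : ∀ i b, 5 * a ≤ boolCount (v i) S b) :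
    ∃ A ⊆ S, ∃ B ⊆ S, A.card = a ∧ B.card = a ∧ Disjoint A B ∧
      (∀ i, ∀ x ∈ A, ∀ y ∈ A, v i x = v i y) ∧ ∀ i, ∀ x ∈ A, ∀ y ∈ B, v i x ≠ v i y := by
  classical
  obtain ⟨e, heS, hinj, hopp⟩ := h.exists_opposite_pairs ha (3 * a) (by omega)
    fun i b => by have := hcount i b; omega
  -- Pairs are twins if they are always equal up to order. With `a` twins, one element of each can
  -- be aligned into `A` and the other into `B`. Otherwise three pairwise non-twin pairs lead to a
  -- contradiction.
  set twins : ℕ → Finset ℕ := fun j =>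
    (Finset.range (3 * a)).filter fun l => ∃ s, ∀ i, v i (e l s) = v i (e j true) with htw
  by_cases hbig : ∃ j, a ≤ (twins j).card
  · obtain ⟨j, hj⟩ := hbig
    obtain ⟨J, hJ, hJa⟩ := Finset.exists_subset_card_eq hj
    have hJ' : ∀ l ∈ J, l < 3 * a ∧ ∃ s, ∀ i, v i (e l s) = v i (e j true) := fun l hl => by
      simpa [htw] using hJ hl
    have hs : ∀ l, ∃ s, l ∈ J → ∀ i, v i (e l s) = v i (e j true) := fun l => by
      by_cases hl : l ∈ J
      · obtain ⟨s, hs⟩ := (hJ' l hl).2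
        exact ⟨s, fun _ => hs⟩
      · exact ⟨true, fun h' => absurd h' hl⟩
    choose s hs using hs
    have hnot : ∀ l ∈ J, ∀ i, v i (e l (!s l)) = !v i (e j true) := fun l hl i => by
      have h₁ := hopp l (hJ' l hl).1 i
      have h₂ := hs l hl i
      cases hsl : s l <;> rw [hsl] at h₂
      · rw [← h₂, h₁]; simp
      · rw [← h₂]; exact h₁
    refine ⟨J.image fun l => e l (s l), ?_, J.image fun l => e l (!s l), ?_, ?_, ?_, ?_, ?_, ?_⟩
    · intro x hx
      obtain ⟨l, hl, rfl⟩ := Finset.mem_image.1 hx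
      exact heS l (hJ' l hl).1 _
    · intro x hx
      obtain ⟨l, hl, rfl⟩ := Finset.mem_image.1 hx
      exact heS l (hJ' l hl).1 _
    · rw [Finset.card_image_of_injOn, hJa]
      exact fun l hl l' hl' heq => (hinj l (hJ' l hl).1 l' (hJ' l' hl').1 _ _ heq).1
    · rw [Finset.card_image_of_injOn, hJa]
      exact fun l hl l' hl' heq => (hinj l (hJ' l hl).1 l' (hJ' l' hl').1 _ _ heq).1
    · rw [Finset.disjoint_left]
      intro x hx hx'
      obtain ⟨l, hl, rfl⟩ := Finset.mem_image.1 hx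
      obtain ⟨l', hl', heq⟩ := Finset.mem_image.1 hx'
      obtain ⟨i⟩ := ‹Nonempty ι›
      have h₁ := hnot l' hl' i
      rw [heq, hs l hl i] at h₁
      simp at h₁
    · intro i x hx y hy
      obtain ⟨l, hl, rfl⟩ := Finset.mem_image.1 hx
      obtain ⟨l', hl', rfl⟩ := Finset.mem_image.1 hy
      rw [hs l hl i, hs l' hl' i]
    · intro i x hx y hy
      obtain ⟨l, hl, rfl⟩ := Finset.mem_image.1 hx
      obtain ⟨l', hl', rfl⟩ := Finset.mem_image.1 hy
      rw [hs l hl i, hnot l' hl' i]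
      simp
  exfalso
  push Not at hbig
  have hpick : ∀ T : Finset ℕ, T.card < 3 * a → ∃ j < 3 * a, j ∉ T := fun T hT => by
    obtain ⟨j, hj, hjT⟩ := Finset.exists_mem_notMem_of_card_lt_card
      (show T.card < (Finset.range (3 * a)).card by simpa using hT)
    exact ⟨j, by simpa using hj, hjT⟩
  have hself : ∀ j < 3 * a, j ∈ twins j := fun j hj => by
    simp only [htw, Finset.mem_filter, Finset.mem_range]
    exact ⟨hj, true, fun _ => rfl⟩
  have hntw : ∀ j, ∀ l < 3 * a, l ∉ twins j → ∀ s, ¬ ∀ i, v i (e l s) = v i (e j true) :=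
    fun j l hl hlj s hs => hlj (by
      simp only [htw, Finset.mem_filter, Finset.mem_range]
      exact ⟨hl, s, hs⟩)
  obtain ⟨j₁, hj₁, hj₁0⟩ := hpick (twins 0) (by have := hbig 0; omega)
  obtain ⟨j₂, hj₂, hj₂n⟩ := hpick (twins 0 ∪ twins j₁) (by
    have := hbig 0
    have := hbig j₁
    have := Finset.card_union_le (twins 0) (twins j₁)
    omega)
  rw [Finset.mem_union, not_or] at hj₂n
  have h0 : 0 < 3 * a := by omega
  have h01 : (0 : ℕ) ≠ j₁ := fun h' => hj₁0 (h' ▸ hself 0 h0)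
  have h02 : (0 : ℕ) ≠ j₂ := fun h' => hj₂n.1 (h' ▸ hself 0 h0)
  have h12 : j₁ ≠ j₂ := fun h' => hj₂n.2 (h' ▸ hself j₁ hj₁)
  have hmed : ∀ b₀ b₁ b₂, ∃ u, (u = e 0 b₀ ∨ u = e j₁ b₁ ∨ u = e j₂ b₂) ∧
      ∀ i, v i u = majority3 (v i (e 0 b₀)) (v i (e j₁ b₁)) (v i (e j₂ b₂)) := by
    intro b₀ b₁ b₂
    -- Padding three elements with `a - 1` opposite pairs turns the majority reply into their
    -- median. Pairs containing an element that always equals the median are excluded from the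
    -- padding, so the reply is one of the three. The excluded pairs are twins of each other, hence
    -- fewer than `a`.
    set M : Finset ℕ := (Finset.range (3 * a)).filter fun l => ∃ s, ∀ i,
      v i (e l s) = majority3 (v i (e 0 b₀)) (v i (e j₁ b₁)) (v i (e j₂ b₂)) with hM
    have hMcard : M.card < a := by
      rcases M.eq_empty_or_nonempty with hempty | ⟨l, hl⟩
      · rw [hempty, Finset.card_empty]; omega
      refine lt_of_le_of_lt (Finset.card_le_card (t := twins l) fun l' hl' => ?_) (hbig l)
      simp only [hM, htw, Finset.mem_filter, Finset.mem_range] at hl hl' ⊢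
      obtain ⟨hl, s, hs⟩ := hl
      obtain ⟨hl', s', hs'⟩ := hl'
      cases s
      · refine ⟨hl', !s', fun i => ?_⟩
        have h₁ := hs i
        have h₂ := hs' i
        rw [← h₁, hopp l hl i] at h₂
        have h₃ := hopp l' hl' i
        cases s'
        · rw [h₃] at h₂
          simpa using h₂
        · rw [Bool.not_true, h₃, h₂, Bool.not_not]
      · exact ⟨hl', s', fun i => (hs' i).trans (hs i).symm⟩
    obtain ⟨J, hJ, hJa⟩ := Finset.exists_subset_card_eq
      (show a - 1 ≤ (Finset.range (3 * a) \ (M ∪ {0, j₁, j₂})).card by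
        have h₁ := Finset.le_card_sdiff (M ∪ {0, j₁, j₂}) (Finset.range (3 * a))
        have h₂ := Finset.card_union_le M {0, j₁, j₂}
        have h₃ : ({0, j₁, j₂} : Finset ℕ).card ≤ 3 := Finset.card_le_three
        rw [Finset.card_range] at h₁
        omega)
    have hJ' : ∀ l ∈ J, l < 3 * a ∧ l ∉ M ∧ l ≠ 0 ∧ l ≠ j₁ ∧ l ≠ j₂ := fun l hl => by
      have := hJ hl
      simp only [Finset.mem_sdiff, Finset.mem_range, Finset.mem_union, Finset.mem_insert,
        Finset.mem_singleton, not_or] at this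
      exact this
    set pad := J.biUnion fun j => {e j true, e j false} with hpad
    have hpadmem : ∀ x ∈ pad, ∃ l ∈ J, ∃ s, x = e l s := fun x hx => by
      obtain ⟨l, hl, hx⟩ := Finset.mem_biUnion.1 hx
      simp only [Finset.mem_insert, Finset.mem_singleton] at hx
      rcases hx with rfl | rfl
      · exact ⟨l, hl, _, rfl⟩
      · exact ⟨l, hl, _, rfl⟩
    have hnot : ∀ l, l < 3 * a → l ∉ J → ∀ s, e l s ∉ pad := fun l hl hlJ s hs => by
      obtain ⟨l', hl', s', heq⟩ := hpadmem _ hs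
      exact hlJ ((hinj l hl l' (hJ' l' hl').1 _ _ heq).1 ▸ hl')
    have hpc : ∀ i b, boolCount (v i) pad b = a - 1 := fun i b => by
      rw [hpad, boolCount_opposite_pairs
        (fun j hj j' hj' => hinj j (hJ' j hj).1 j' (hJ' j' hj').1)
        (fun j hj => hopp j (hJ' j hj).1 i), hJa]
    have hx₂ : e j₂ b₂ ∉ pad := hnot j₂ hj₂ (fun h' => (hJ' _ h').2.2.2.2 rfl) _
    have hx₁ : e j₁ b₁ ∉ insert (e j₂ b₂) pad := by
      rw [Finset.mem_insert, not_or]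
      exact ⟨fun h' => h12 (hinj j₁ hj₁ j₂ hj₂ _ _ h').1,
        hnot j₁ hj₁ (fun h' => (hJ' _ h').2.2.2.1 rfl) _⟩
    have hx₀ : e 0 b₀ ∉ insert (e j₁ b₁) (insert (e j₂ b₂) pad) := by
      rw [Finset.mem_insert, Finset.mem_insert, not_or, not_or]
      exact ⟨fun h' => h01 (hinj 0 h0 j₁ hj₁ _ _ h').1, fun h' => h02 (hinj 0 h0 j₂ hj₂ _ _ h').1,
        hnot 0 h0 (fun h' => (hJ' _ h').2.2.1 rfl) _⟩
    have hcard : (insert (e 0 b₀) (insert (e j₁ b₁) (insert (e j₂ b₂) pad))).card = 2 * a + 1 := by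
      obtain ⟨i⟩ := ‹Nonempty ι›
      rw [Finset.card_insert_of_notMem hx₀, Finset.card_insert_of_notMem hx₁,
        Finset.card_insert_of_notMem hx₂, ← boolCount_add_not (v i) pad true, hpc, hpc]
      omega
    obtain ⟨u, huQ, hu⟩ := h _ (Finset.insert_subset (heS 0 h0 _) (Finset.insert_subset
      (heS j₁ hj₁ _) (Finset.insert_subset (heS j₂ hj₂ _) fun x hx => by
        obtain ⟨l, hl, s, rfl⟩ := hpadmem x hx
        exact heS l (hJ' l hl).1 s))) hcard
    have hval : ∀ i, v i u = majority3 (v i (e 0 b₀)) (v i (e j₁ b₁)) (v i (e j₂ b₂)) := by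
      intro i
      have h₁ := hu i
      rw [hcard, boolCount_insert _ hx₀, boolCount_insert _ hx₁, boolCount_insert _ hx₂, hpc] at h₁
      revert h₁
      cases v i u <;> cases v i (e 0 b₀) <;> cases v i (e j₁ b₁) <;> cases v i (e j₂ b₂) <;>
        simp [majority3] <;> omega
    refine ⟨u, ?_, hval⟩
    simp only [Finset.mem_insert] at huQ
    rcases huQ with h' | h' | h' | h'
    · exact Or.inl h'
    · exact Or.inr (Or.inl h')
    · exact Or.inr (Or.inr h')
    · exfalso
      obtain ⟨l, hl, s, rfl⟩ := hpadmem u h'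
      refine (hJ' l hl).2.1 ?_
      simp only [hM, Finset.mem_filter, Finset.mem_range]
      exact ⟨(hJ' l hl).1, s, hval⟩
  have o₀ := hopp 0 h0
  have o₁ := hopp j₁ hj₁
  have o₂ := hopp j₂ hj₂
  have n₀₁ := hntw 0 j₁ hj₁ hj₁0
  have n₀₂ := hntw 0 j₂ hj₂ hj₂n.1
  have n₁₂ := hntw j₁ j₂ hj₂ hj₂n.2
  -- The median of x, y, z is always the same one of them, say x. The median of ¬x, y, z is then ¬x
  -- exactly where y and z differ, and the common value elsewhere. If it is always ¬x, then y and z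
  -- are opposite; if it is always y or always z, then the other one equals x. Each outcome makes
  -- two of the pairs twins.
  obtain ⟨u, hu, hm⟩ := hmed true true true
  rcases hu with rfl | rfl | rfl
  · obtain ⟨u', hu', hm'⟩ := hmed false true true
    rcases hu' with rfl | rfl | rfl
    · refine n₁₂ false fun i => ?_
      have h₁ := hm i; have h₂ := hm' i
      rw [o₂]; rw [o₀] at h₂; revert h₁ h₂
      cases v i (e 0 true) <;> cases v i (e j₁ true) <;> cases v i (e j₂ true) <;> decide
    · refine n₀₂ true fun i => ?_
      have h₁ := hm i; have h₂ := hm' i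
      rw [o₀] at h₂; revert h₁ h₂
      cases v i (e 0 true) <;> cases v i (e j₁ true) <;> cases v i (e j₂ true) <;> decide
    · refine n₀₁ true fun i => ?_
      have h₁ := hm i; have h₂ := hm' i
      rw [o₀] at h₂; revert h₁ h₂
      cases v i (e 0 true) <;> cases v i (e j₁ true) <;> cases v i (e j₂ true) <;> decide
  · obtain ⟨u', hu', hm'⟩ := hmed true false true
    rcases hu' with rfl | rfl | rfl
    · refine n₁₂ true fun i => ?_
      have h₁ := hm i; have h₂ := hm' i
      rw [o₁] at h₂; revert h₁ h₂
      cases v i (e 0 true) <;> cases v i (e j₁ true) <;> cases v i (e j₂ true) <;> decide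
    · refine n₀₂ false fun i => ?_
      have h₁ := hm i; have h₂ := hm' i
      rw [o₂]; rw [o₁] at h₂; revert h₁ h₂
      cases v i (e 0 true) <;> cases v i (e j₁ true) <;> cases v i (e j₂ true) <;> decide
    · refine n₀₁ true fun i => ?_
      have h₁ := hm i; have h₂ := hm' i
      rw [o₁] at h₂; revert h₁ h₂
      cases v i (e 0 true) <;> cases v i (e j₁ true) <;> cases v i (e j₂ true) <;> decide
  · obtain ⟨u', hu', hm'⟩ := hmed true true false
    rcases hu' with rfl | rfl | rfl
    · refine n₁₂ true fun i => ?_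
      have h₁ := hm i; have h₂ := hm' i
      rw [o₂] at h₂; revert h₁ h₂
      cases v i (e 0 true) <;> cases v i (e j₁ true) <;> cases v i (e j₂ true) <;> decide
    · refine n₀₂ true fun i => ?_
      have h₁ := hm i; have h₂ := hm' i
      rw [o₂] at h₂; revert h₁ h₂
      cases v i (e 0 true) <;> cases v i (e j₁ true) <;> cases v i (e j₂ true) <;> decide
    · refine n₀₁ false fun i => ?_
      have h₁ := hm i; have h₂ := hm' i
      rw [o₁]; rw [o₂] at h₂; revert h₁ h₂
      cases v i (e 0 true) <;> cases v i (e j₁ true) <;> cases v i (e j₂ true) <;> decide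

end twoColours

/-! ### Linear-time selection by medians of medians. -/

section selection

/-- An abstract model of comparison algorithms: `le κ` is the preorder known to hold at the
knowledge `κ`, and `win k κ` says that a task can be completed at cost `k` from `κ`. Comparing two
elements has unit cost. -/
structure ComparisonModel (K α : Type*) [Preorder K] where
  le : K → α → α → Prop
  win : ℕ → K → Prop
  le_refl : ∀ κ x, le κ x x
  le_trans : ∀ κ x y z, le κ x y → le κ y z → le κ x z
  le_mono : ∀ κ κ' x y, κ ≤ κ' → le κ x y → le κ' x y
  win_mono : ∀ k l κ, k ≤ l → win k κ → win l κ

variable {K α : Type*} [Preorder K]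

namespace ComparisonModel

variable (M : ComparisonModel K α)

/-- Any two elements of `Y` can be compared at unit cost. -/
def CanCompare (Y : Finset α) : Prop :=
  ∀ κ k, ∀ x ∈ Y, ∀ y ∈ Y, (∀ κ', κ ≤ κ' → M.le κ' x y ∨ M.le κ' y x → M.win k κ') →
    M.win (k + 1) κ

/-- `w` is an element of `Y` with `Lo` below and `Hi` above it. -/
structure IsSplit [DecidableEq α] (κ : K) (Y : Finset α) (w : α) (Lo Hi : Finset α) : Prop where
  mem : w ∈ Y
  union : Lo ∪ Hi = Y.erase w
  disj : Disjoint Lo Hi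
  lo : ∀ x ∈ Lo, M.le κ x w
  hi : ∀ x ∈ Hi, M.le κ w x

variable {M}

theorem CanCompare.subset {Y Z : Finset α} (h : M.CanCompare Y) (hZ : Z ⊆ Y) : M.CanCompare Z :=
  fun κ k x hx y hy => h κ k x (hZ hx) y (hZ hy)

theorem exists_le_of_total {κ : K} {Y : Finset α} (hne : Y.Nonempty)
    (htot : ∀ x ∈ Y, ∀ y ∈ Y, M.le κ y x ∨ M.le κ x y) : ∃ w ∈ Y, ∀ x ∈ Y, M.le κ w x := by
  induction hne using Finset.Nonempty.cons_induction with
  | singleton a => exact ⟨a, by simp, by simpa using M.le_refl κ a⟩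
  | cons a s ha hs ih =>
    obtain ⟨w, hw, hwmin⟩ := ih fun x hx y hy => htot x (by simp [hx]) y (by simp [hy])
    rcases htot a (by simp) w (by simp [hw]) with h | h
    · refine ⟨w, by simp [hw], fun x hx => ?_⟩
      rcases Finset.mem_cons.1 hx with rfl | hx
      · exact h
      · exact hwmin x hx
    · refine ⟨a, by simp, fun x hx => ?_⟩
      rcases Finset.mem_cons.1 hx with rfl | hx
      · exact M.le_refl κ _
      · exact M.le_trans _ _ _ _ h (hwmin x hx)

variable [DecidableEq α]

theorem IsSplit.mono {κ κ' : K} {Y Lo Hi : Finset α} {w : α} (h : M.IsSplit κ Y w Lo Hi)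
    (hκ : κ ≤ κ') : M.IsSplit κ' Y w Lo Hi :=
  ⟨h.mem, h.union, h.disj, fun x hx => M.le_mono _ _ _ _ hκ (h.lo x hx),
    fun x hx => M.le_mono _ _ _ _ hκ (h.hi x hx)⟩

theorem IsSplit.card {κ : K} {Y Lo Hi : Finset α} {w : α} (h : M.IsSplit κ Y w Lo Hi) :
    Lo.card + Hi.card + 1 = Y.card := by
  rw [← Finset.card_union_of_disjoint h.disj, h.union, Finset.card_erase_add_one h.mem]

theorem IsSplit.lo_subset {κ : K} {Y Lo Hi : Finset α} {w : α} (h : M.IsSplit κ Y w Lo Hi) :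
    Lo ⊆ Y.erase w := h.union ▸ Finset.subset_union_left

theorem IsSplit.hi_subset {κ : K} {Y Lo Hi : Finset α} {w : α} (h : M.IsSplit κ Y w Lo Hi) :
    Hi ⊆ Y.erase w := h.union ▸ Finset.subset_union_right

theorem CanCompare.win_of_compare_one {Y : Finset α} (h : M.CanCompare Y) {w : α} (hw : w ∈ Y)
    (T : Finset α) (hT : T ⊆ Y) {κ : K} {k : ℕ}
    (hk : ∀ κ', κ ≤ κ' → (∀ x ∈ T, M.le κ' x w ∨ M.le κ' w x) → M.win k κ') :
    M.win (k + T.card) κ := by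
  induction T using Finset.induction_on generalizing κ with
  | empty => exact hk κ le_rfl (by simp)
  | insert x T hx ih =>
    rw [Finset.card_insert_of_notMem hx, ← add_assoc]
    refine h κ _ x (hT (by simp)) w hw fun κ₁ h₁ hc => ?_
    refine ih (fun y hy => hT (by simp [hy])) fun κ₂ h₂ hall => hk κ₂ (h₁.trans h₂) ?_
    rw [Finset.forall_mem_insert]
    exact ⟨hc.imp (M.le_mono _ _ _ _ h₂) (M.le_mono _ _ _ _ h₂), hall⟩

theorem CanCompare.win_of_compare_all {Y : Finset α} (h : M.CanCompare Y) (T : Finset α)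
    (hT : T ⊆ Y) {κ : K} {k : ℕ}
    (hk : ∀ κ', κ ≤ κ' → (∀ x ∈ T, ∀ y ∈ Y, M.le κ' y x ∨ M.le κ' x y) → M.win k κ') :
    M.win (k + T.card * Y.card) κ := by
  induction T using Finset.induction_on generalizing κ with
  | empty => simpa using hk κ le_rfl (by simp)
  | insert x T hx ih =>
    rw [Finset.card_insert_of_notMem hx, add_mul, one_mul, ← add_assoc]
    refine h.win_of_compare_one (hT (Finset.mem_insert_self x T)) Y subset_rfl fun κ₁ h₁ hc => ?_
    refine ih (fun y hy => hT (by simp [hy])) fun κ₂ h₂ hall => hk κ₂ (h₁.trans h₂) ?_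
    rw [Finset.forall_mem_insert]
    exact ⟨fun y hy => (hc y hy).imp (M.le_mono _ _ _ _ h₂) (M.le_mono _ _ _ _ h₂), hall⟩

theorem exists_isSplit_of_total {κ : K} {Y : Finset α}
    (htot : ∀ x ∈ Y, ∀ y ∈ Y, M.le κ y x ∨ M.le κ x y) {r : ℕ} (hr : r < Y.card) :
    ∃ w Lo Hi, M.IsSplit κ Y w Lo Hi ∧ Lo.card = r := by
  obtain ⟨m, hm, hmin⟩ := exists_le_of_total (Finset.card_pos.1 (by omega)) htot
  induction r generalizing Y m with
  | zero =>
    exact ⟨m, ∅, Y.erase m, ⟨hm, by simp, by simp, by simp,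
      fun x hx => hmin x (Finset.mem_of_mem_erase hx)⟩, rfl⟩
  | succ r ih =>
    have htot' : ∀ x ∈ Y.erase m, ∀ y ∈ Y.erase m, M.le κ y x ∨ M.le κ x y := fun x hx y hy =>
      htot x (Finset.mem_of_mem_erase hx) y (Finset.mem_of_mem_erase hy)
    have hcard : r < (Y.erase m).card := by rw [Finset.card_erase_of_mem hm]; omega
    obtain ⟨m', hm', hmin'⟩ := exists_le_of_total (Finset.card_pos.1 (by omega)) htot'
    obtain ⟨w, Lo, Hi, h, hLo⟩ := ih htot' hcard m' hm' hmin'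
    have hwY := Finset.mem_of_mem_erase h.mem
    have hmLo : m ∉ Lo := fun h' => by simpa using h.lo_subset h'
    have hmHi : m ∉ Hi := fun h' => by simpa using h.hi_subset h'
    refine ⟨w, insert m Lo, Hi, ⟨hwY, ?_, ?_, ?_, h.hi⟩, ?_⟩
    · rw [Finset.insert_union, h.union, Finset.erase_right_comm, Finset.insert_erase]
      exact Finset.mem_erase.2 ⟨(Finset.ne_of_mem_erase h.mem).symm, hm⟩
    · exact Finset.disjoint_insert_left.2 ⟨hmHi, h.disj⟩
    · rw [Finset.forall_mem_insert]
      exact ⟨hmin w hwY, h.lo⟩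
    · rw [Finset.card_insert_of_notMem hmLo, hLo]

theorem IsSplit.split_lo {κ : K} {Y L H Lo Hi : Finset α} {w w' : α} (h : M.IsSplit κ Y w L H)
    (h' : M.IsSplit κ L w' Lo Hi) : M.IsSplit κ Y w' Lo (Hi ∪ insert w H) := by
  have hwL : w ∉ L := fun hw => by simpa using h.lo_subset hw
  have hwH : w ∉ H := fun hw => by simpa using h.hi_subset hw
  have hLoL : Lo ⊆ L := h'.lo_subset.trans (Finset.erase_subset _ _)
  have hLY : L ⊆ Y := h.lo_subset.trans (Finset.erase_subset _ _)
  refine ⟨hLY h'.mem, ?_, ?_, h'.lo, ?_⟩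
  · rw [← Finset.union_assoc, h'.union]
    have hY : insert w (L ∪ H) = Y := by rw [h.union, Finset.insert_erase h.mem]
    have h₁ := Finset.disjoint_left.1 h.disj h'.mem
    have h₂ : w' ≠ w := fun e => hwL (e ▸ h'.mem)
    rw [← hY]
    ext x
    simp only [Finset.mem_union, Finset.mem_erase, Finset.mem_insert]
    constructor
    · rintro (⟨h₃, h₄⟩ | rfl | h₃)
      · exact ⟨h₃, Or.inr (Or.inl h₄)⟩
      · exact ⟨h₂.symm, Or.inl rfl⟩
      · exact ⟨fun e => h₁ (e ▸ h₃), Or.inr (Or.inr h₃)⟩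
    · tauto
  · rw [Finset.disjoint_union_right, Finset.disjoint_insert_right]
    exact ⟨h'.disj, fun hw => hwL (hLoL hw), h.disj.mono_left hLoL⟩
  · intro x hx
    rcases Finset.mem_union.1 hx with hx | hx
    · exact h'.hi x hx
    · rcases Finset.mem_insert.1 hx with rfl | hx
      · exact h.lo w' h'.mem
      · exact M.le_trans _ _ _ _ (h.lo w' h'.mem) (h.hi x hx)

theorem IsSplit.split_hi {κ : K} {Y L H Lo Hi : Finset α} {w w' : α} (h : M.IsSplit κ Y w L H)
    (h' : M.IsSplit κ H w' Lo Hi) : M.IsSplit κ Y w' (Lo ∪ insert w L) Hi := by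
  have hwL : w ∉ L := fun hw => by simpa using h.lo_subset hw
  have hwH : w ∉ H := fun hw => by simpa using h.hi_subset hw
  have hHiH : Hi ⊆ H := h'.hi_subset.trans (Finset.erase_subset _ _)
  have hHY : H ⊆ Y := h.hi_subset.trans (Finset.erase_subset _ _)
  refine ⟨hHY h'.mem, ?_, ?_, ?_, h'.hi⟩
  · rw [Finset.union_right_comm, h'.union]
    have hY : insert w (L ∪ H) = Y := by rw [h.union, Finset.insert_erase h.mem]
    have h₁ := Finset.disjoint_right.1 h.disj h'.mem
    have h₂ : w' ≠ w := fun e => hwH (e ▸ h'.mem)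
    rw [← hY]
    ext x
    simp only [Finset.mem_union, Finset.mem_erase, Finset.mem_insert]
    constructor
    · rintro (⟨h₃, h₄⟩ | rfl | h₃)
      · exact ⟨h₃, Or.inr (Or.inr h₄)⟩
      · exact ⟨h₂.symm, Or.inl rfl⟩
      · exact ⟨fun e => h₁ (e ▸ h₃), Or.inr (Or.inl h₃)⟩
    · tauto
  · rw [Finset.disjoint_union_left, Finset.disjoint_insert_left]
    exact ⟨h'.disj, fun hw => hwH (hHiH hw), h.disj.mono_right hHiH⟩
  · intro x hx
    rcases Finset.mem_union.1 hx with hx | hx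
    · exact h'.lo x hx
    · rcases Finset.mem_insert.1 hx with rfl | hx
      · exact h.hi w' h'.mem
      · exact M.le_trans _ _ _ _ (h.lo x hx) (h.hi w' h'.mem)

theorem CanCompare.select_naive {Y : Finset α} (h : M.CanCompare Y) {r k : ℕ} (hr : r < Y.card)
    {κ : K} (hk : ∀ κ', κ ≤ κ' → ∀ w Lo Hi, M.IsSplit κ' Y w Lo Hi → Lo.card = r → M.win k κ') :
    M.win (k + Y.card * Y.card) κ := by
  refine h.win_of_compare_all Y subset_rfl fun κ' hκ htot => ?_
  obtain ⟨w, Lo, Hi, hs, hLo⟩ := exists_isSplit_of_total htot hr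
  exact hk κ' hκ w Lo Hi hs hLo

/-- `D` is a set of medians of disjoint five-element subsets `G x` of `Y`. -/
structure IsMedianFamily (M : ComparisonModel K α) (κ : K) (Y D : Finset α)
    (G lo hi : α → Finset α) : Prop where
  mem : ∀ x ∈ D, G x ⊆ Y
  split : ∀ x ∈ D, M.IsSplit κ (G x) x (lo x) (hi x)
  card_lo : ∀ x ∈ D, (lo x).card = 2
  card_hi : ∀ x ∈ D, (hi x).card = 2
  disj : ∀ x ∈ D, ∀ y ∈ D, x ≠ y → Disjoint (G x) (G y)

theorem CanCompare.win_of_medians (g : ℕ) {Y : Finset α} (h : M.CanCompare Y) (hg : 5 * g ≤ Y.card)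
    {k : ℕ} {κ : K} (hk : ∀ κ', κ ≤ κ' → ∀ D G lo hi, IsMedianFamily M κ' Y D G lo hi → D.card = g →
      M.win k κ') : M.win (k + 25 * g) κ := by
  induction g generalizing Y κ with
  | zero =>
    refine hk κ le_rfl ∅ (fun _ => ∅) (fun _ => ∅) (fun _ => ∅) ?_ rfl
    exact ⟨by simp, by simp, by simp, by simp, by simp⟩
  | succ g ih =>
    obtain ⟨F, hFY, hF⟩ := Finset.exists_subset_card_eq (show 5 ≤ Y.card by omega)
    have key : M.win (k + 25 * g + F.card * F.card) κ := by
      refine (h.subset hFY).select_naive (r := 2) (by omega) fun κ₁ h₁ w Lo Hi hs hLo => ?_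
      refine ih (Y := Y \ F) (h.subset Finset.sdiff_subset)
        (by have := Finset.card_sdiff_add_card_eq_card hFY; omega) fun κ₂ h₂ D G lo hi hD hDg => ?_
      have hsub : ∀ x ∈ D, G x ⊆ Y ∧ Disjoint F (G x) := fun x hx =>
        ⟨(hD.mem x hx).trans Finset.sdiff_subset,
          Finset.disjoint_of_subset_right (hD.mem x hx) Finset.disjoint_sdiff⟩
      have hwD : w ∉ D := fun hw =>
        Finset.disjoint_left.1 (hsub w hw).2 hs.mem (hD.split w hw).mem
      have hne : ∀ x ∈ D, x ≠ w := fun x hx e => hwD (e ▸ hx)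
      have hcard := hs.card
      refine hk κ₂ (h₁.trans h₂) (insert w D) (fun x => if x = w then F else G x)
        (fun x => if x = w then Lo else lo x) (fun x => if x = w then Hi else hi x) ?_
        (by rw [Finset.card_insert_of_notMem hwD, hDg])
      constructor
      · rw [Finset.forall_mem_insert]
        refine ⟨by simpa using hFY, fun x hx => ?_⟩
        simpa [hne x hx] using (hsub x hx).1
      · rw [Finset.forall_mem_insert]
        refine ⟨by simpa using hs.mono h₂, fun x hx => ?_⟩
        simpa [hne x hx] using hD.split x hx
      · rw [Finset.forall_mem_insert]
        refine ⟨by simpa using hLo, fun x hx => ?_⟩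
        simpa [hne x hx] using hD.card_lo x hx
      · rw [Finset.forall_mem_insert]
        refine ⟨by simp; omega, fun x hx => ?_⟩
        simpa [hne x hx] using hD.card_hi x hx
      · rw [Finset.forall_mem_insert]
        refine ⟨?_, fun x hx => ?_⟩
        · rw [Finset.forall_mem_insert]
          refine ⟨fun h' => absurd rfl h', fun y hy _ => ?_⟩
          simpa [hne y hy] using (hsub y hy).2
        · rw [Finset.forall_mem_insert]
          refine ⟨fun _ => ?_, fun y hy hxy => ?_⟩
          · simpa [hne x hx] using (hsub x hx).2.symm
          · simpa [hne x hx, hne y hy] using hD.disj x hx y hy hxy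
    rw [hF] at key
    exact M.win_mono _ _ _ (by omega) key

theorem card_biUnion_insert {D : Finset α} {f G : α → Finset α}
    (hG : ∀ x ∈ D, insert x (f x) ⊆ G x) (hf : ∀ x ∈ D, x ∉ f x) (hc : ∀ x ∈ D, (f x).card = 2)
    (hd : ∀ x ∈ D, ∀ y ∈ D, x ≠ y → Disjoint (G x) (G y)) :
    (D.biUnion fun x => insert x (f x)).card = 3 * D.card := by
  rw [Finset.card_biUnion fun x hx y hy hxy =>
    Finset.disjoint_of_subset_left (hG x hx) (Finset.disjoint_of_subset_right (hG y hy)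
      (hd x hx y hy hxy)), Finset.sum_congr rfl fun x hx => by
        rw [Finset.card_insert_of_notMem (hf x hx), hc x hx], Finset.sum_const, smul_eq_mul]
  omega

/-- The median of medians is a good pivot. -/
theorem IsMedianFamily.exists_split {κ : K} {Y D LoD HiD : Finset α} {G lo hi : α → Finset α} {w : α}
    (hD : IsMedianFamily M κ Y D G lo hi) (hw : M.IsSplit κ D w LoD HiD)
    (hcmp : ∀ x ∈ Y, M.le κ x w ∨ M.le κ w x) :
    ∃ L H, M.IsSplit κ Y w L H ∧ 3 * LoD.card + 2 ≤ L.card ∧ 3 * HiD.card + 2 ≤ H.card := by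
  classical
  have hGlo : ∀ x ∈ D, insert x (lo x) ⊆ G x := fun x hx => Finset.insert_subset (hD.split x hx).mem
    ((hD.split x hx).lo_subset.trans (Finset.erase_subset _ _))
  have hGhi : ∀ x ∈ D, insert x (hi x) ⊆ G x := fun x hx => Finset.insert_subset (hD.split x hx).mem
    ((hD.split x hx).hi_subset.trans (Finset.erase_subset _ _))
  have hnlo : ∀ x ∈ D, x ∉ lo x := fun x hx h' => by simpa using (hD.split x hx).lo_subset h'
  have hnhi : ∀ x ∈ D, x ∉ hi x := fun x hx h' => by simpa using (hD.split x hx).hi_subset h'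
  have hLoD : insert w LoD ⊆ D := Finset.insert_subset hw.mem
    (hw.lo_subset.trans (Finset.erase_subset _ _))
  have hHiD : insert w HiD ⊆ D := Finset.insert_subset hw.mem
    (hw.hi_subset.trans (Finset.erase_subset _ _))
  have hwLo : w ∉ LoD := fun h' => by simpa using hw.lo_subset h'
  have hwHi : w ∉ HiD := fun h' => by simpa using hw.hi_subset h'
  -- Each median at or below `w` contributes itself and its two smaller group members to the
  -- elements below `w`, and dually for `High`.
  set Low := (insert w LoD).biUnion fun x => insert x (lo x) with hLow
  set High := (insert w HiD).biUnion fun x => insert x (hi x) with hHigh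
  have hLowc : Low.card = 3 * (LoD.card + 1) := by
    rw [hLow, card_biUnion_insert (fun x hx => hGlo x (hLoD hx)) (fun x hx => hnlo x (hLoD hx))
      (fun x hx => hD.card_lo x (hLoD hx)) (fun x hx y hy => hD.disj x (hLoD hx) y (hLoD hy)),
      Finset.card_insert_of_notMem hwLo]
  have hHighc : High.card = 3 * (HiD.card + 1) := by
    rw [hHigh, card_biUnion_insert (fun x hx => hGhi x (hHiD hx)) (fun x hx => hnhi x (hHiD hx))
      (fun x hx => hD.card_hi x (hHiD hx)) (fun x hx y hy => hD.disj x (hHiD hx) y (hHiD hy)),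
      Finset.card_insert_of_notMem hwHi]
  have hwLow : w ∈ Low := Finset.mem_biUnion.2 ⟨w, by simp, by simp⟩
  have hwHigh : w ∈ High := Finset.mem_biUnion.2 ⟨w, by simp, by simp⟩
  have hLowY : Low ⊆ Y := Finset.biUnion_subset.2 fun x hx =>
    (hGlo x (hLoD hx)).trans (hD.mem x (hLoD hx))
  have hHighY : High ⊆ Y := Finset.biUnion_subset.2 fun x hx =>
    (hGhi x (hHiD hx)).trans (hD.mem x (hHiD hx))
  have hLowle : ∀ x ∈ Low, M.le κ x w := by
    intro x hx
    obtain ⟨y, hy, hx⟩ := Finset.mem_biUnion.1 hx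
    have hyw : M.le κ y w := by
      rcases Finset.mem_insert.1 hy with rfl | hy
      · exact M.le_refl _ _
      · exact hw.lo y hy
    rcases Finset.mem_insert.1 hx with rfl | hx
    · exact hyw
    · exact M.le_trans _ _ _ _ ((hD.split y (hLoD hy)).lo x hx) hyw
  have hHighle : ∀ x ∈ High, M.le κ w x := by
    intro x hx
    obtain ⟨y, hy, hx⟩ := Finset.mem_biUnion.1 hx
    have hyw : M.le κ w y := by
      rcases Finset.mem_insert.1 hy with rfl | hy
      · exact M.le_refl _ _
      · exact hw.hi y hy
    rcases Finset.mem_insert.1 hx with rfl | hx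
    · exact hyw
    · exact M.le_trans _ _ _ _ hyw ((hD.split y (hHiD hy)).hi x hx)
  have hdisj : ∀ x ∈ Low, x ∈ High → x = w := by
    intro x hx hx'
    obtain ⟨y, hy, hxy⟩ := Finset.mem_biUnion.1 hx
    obtain ⟨z, hz, hxz⟩ := Finset.mem_biUnion.1 hx'
    by_cases hyz : y = z
    · subst hyz
      have hyw : y = w := by
        by_contra hyw
        have h₁ := (Finset.mem_insert.1 hy).resolve_left hyw
        have h₂ := (Finset.mem_insert.1 hz).resolve_left hyw
        exact Finset.disjoint_left.1 hw.disj h₁ h₂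
      by_contra hxw
      have h₁ := (Finset.mem_insert.1 hxy).resolve_left fun e => hxw (e.trans hyw)
      have h₂ := (Finset.mem_insert.1 hxz).resolve_left fun e => hxw (e.trans hyw)
      exact Finset.disjoint_left.1 (hD.split y (hLoD hy)).disj h₁ h₂
    · exact absurd (hGhi z (hHiD hz) hxz)
        (Finset.disjoint_left.1 (hD.disj y (hLoD hy) z (hHiD hz) hyz) (hGlo y (hLoD hy) hxy))
  -- In a preorder an element may be both below and above `w`. Assigning `Low` and `High` to their
  -- own sides before looking at `le` protects the size bounds.
  refine ⟨(Y.erase w).filter fun x => x ∈ Low ∨ x ∉ High ∧ M.le κ x w,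
    (Y.erase w).filter fun x => ¬ (x ∈ Low ∨ x ∉ High ∧ M.le κ x w),
    ⟨hLowY hwLow, ?_, ?_, ?_, ?_⟩, ?_, ?_⟩
  · exact Finset.filter_union_filter_not_eq _ _
  · exact Finset.disjoint_filter_filter_not _ _ _
  · intro x hx
    rcases (Finset.mem_filter.1 hx).2 with h' | h'
    · exact hLowle x h'
    · exact h'.2
  · intro x hx
    obtain ⟨hxY, hx⟩ := Finset.mem_filter.1 hx
    by_cases hxH : x ∈ High
    · exact hHighle x hxH
    · exact (hcmp x (Finset.mem_of_mem_erase hxY)).resolve_left fun h' => hx (Or.inr ⟨hxH, h'⟩)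
  · have h₁ : (Low.erase w).card + 1 = Low.card := Finset.card_erase_add_one hwLow
    have h₂ := Finset.card_le_card (s := Low.erase w)
      (t := (Y.erase w).filter fun x => x ∈ Low ∨ x ∉ High ∧ M.le κ x w) fun x hx => by
        rw [Finset.mem_filter]
        exact ⟨Finset.erase_subset_erase _ hLowY hx, Or.inl (Finset.mem_of_mem_erase hx)⟩
    omega
  · have h₁ : (High.erase w).card + 1 = High.card := Finset.card_erase_add_one hwHigh
    have h₂ := Finset.card_le_card (s := High.erase w)
      (t := (Y.erase w).filter fun x => ¬ (x ∈ Low ∨ x ∉ High ∧ M.le κ x w)) fun x hx => by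
        rw [Finset.mem_filter]
        refine ⟨Finset.erase_subset_erase _ hHighY hx, ?_⟩
        have hxH := Finset.mem_of_mem_erase hx
        rintro (h' | h')
        · exact Finset.ne_of_mem_erase hx (hdisj x h' hxH)
        · exact h'.1 hxH
    omega

/-- Linear-time selection of the element with exactly `r` elements below it. -/
theorem CanCompare.select {Y : Finset α} (h : M.CanCompare Y) {r k : ℕ} (hr : r < Y.card)
    {κ : K} (hk : ∀ κ', κ ≤ κ' → ∀ w Lo Hi, M.IsSplit κ' Y w Lo Hi → Lo.card = r → M.win k κ') :
    M.win (k + 200 * Y.card) κ := by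
  induction hm : Y.card using Nat.strong_induction_on generalizing Y r k κ with
  | _ m ih =>
  -- For `m < 10` quadratic cost is within `200 * m`; otherwise there are at least two groups of
  -- five, as the cost estimate at the end requires.
  by_cases hsmall : m < 10
  · refine M.win_mono _ _ _ ?_ (h.select_naive hr hk)
    rw [hm]
    nlinarith
  set g := m / 5 with hg
  have hrest : ∀ κ₁, κ ≤ κ₁ → ∀ w L H, M.IsSplit κ₁ Y w L H → 2 * L.card + 3 * g ≤ 2 * m →
      2 * H.card + 3 * g ≤ 2 * m → M.win (k + 200 * (m - 3 * g / 2)) κ₁ := by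
    intro κ₁ h₁ w L H hs hL hH
    have hcard := hs.card
    have hLY : L ⊆ Y := hs.lo_subset.trans (Finset.erase_subset _ _)
    have hHY : H ⊆ Y := hs.hi_subset.trans (Finset.erase_subset _ _)
    rcases lt_trichotomy r L.card with hlt | heq | hgt
    · refine M.win_mono (k + 200 * L.card) _ _ (by omega) ?_
      refine ih L.card (by omega) (h.subset hLY) hlt (fun κ₂ h₂ w' Lo Hi hs' hLo => ?_) rfl
      exact hk κ₂ (h₁.trans h₂) w' _ _ ((hs.mono h₂).split_lo hs') hLo
    · exact M.win_mono k _ _ (by omega) (hk κ₁ h₁ w L H hs heq.symm)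
    · refine M.win_mono (k + 200 * H.card) _ _ (by omega) ?_
      refine ih H.card (by omega) (r := r - L.card - 1) (h.subset hHY) (by omega)
        (fun κ₂ h₂ w' Lo Hi hs' hLo => ?_) rfl
      refine hk κ₂ (h₁.trans h₂) w' _ _ ((hs.mono h₂).split_hi hs') ?_
      have hwL : w ∉ L := fun hw => by simpa using hs.lo_subset hw
      have hwH : w ∉ H := fun hw => by simpa using hs.hi_subset hw
      have hLoH : Lo ⊆ H := hs'.lo_subset.trans (Finset.erase_subset _ _)
      rw [Finset.card_union_of_disjoint, Finset.card_insert_of_notMem hwL]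
      · omega
      · rw [Finset.disjoint_insert_right]
        exact ⟨fun hw => hwH (hLoH hw), (hs.disj.mono_right hLoH).symm⟩
  -- The terms pay for the group medians (`25 * g`), their median (`200 * g`), the comparisons with
  -- the pivot (`Y.card`), and the recursion on a side smaller by `3 * g / 2`. The saving, about
  -- `300 * g`, exceeds `225 * g + m` once `g ≥ 2`, as `m ≤ 5 * g + 4`.
  have key : M.win (k + 200 * (m - 3 * g / 2) + Y.card + 200 * g + 25 * g) κ := by
    refine h.win_of_medians g (by omega) fun κ₁ h₁ D G lo hi hD hDg => ?_
    have hDY : D ⊆ Y := fun x hx => hD.mem x hx (hD.split x hx).mem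
    refine ih g (by omega) (r := g / 2) (h.subset hDY) (by omega) (fun κ₂ h₂ w Lo Hi hs hLo => ?_) hDg
    refine h.win_of_compare_one (hDY hs.mem) Y subset_rfl fun κ₃ h₃ hcmp => ?_
    have hD' : IsMedianFamily M κ₃ Y D G lo hi := ⟨hD.mem,
      fun x hx => (hD.split x hx).mono (h₂.trans h₃), hD.card_lo, hD.card_hi, hD.disj⟩
    obtain ⟨L, H, hsp, hL, hH⟩ := hD'.exists_split (hs.mono h₃) hcmp
    have h₄ := hs.card
    have h₅ := hsp.card
    exact hrest κ₃ (h₁.trans (h₂.trans h₃)) w L H hsp (by omega) (by omega)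
  have hg2 : 2 ≤ g := by omega
  exact M.win_mono _ _ _ (by omega) key

end ComparisonModel

end selection

/-! ### Comparing balls against known opposite blocks. -/

section frame

variable {n c q : ℕ} {ans : BallKind n c} {Γ Γ' O : Set (Fin n → Fin c)}

/-- If, up to two balls `y` and `z`, a query consists of `m` balls of one colour `p` and of `m + 1`
balls of the only other colour, then the reply computes the conjunction of `y` and `z` having
colour `p`. -/
theorem IsAnswerKind.reply_conjunction (hans : IsAnswerKind ans) {χ : Fin n → Fin c}
    {R T : Finset (Fin n)} {y z : Fin n} {p : Fin c} (hcard : T.card = R.card + 1)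
    (hdisj : Disjoint R T) (hyz : y ≠ z) (hy : y ∉ R ∪ T) (hz : z ∉ R ∪ T)
    (hR : ∀ x ∈ R, χ x = p) (hT : ∀ x ∈ T, χ x ≠ p)
    (htwo : ∀ x x', χ x ≠ p → χ x' ≠ p → χ x = χ x') {r : Option (Fin n)}
    (hr : IsCorrectReply ans χ (insert y (insert z (R ∪ T))) r) :
    ∃ u ∈ insert y (insert z (R ∪ T)), r = some u ∧ (χ u = p ↔ χ y = p ∧ χ z = p) := by
  have hy' : y ∉ insert z (R ∪ T) := by simp [hyz, Finset.mem_union] at hy ⊢; exact hy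
  have hQ : (insert y (insert z (R ∪ T))).card = 2 * R.card + 3 := by
    rw [Finset.card_insert_of_notMem hy', Finset.card_insert_of_notMem hz,
      Finset.card_union_of_disjoint hdisj]
    omega
  have hcount : ∀ d, colourCount χ (insert y (insert z (R ∪ T))) d = colourCount χ R d +
      colourCount χ T d + (if χ z = d then 1 else 0) + if χ y = d then 1 else 0 := fun d => by
    rw [colourCount_insert_of_notMem hy', colourCount_insert_of_notMem hz,
      colourCount_union_of_disjoint hdisj]
  obtain ⟨t, ht⟩ := Finset.card_pos.1 (show 0 < T.card by omega)
  by_cases hpp : χ y = p ∧ χ z = p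
  · obtain ⟨u, hu, hru, hup⟩ := hans.reply_of_majority (d := p) (by
      rw [hQ, hcount, colourCount_eq_card hR, if_pos hpp.1, if_pos hpp.2]; omega) hr
    exact ⟨u, hu, hru, by simp [hup, hpp]⟩
  · obtain ⟨u, hu, hru, hup⟩ := hans.reply_of_majority (d := χ t) (by
      rw [hQ, hcount, colourCount_eq_card (D := T) fun x hx => htwo x t (hT x hx) (hT t ht)]
      rw [not_and_or] at hpp
      rcases hpp with h | h
      · rw [if_pos (htwo y t h (hT t ht))]; omega
      · rw [if_pos (htwo z t h (hT t ht))]; omega) hr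
    exact ⟨u, hu, hru, by simp [hup, hpp, hT t ht]⟩

/-- All colourings in `O` use just two colours; `A ∋ a₀` and `B ∋ b₀` are equally large sets of
balls of the one and of the other colour. -/
structure IsFrame (O : Set (Fin n → Fin c)) (A B : Finset (Fin n)) (a₀ b₀ : Fin n) : Prop where
  mem_left : a₀ ∈ A
  mem_right : b₀ ∈ B
  card_eq : B.card = A.card
  disj : Disjoint A B
  left : ∀ χ ∈ O, ∀ x ∈ A, χ x = χ a₀
  right : ∀ χ ∈ O, ∀ x ∈ B, χ x ≠ χ a₀
  two : ∀ χ ∈ O, ∀ x y, χ x ≠ χ a₀ → χ y ≠ χ a₀ → χ x = χ y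

/-- If `y` has the colour of `a₀` then so has `z`. -/
def SureLe (a₀ : Fin n) (Γ : Set (Fin n → Fin c)) (y z : Fin n) : Prop :=
  ∀ χ ∈ Γ, χ y = χ a₀ → χ z = χ a₀

/-- Exactly one of `y` and `z` has the colour of `a₀`. -/
def SureOpp (a₀ : Fin n) (Γ : Set (Fin n → Fin c)) (y z : Fin n) : Prop :=
  ∀ χ ∈ Γ, χ y = χ a₀ ↔ χ z ≠ χ a₀

/-- It is known whether `y` has the colour of `a₀`. -/
def IsSure (a₀ : Fin n) (Γ : Set (Fin n → Fin c)) (y : Fin n) : Prop :=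
  (∀ χ ∈ Γ, χ y = χ a₀) ∨ ∀ χ ∈ Γ, χ y ≠ χ a₀

namespace IsFrame

variable {A B : Finset (Fin n)} {a₀ b₀ y z : Fin n}

theorem right_iff (hf : IsFrame O A B a₀ b₀) {χ : Fin n → Fin c} (hχ : χ ∈ O) (x : Fin n) :
    χ x = χ b₀ ↔ χ x ≠ χ a₀ :=
  ⟨fun h => h ▸ hf.right χ hχ b₀ hf.mem_right,
    fun h => hf.two χ hχ x b₀ h (hf.right χ hχ b₀ hf.mem_right)⟩

/-- The two replies `u₁` and `u₂` behave on `O` as the conjunction and the disjunction of `y` and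
`z`. If either is `y` or `z`, this is an implication between them. If it lies in `A` or `B`, the
conjunction or disjunction is constant, and the only combination without an implication is
conjunction false and disjunction true. -/
theorem compare (hf : IsFrame O A B a₀ b₀) (hans : IsAnswerKind ans) (hyz : y ≠ z)
    (hy : y ∉ A ∪ B) (hz : z ∉ A ∪ B)
    (h₁ : Resolved ans Γ (insert y (insert z (A.erase a₀ ∪ B))))
    (h₂ : Resolved ans Γ (insert y (insert z (B.erase b₀ ∪ A)))) :
    SureLe a₀ (Γ ∩ O) y z ∨ SureLe a₀ (Γ ∩ O) z y ∨ SureOpp a₀ (Γ ∩ O) y z := by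
  obtain ⟨r₁, h₁⟩ := h₁
  obtain ⟨r₂, h₂⟩ := h₂
  have hA := Finset.card_erase_add_one hf.mem_left
  have hB := Finset.card_erase_add_one hf.mem_right
  have hc := hf.card_eq
  have hsub₁ : A.erase a₀ ∪ B ⊆ A ∪ B := Finset.union_subset_union_left (Finset.erase_subset _ _)
  have hsub₂ : B.erase b₀ ∪ A ⊆ A ∪ B :=
    Finset.union_subset ((Finset.erase_subset _ _).trans Finset.subset_union_right)
      Finset.subset_union_left
  have k₁ : ∀ χ ∈ Γ ∩ O, ∃ u ∈ insert y (insert z (A.erase a₀ ∪ B)), r₁ = some u ∧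
      (χ u = χ a₀ ↔ χ y = χ a₀ ∧ χ z = χ a₀) := fun χ hχ =>
    hans.reply_conjunction (by omega) (hf.disj.mono_left (Finset.erase_subset _ _)) hyz
      (fun h => hy (hsub₁ h)) (fun h => hz (hsub₁ h))
      (fun x hx => hf.left χ hχ.2 x (Finset.mem_of_mem_erase hx)) (hf.right χ hχ.2)
      (hf.two χ hχ.2) (h₁ χ hχ.1)
  have k₂ : ∀ χ ∈ Γ ∩ O, ∃ u ∈ insert y (insert z (B.erase b₀ ∪ A)), r₂ = some u ∧
      (χ u = χ b₀ ↔ χ y = χ b₀ ∧ χ z = χ b₀) := fun χ hχ =>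
    hans.reply_conjunction (by omega) (hf.disj.symm.mono_left (Finset.erase_subset _ _)) hyz
      (fun h => hy (hsub₂ h)) (fun h => hz (hsub₂ h))
      (fun x hx => (hf.right_iff hχ.2 x).2 (hf.right χ hχ.2 x (Finset.mem_of_mem_erase hx)))
      (fun x hx h => (hf.right_iff hχ.2 x).1 h (hf.left χ hχ.2 x hx))
      (fun x x' h h' => by
        rw [ne_eq, hf.right_iff hχ.2, not_not] at h h'
        rw [h, h'])
      (h₂ χ hχ.1)
  by_cases hne : (Γ ∩ O).Nonempty
  · obtain ⟨χ₀, hχ₀⟩ := hne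
    obtain ⟨u₁, hu₁, rfl, -⟩ := k₁ χ₀ hχ₀
    obtain ⟨u₂, hu₂, rfl, -⟩ := k₂ χ₀ hχ₀
    have e₁ : ∀ χ ∈ Γ ∩ O, (χ u₁ = χ a₀ ↔ χ y = χ a₀ ∧ χ z = χ a₀) := fun χ hχ => by
      obtain ⟨u, -, hu, h⟩ := k₁ χ hχ
      rwa [← Option.some.inj hu] at h
    have e₂ : ∀ χ ∈ Γ ∩ O, (χ u₂ = χ a₀ ↔ χ y = χ a₀ ∨ χ z = χ a₀) := fun χ hχ => by
      obtain ⟨u, -, hu, h⟩ := k₂ χ hχ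
      rw [← Option.some.inj hu, hf.right_iff hχ.2, hf.right_iff hχ.2, hf.right_iff hχ.2] at h
      tauto
    simp only [Finset.mem_insert, Finset.mem_union, Finset.mem_erase] at hu₁ hu₂
    rcases hu₁ with rfl | rfl | ⟨-, hu₁⟩ | hu₁
    · exact Or.inl fun χ hχ h => ((e₁ χ hχ).1 h).2
    · exact Or.inr (Or.inl fun χ hχ h => ((e₁ χ hχ).1 h).1)
    · exact Or.inl fun χ hχ _ => ((e₁ χ hχ).1 (hf.left χ hχ.2 u₁ hu₁)).2
    rcases hu₂ with rfl | rfl | ⟨-, hu₂⟩ | hu₂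
    · exact Or.inr (Or.inl fun χ hχ h => (e₂ χ hχ).2 (Or.inr h))
    · exact Or.inl fun χ hχ h => (e₂ χ hχ).2 (Or.inl h)
    · exact Or.inl fun χ hχ h => absurd ((e₂ χ hχ).2 (Or.inl h)) (hf.right χ hχ.2 u₂ hu₂)
    · refine Or.inr (Or.inr fun χ hχ => ?_)
      have f₁ := (e₁ χ hχ).not.1 (hf.right χ hχ.2 u₁ hu₁)
      have f₂ := (e₂ χ hχ).1 (hf.left χ hχ.2 u₂ hu₂)
      tauto
  · exact Or.inl fun χ hχ => absurd ⟨χ, hχ⟩ hne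

theorem reach_compare (hf : IsFrame O A B a₀ b₀) (hans : IsAnswerKind ans)
    (hq : q = 2 * A.card + 1) {P : Set (Fin n → Fin c) → Prop} {k : ℕ} (hyz : y ≠ z)
    (hy : y ∉ A ∪ B) (hz : z ∉ A ∪ B)
    (h : ∀ Γ' ⊆ Γ, SureLe a₀ (Γ' ∩ O) y z ∨ SureLe a₀ (Γ' ∩ O) z y ∨ SureOpp a₀ (Γ' ∩ O) y z →
      Reach q ans P k Γ') : Reach q ans P (k + 2) Γ := by
  have hA := Finset.card_erase_add_one hf.mem_left
  have hB := Finset.card_erase_add_one hf.mem_right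
  have hc := hf.card_eq
  have hcard : ∀ R T : Finset (Fin n), R ⊆ A ∪ B → T ⊆ A ∪ B → Disjoint R T →
      (insert y (insert z (R ∪ T))).card = R.card + T.card + 2 := by
    intro R T hR hT hRT
    have hRT' := Finset.union_subset hR hT
    rw [Finset.card_insert_of_notMem, Finset.card_insert_of_notMem fun h' => hz (hRT' h'),
      Finset.card_union_of_disjoint hRT]
    rw [Finset.mem_insert, not_or]
    exact ⟨hyz, fun h' => hy (hRT' h')⟩
  refine Reach.ask (k := k + 1) (Q := insert y (insert z (A.erase a₀ ∪ B))) ?_ fun Γ₁ h₁ r₁ => ?_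
  · rw [hcard _ _ ((Finset.erase_subset _ _).trans Finset.subset_union_left)
      Finset.subset_union_right (hf.disj.mono_left (Finset.erase_subset _ _))]
    omega
  refine Reach.ask (k := k) (Q := insert y (insert z (B.erase b₀ ∪ A))) ?_ fun Γ₂ h₂ r₂ => ?_
  · rw [hcard _ _ ((Finset.erase_subset _ _).trans Finset.subset_union_right)
      Finset.subset_union_left (hf.disj.symm.mono_left (Finset.erase_subset _ _))]
    omega
  exact h Γ₂ (h₂.trans h₁) (hf.compare hans hyz hy hz (r₁.mono h₂) r₂)

end IsFrame

end frame

/-! ### Finding a non-minority ball for the two-coloured colourings. -/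

section witness

variable {n c q : ℕ} {ans : BallKind n c} {Γ Γ' O : Set (Fin n → Fin c)}

/-- There is a ball `w` that is a non-minority ball for all colourings in `Γ ∩ O`, and there are two
disjoint sets of `N` or more balls other than `w`, one of which is known to consist of balls of the
colour of `w`. -/
def HasWitness (N : ℕ) (O Γ : Set (Fin n → Fin c)) : Prop :=
  ∃ (w : Fin n) (H₁ H₂ : Finset (Fin n)), Disjoint H₁ H₂ ∧ w ∉ H₁ ∧ w ∉ H₂ ∧ N ≤ H₁.card ∧
    N ≤ H₂.card ∧ ∀ χ ∈ Γ ∩ O, ((∀ x ∈ H₁, χ x = χ w) ∨ ∀ x ∈ H₂, χ x = χ w) ∧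
      n ≤ 2 * colourCount χ Finset.univ (χ w)

/-- Whichever of `D₁`, `D₂` has the colour of `w`, together with `W` it makes up half of the balls.
-/
theorem hasWitness_of_sets {N : ℕ} (hn : 6 * N ≤ n) {w : Fin n} {W D₁ D₂ : Finset (Fin n)}
    (hw : w ∈ W) (h₁ : Disjoint W D₁) (h₂ : Disjoint W D₂) (h₁₂ : Disjoint D₁ D₂)
    (hn₁ : n ≤ 2 * (W.card + D₁.card)) (hn₂ : n ≤ 2 * (W.card + D₂.card))
    (hW : ∀ χ ∈ Γ ∩ O, ∀ x ∈ W, χ x = χ w)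
    (hD : ∀ χ ∈ Γ ∩ O, (∀ x ∈ D₁, χ x = χ w) ∨ ∀ x ∈ D₂, χ x = χ w) : HasWitness N O Γ := by
  have hcount : ∀ χ ∈ Γ ∩ O, n ≤ 2 * colourCount χ Finset.univ (χ w) := by
    intro χ hχ
    have key : ∀ D : Finset (Fin n), Disjoint W D → (∀ x ∈ D, χ x = χ w) →
        W.card + D.card ≤ colourCount χ Finset.univ (χ w) := fun D hWD hDw => by
      rw [← Finset.card_union_of_disjoint hWD]
      refine card_le_colourCount (Finset.subset_univ _) fun x hx => ?_
      rcases Finset.mem_union.1 hx with hx | hx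
      · exact hW χ hχ x hx
      · exact hDw x hx
    rcases hD χ hχ with h | h
    · have := key D₁ h₁ h; omega
    · have := key D₂ h₂ h; omega
  -- A large `W` supplies both reservoirs by itself. Otherwise, since half of `n` is at least `3 *
  -- N`, each of `D₁` and `D₂` has at least `N` balls.
  by_cases hbig : 2 * N + 1 ≤ W.card
  · have hcard := Finset.card_erase_add_one hw
    obtain ⟨H₁, hH₁, hc₁⟩ := Finset.exists_subset_card_eq (show N ≤ (W.erase w).card by omega)
    have hcard' := Finset.card_sdiff_add_card_eq_card hH₁
    obtain ⟨H₂, hH₂, hc₂⟩ := Finset.exists_subset_card_eq (show N ≤ (W.erase w \ H₁).card by omega)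
    refine ⟨w, H₁, H₂, Finset.disjoint_of_subset_right hH₂ Finset.disjoint_sdiff,
      fun h => by simpa using hH₁ h, fun h => by simpa using hH₂ h, hc₁.ge, hc₂.ge,
      fun χ hχ => ⟨Or.inl fun x hx => hW χ hχ x (Finset.mem_of_mem_erase (hH₁ hx)), hcount χ hχ⟩⟩
  · exact ⟨w, D₁, D₂, h₁₂, Finset.disjoint_left.1 h₁ hw, Finset.disjoint_left.1 h₂ hw, by omega,
      by omega, fun χ hχ => ⟨hD χ hχ, hcount χ hχ⟩⟩

namespace IsFrame

variable {A B : Finset (Fin n)} {a₀ b₀ y z : Fin n} {N : ℕ}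

theorem colour_eq (hf : IsFrame O A B a₀ b₀) {χ : Fin n → Fin c} (hχ : χ ∈ O) {x x' : Fin n}
    (h : χ x = χ a₀ ↔ χ x' = χ a₀) : χ x = χ x' := by
  by_cases hx : χ x = χ a₀
  · rw [hx, h.1 hx]
  · exact hf.two χ hχ x x' hx fun hx' => hx (h.2 hx')

/-- If the balls are split into four sets, two of which have opposite known colours and two of which
have opposite unknown colours, then there is a witness. -/
theorem hasWitness_of_opp (hf : IsFrame O A B a₀ b₀) (hn : 6 * N ≤ n)
    (hopp : SureOpp a₀ (Γ ∩ O) y z)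
    (hall : ∀ x ∉ A ∪ B, IsSure a₀ (Γ ∩ O) x ∨ (∀ χ ∈ Γ ∩ O, χ x = χ a₀ ↔ χ y = χ a₀) ∨
      ∀ χ ∈ Γ ∩ O, χ x = χ a₀ ↔ χ z = χ a₀) : HasWitness N O Γ := by
  classical
  have hall' : ∀ x, IsSure a₀ (Γ ∩ O) x ∨ (∀ χ ∈ Γ ∩ O, χ x = χ a₀ ↔ χ y = χ a₀) ∨
      ∀ χ ∈ Γ ∩ O, χ x = χ a₀ ↔ χ z = χ a₀ := by
    intro x
    by_cases hx : x ∈ A ∪ B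
    · rcases Finset.mem_union.1 hx with hx | hx
      · exact Or.inl (Or.inl fun χ hχ => hf.left χ hχ.2 x hx)
      · exact Or.inl (Or.inr fun χ hχ => hf.right χ hχ.2 x hx)
    · exact hall x hx
  set T := Finset.univ.filter fun x => ∀ χ ∈ Γ ∩ O, χ x = χ a₀ with hT
  set F := Tᶜ.filter fun x => ∀ χ ∈ Γ ∩ O, χ x ≠ χ a₀ with hF
  set C := (Tᶜ \ F).filter fun x => ∀ χ ∈ Γ ∩ O, χ x = χ a₀ ↔ χ y = χ a₀ with hC
  set D := (Tᶜ \ F) \ C with hD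
  have hFT : F ⊆ Tᶜ := Finset.filter_subset _ _
  have hCT : C ⊆ Tᶜ \ F := Finset.filter_subset _ _
  have hDT : D ⊆ Tᶜ \ F := Finset.sdiff_subset
  have hcardT := Finset.card_compl_add_card T
  have hcardF := Finset.card_sdiff_add_card_eq_card hFT
  have hcardC := Finset.card_sdiff_add_card_eq_card hCT
  rw [Fintype.card_fin] at hcardT
  rw [← hD] at hcardC
  have dTF : Disjoint T F := Finset.disjoint_of_subset_right hFT disjoint_compl_right
  have dTC : Disjoint T C := Finset.disjoint_of_subset_right (hCT.trans Finset.sdiff_subset)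
    disjoint_compl_right
  have dTD : Disjoint T D := Finset.disjoint_of_subset_right (hDT.trans Finset.sdiff_subset)
    disjoint_compl_right
  have dFC : Disjoint F C := Finset.disjoint_of_subset_right hCT Finset.disjoint_sdiff
  have dFD : Disjoint F D := Finset.disjoint_of_subset_right hDT Finset.disjoint_sdiff
  have dCD : Disjoint C D := Finset.disjoint_sdiff
  have pT : ∀ χ ∈ Γ ∩ O, ∀ x ∈ T, χ x = χ a₀ := fun χ hχ x hx => (Finset.mem_filter.1 hx).2 χ hχ
  have pF : ∀ χ ∈ Γ ∩ O, ∀ x ∈ F, χ x ≠ χ a₀ := fun χ hχ x hx => (Finset.mem_filter.1 hx).2 χ hχ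
  have pC : ∀ χ ∈ Γ ∩ O, ∀ x ∈ C, (χ x = χ a₀ ↔ χ y = χ a₀) := fun χ hχ x hx =>
    (Finset.mem_filter.1 hx).2 χ hχ
  have pD : ∀ χ ∈ Γ ∩ O, ∀ x ∈ D, (χ x = χ a₀ ↔ χ y ≠ χ a₀) := by
    intro χ hχ x hx
    have hx' := Finset.mem_sdiff.1 hx
    have hxT := Finset.mem_sdiff.1 hx'.1
    rcases hall' x with (h | h) | h | h
    · exact absurd (Finset.mem_filter.2 ⟨Finset.mem_univ x, h⟩) (Finset.mem_compl.1 hxT.1)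
    · exact absurd (Finset.mem_filter.2 ⟨hxT.1, h⟩) hxT.2
    · exact absurd (Finset.mem_filter.2 ⟨hx'.1, h⟩) hx'.2
    · have := hopp χ hχ
      have := h χ hχ
      tauto
  have haT : a₀ ∈ T := Finset.mem_filter.2 ⟨Finset.mem_univ _, fun _ _ => rfl⟩
  have hTpos : 0 < T.card := Finset.card_pos.2 ⟨a₀, haT⟩
  -- Arrange the classes in the cycle `T`, `C`, `F`, `D`. Opposite edges of the cycle have sizes
  -- adding up to `n`, so one edge of each of the two pairs holds at least half of the balls. These
  -- two edges meet in a class, which takes the role of `W`.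
  by_cases h₁ : n ≤ 2 * (T.card + C.card) ∧ n ≤ 2 * (T.card + D.card)
  · refine hasWitness_of_sets hn haT dTC dTD dCD h₁.1 h₁.2 pT fun χ hχ => ?_
    by_cases hy : χ y = χ a₀
    · exact Or.inl fun x hx => (pC χ hχ x hx).2 hy
    · exact Or.inr fun x hx => (pD χ hχ x hx).2 hy
  by_cases h₂ : n ≤ 2 * (F.card + C.card) ∧ n ≤ 2 * (F.card + D.card)
  · obtain ⟨w, hw⟩ := Finset.card_pos.1 (show 0 < F.card by omega)
    refine hasWitness_of_sets hn hw dFC dFD dCD h₂.1 h₂.2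
      (fun χ hχ x hx => hf.two χ hχ.2 x w (pF χ hχ x hx) (pF χ hχ w hw)) fun χ hχ => ?_
    have hw' := pF χ hχ w hw
    by_cases hy : χ y = χ a₀
    · exact Or.inr fun x hx => hf.two χ hχ.2 x w (fun h => (pD χ hχ x hx).1 h hy) hw'
    · exact Or.inl fun x hx => hf.two χ hχ.2 x w (fun h => hy ((pC χ hχ x hx).1 h)) hw'
  by_cases h₃ : n ≤ 2 * (C.card + T.card) ∧ n ≤ 2 * (C.card + F.card)
  · obtain ⟨w, hw⟩ := Finset.card_pos.1 (show 0 < C.card by omega)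
    refine hasWitness_of_sets hn hw dTC.symm dFC.symm dTF h₃.1 h₃.2
      (fun χ hχ x hx => hf.colour_eq hχ.2 ((pC χ hχ x hx).trans (pC χ hχ w hw).symm)) fun χ hχ => ?_
    have hw' := pC χ hχ w hw
    by_cases hy : χ w = χ a₀
    · exact Or.inl fun x hx => (pT χ hχ x hx).trans hy.symm
    · exact Or.inr fun x hx => hf.two χ hχ.2 x w (pF χ hχ x hx) hy
  · obtain ⟨w, hw⟩ := Finset.card_pos.1 (show 0 < D.card by omega)
    refine hasWitness_of_sets hn hw dTD.symm dFD.symm dTF (by omega) (by omega)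
      (fun χ hχ x hx => hf.colour_eq hχ.2 ((pD χ hχ x hx).trans (pD χ hχ w hw).symm)) fun χ hχ => ?_
    by_cases hy : χ w = χ a₀
    · exact Or.inl fun x hx => (pT χ hχ x hx).trans hy.symm
    · exact Or.inr fun x hx => hf.two χ hχ.2 x w (pF χ hχ x hx) hy

end IsFrame

open Classical in
/-- The number of balls outside of `A ∪ B` that are not yet known to have the colour of `a₀` or the
other one. -/
noncomputable def unsureCount (A B : Finset (Fin n)) (a₀ : Fin n) (Γ : Set (Fin n → Fin c)) : ℕ :=
  ((A ∪ B)ᶜ.filter fun x => ¬ IsSure a₀ Γ x).card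

theorem SureLe.mono {a₀ y z : Fin n} (h : SureLe a₀ Γ y z) (hΓ : Γ' ⊆ Γ) : SureLe a₀ Γ' y z :=
  fun χ hχ => h χ (hΓ hχ)

theorem SureOpp.mono {a₀ y z : Fin n} (h : SureOpp a₀ Γ y z) (hΓ : Γ' ⊆ Γ) : SureOpp a₀ Γ' y z :=
  fun χ hχ => h χ (hΓ hχ)

theorem IsSure.mono {a₀ y : Fin n} (h : IsSure a₀ Γ y) (hΓ : Γ' ⊆ Γ) : IsSure a₀ Γ' y :=
  h.imp (fun h χ hχ => h χ (hΓ hχ)) fun h χ hχ => h χ (hΓ hχ)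

theorem SureOpp.isSure_of_le {a₀ y z : Fin n} (h : SureOpp a₀ Γ y z)
    (hle : SureLe a₀ Γ y z ∨ SureLe a₀ Γ z y) : IsSure a₀ Γ y ∧ IsSure a₀ Γ z := by
  rcases hle with hle | hle
  · refine ⟨Or.inr fun χ hχ hy => (h χ hχ).1 hy (hle χ hχ hy), Or.inl fun χ hχ => ?_⟩
    by_contra hz
    exact hz (hle χ hχ ((h χ hχ).2 hz))
  · refine ⟨Or.inl fun χ hχ => ?_, Or.inr fun χ hχ hz => (h χ hχ).1 (hle χ hχ hz) hz⟩
    by_contra hy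
    exact hy ((h χ hχ).2 fun hz => hy (hle χ hχ hz))

namespace IsFrame

variable {A B : Finset (Fin n)} {a₀ b₀ y z : Fin n} {N k : ℕ}

/-- Once `y` and `z` are sure, so is every ball identified with one of them; only balls of `R` not
yet treated can remain unsure. -/
theorem unsureCount_le (hle : IsSure a₀ (Γ ∩ O) y ∧ IsSure a₀ (Γ ∩ O) z) (R : Finset (Fin n))
    (hall : ∀ x ∉ A ∪ B, x ∉ R → IsSure a₀ (Γ ∩ O) x ∨
      (∀ χ ∈ Γ ∩ O, χ x = χ a₀ ↔ χ y = χ a₀) ∨ ∀ χ ∈ Γ ∩ O, χ x = χ a₀ ↔ χ z = χ a₀) :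
    unsureCount A B a₀ (Γ ∩ O) ≤ R.card := by
  have hequiv : ∀ {x t : Fin n}, IsSure a₀ (Γ ∩ O) t → (∀ χ ∈ Γ ∩ O, χ x = χ a₀ ↔ χ t = χ a₀) →
      IsSure a₀ (Γ ∩ O) x := fun {x t} ht hxt =>
    ht.imp (fun h χ hχ => (hxt χ hχ).2 (h χ hχ)) fun h χ hχ hx => h χ hχ ((hxt χ hχ).1 hx)
  classical
  refine Finset.card_le_card fun x hx => ?_
  obtain ⟨hx, hns⟩ := Finset.mem_filter.1 hx
  by_contra hxR
  rcases hall x (Finset.mem_compl.1 hx) hxR with h | h | h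
  · exact hns h
  · exact hns (hequiv hle.1 h)
  · exact hns (hequiv hle.2 h)

/-- Each ball of `R` is compared with both members of the opposite pair, for four queries. It
becomes sure, or is identified with `y` or `z`, or an implication between `y` and `z` follows. If
the last never happens, all balls fall into four classes; if it does, `y` and `z` become sure with
all balls identified with them, which pays for the queries spent. The extra four queries cover the
ball at which this occurs, as it may stay unsure. -/
theorem reach_orient (hf : IsFrame O A B a₀ b₀) (hans : IsAnswerKind ans)
    (hq : q = 2 * A.card + 1) (hn : 6 * N ≤ n) (hy : y ∉ A ∪ B) (hz : z ∉ A ∪ B)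
    (hk : ∀ Γ' ⊆ Γ, SureLe a₀ (Γ' ∩ O) y z ∨ SureLe a₀ (Γ' ∩ O) z y →
      Reach q ans (HasWitness N O) (6 * k + 4 * unsureCount A B a₀ (Γ' ∩ O)) Γ')
    (hopp : SureOpp a₀ (Γ ∩ O) y z) (R : Finset (Fin n)) (hR : ∀ x ∈ R, x ∉ A ∪ B)
    (hall : ∀ x ∉ A ∪ B, x ∉ R → IsSure a₀ (Γ ∩ O) x ∨
      (∀ χ ∈ Γ ∩ O, χ x = χ a₀ ↔ χ y = χ a₀) ∨ ∀ χ ∈ Γ ∩ O, χ x = χ a₀ ↔ χ z = χ a₀) :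
    Reach q ans (HasWitness N O) (6 * k + 4 * R.card + 4) Γ := by
  induction R using Finset.induction_on generalizing Γ with
  | empty => exact Reach.of_holds (hf.hasWitness_of_opp hn hopp fun x hx => hall x hx (by simp))
  | insert x R hxR ih =>
    rw [Finset.card_insert_of_notMem hxR]
    have hmono : ∀ Γ' ⊆ Γ, ∀ t ∉ A ∪ B, t ∉ insert x R → IsSure a₀ (Γ' ∩ O) t ∨
        (∀ χ ∈ Γ' ∩ O, χ t = χ a₀ ↔ χ y = χ a₀) ∨ ∀ χ ∈ Γ' ∩ O, χ t = χ a₀ ↔ χ z = χ a₀ := by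
      intro Γ' hΓ' t ht htR
      have hi : Γ' ∩ O ⊆ Γ ∩ O := Set.inter_subset_inter_left _ hΓ'
      exact (hall t ht htR).imp (fun h => h.mono hi)
        (Or.imp (fun h χ hχ => h χ (hi hχ)) fun h χ hχ => h χ (hi hχ))
    have step : ∀ Γ' ⊆ Γ, (IsSure a₀ (Γ' ∩ O) x ∨ (∀ χ ∈ Γ' ∩ O, χ x = χ a₀ ↔ χ y = χ a₀) ∨
        ∀ χ ∈ Γ' ∩ O, χ x = χ a₀ ↔ χ z = χ a₀) →
        Reach q ans (HasWitness N O) (6 * k + 4 * R.card + 4) Γ' := by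
      intro Γ' hΓ' hx
      refine ih (fun Γ₂ h₂ => hk Γ₂ (h₂.trans hΓ'))
        (hopp.mono (Set.inter_subset_inter_left _ hΓ')) (fun t ht => hR t (by simp [ht])) ?_
      intro t ht htR
      by_cases htx : t = x
      · exact htx ▸ hx
      · exact hmono Γ' hΓ' t ht (by simp [htx, htR])
    have hxAB := hR x (by simp)
    by_cases hxy : x = y
    · exact (step Γ subset_rfl (Or.inr (Or.inl fun χ _ => by rw [hxy]))).mono_steps (by omega)
    by_cases hxz : x = z
    · exact (step Γ subset_rfl (Or.inr (Or.inr fun χ _ => by rw [hxz]))).mono_steps (by omega)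
    have key : Reach q ans (HasWitness N O) (6 * k + 4 * R.card + 4 + 2 + 2) Γ := by
      refine hf.reach_compare hans hq hxy hxAB hy fun Γ₁ h₁ c₁ => ?_
      refine hf.reach_compare hans hq hxz hxAB hz fun Γ₂ h₂ c₂ => ?_
      have hi : Γ₂ ∩ O ⊆ Γ₁ ∩ O := Set.inter_subset_inter_left _ h₂
      have hopp₂ := hopp.mono (Set.inter_subset_inter_left O (h₂.trans h₁))
      have hdone : SureLe a₀ (Γ₂ ∩ O) y z ∨ SureLe a₀ (Γ₂ ∩ O) z y →
          Reach q ans (HasWitness N O) (6 * k + 4 * R.card + 4) Γ₂ := by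
        intro hle
        refine (hk Γ₂ (h₂.trans h₁) hle).mono_steps ?_
        have := unsureCount_le (A := A) (B := B) (hopp₂.isSure_of_le hle) (insert x R)
          (hmono Γ₂ (h₂.trans h₁))
        rw [Finset.card_insert_of_notMem hxR] at this
        omega
      -- As `y` and `z` are opposite, being below both or above both makes `x` sure, being between
      -- them orders them, and being opposite to one identifies `x` with the other.
      rcases c₁ with c₁ | c₁ | c₁
      · rcases c₂ with c₂ | c₂ | c₂
        · refine step Γ₂ (h₂.trans h₁) (Or.inl (Or.inr fun χ hχ hx => ?_))
          exact (hopp₂ χ hχ).1 (c₁ χ (hi hχ) hx) (c₂ χ hχ hx)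
        · exact hdone (Or.inr fun χ hχ h => c₁ χ (hi hχ) (c₂ χ hχ h))
        · refine step Γ₂ (h₂.trans h₁) (Or.inr (Or.inl fun χ hχ => ?_))
          exact (c₂ χ hχ).trans (hopp₂ χ hχ).symm
      · rcases c₂ with c₂ | c₂ | c₂
        · exact hdone (Or.inl fun χ hχ h => c₂ χ hχ (c₁ χ (hi hχ) h))
        · refine step Γ₂ (h₂.trans h₁) (Or.inl (Or.inl fun χ hχ => ?_))
          by_cases hyy : χ y = χ a₀
          · exact c₁ χ (hi hχ) hyy
          · refine c₂ χ hχ ?_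
            by_contra hzz
            exact hyy ((hopp₂ χ hχ).2 hzz)
        · refine step Γ₂ (h₂.trans h₁) (Or.inr (Or.inl fun χ hχ => ?_))
          exact (c₂ χ hχ).trans (hopp₂ χ hχ).symm
      · refine step Γ₂ (h₂.trans h₁) (Or.inr (Or.inr fun χ hχ => ?_))
        rw [c₁ χ (hi hχ), ne_eq, hopp₂ χ hχ, not_not]
    exact key.mono_steps (by omega)

/-- The comparison model behind a frame. The cost of an unfinished comparison is charged to the
balls that become sure. -/
noncomputable def comparisonModel (q : ℕ) (ans : BallKind n c) (N : ℕ) (O : Set (Fin n → Fin c))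
    (A B : Finset (Fin n)) (a₀ : Fin n) : ComparisonModel (Set (Fin n → Fin c))ᵒᵈ (Fin n) where
  le κ y z := SureLe a₀ (OrderDual.ofDual κ ∩ O) y z
  -- A comparison is allotted six queries: two to ask it and the four of overhead in `reach_orient`.
  -- The potential of four per unsure ball pays for the rest.
  win k κ := Reach q ans (HasWitness N O)
    (6 * k + 4 * unsureCount A B a₀ (OrderDual.ofDual κ ∩ O)) (OrderDual.ofDual κ)
  le_refl _ _ _ _ h := h
  le_trans _ _ _ _ h₁ h₂ χ hχ h := h₂ χ hχ (h₁ χ hχ h)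
  le_mono _ _ _ _ hκ h := h.mono (Set.inter_subset_inter_left _ hκ)
  win_mono _ _ _ hkl h := h.mono_steps (by omega)

theorem canCompare (hf : IsFrame O A B a₀ b₀) (hans : IsAnswerKind ans)
    (hq : q = 2 * A.card + 1) (hn : 6 * N ≤ n) :
    (comparisonModel q ans N O A B a₀).CanCompare (A ∪ B)ᶜ := by
  classical
  intro κ k y hy z hz hk
  rw [Finset.mem_compl] at hy hz
  by_cases hyz : y = z
  · have := hk κ le_rfl (Or.inl (hyz ▸ ComparisonModel.le_refl _ κ y))
    exact ComparisonModel.win_mono _ _ _ _ (by omega) this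
  have hk' : ∀ Γ' ⊆ OrderDual.ofDual κ, SureLe a₀ (Γ' ∩ O) y z ∨ SureLe a₀ (Γ' ∩ O) z y →
      Reach q ans (HasWitness N O) (6 * k + 4 * unsureCount A B a₀ (Γ' ∩ O)) Γ' :=
    fun Γ' hΓ' hle => hk (OrderDual.toDual Γ') hΓ' hle
  have hmono : ∀ Γ' ⊆ OrderDual.ofDual κ, unsureCount A B a₀ (Γ' ∩ O) ≤
      unsureCount A B a₀ (OrderDual.ofDual κ ∩ O) := fun Γ' hΓ' =>
    Finset.card_le_card (Finset.monotone_filter_right _ fun x _ hx h => hx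
      (h.mono (Set.inter_subset_inter_left _ hΓ')))
  have key : Reach q ans (HasWitness N O)
      (6 * k + 4 * unsureCount A B a₀ (OrderDual.ofDual κ ∩ O) + 4 + 2) (OrderDual.ofDual κ) := by
    refine hf.reach_compare hans hq hyz hy hz fun Γ₁ h₁ c₁ => ?_
    have h₂ := hmono Γ₁ h₁
    rcases or_assoc.2 c₁ with c₁ | c₁
    · exact (hk' Γ₁ h₁ c₁).mono_steps (by omega)
    · refine (hf.reach_orient hans hq hn hy hz (fun Γ₂ h₃ => hk' Γ₂ (h₃.trans h₁)) c₁
        ((A ∪ B)ᶜ.filter fun x => ¬ IsSure a₀ (Γ₁ ∩ O) x) (fun x hx => ?_)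
        fun x hx hxR => ?_).mono_steps (l := _) ?_
      · exact Finset.mem_compl.1 (Finset.mem_filter.1 hx).1
      · left
        by_contra hns
        exact hxR (Finset.mem_filter.2 ⟨Finset.mem_compl.2 hx, hns⟩)
      · have : (((A ∪ B)ᶜ.filter fun x => ¬ IsSure a₀ (Γ₁ ∩ O) x)).card =
            unsureCount A B a₀ (Γ₁ ∩ O) := by unfold unsureCount; congr
        omega
  exact key.mono_steps (by omega)

/-- A witness can be found with linearly many queries. -/
theorem reach_hasWitness (hf : IsFrame O A B a₀ b₀) (hans : IsAnswerKind ans)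
    (hq : q = 2 * A.card + 1) (hn : 6 * N ≤ n) (hAn : 2 * A.card < n) :
    Reach q ans (HasWitness N O) (1204 * n) Γ := by
  classical
  have hc := hf.card_eq
  have hAB : (A ∪ B).card = 2 * A.card := by
    rw [Finset.card_union_of_disjoint hf.disj]; omega
  have hY := Finset.card_compl_add_card (A ∪ B)
  rw [Fintype.card_fin] at hY
  have key : (comparisonModel q ans N O A B a₀).win (0 + 200 * (A ∪ B)ᶜ.card)
      (OrderDual.toDual Γ) := by
    refine (hf.canCompare hans hq hn).select (r := (A ∪ B)ᶜ.card / 2) (by omega) ?_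
    intro κ' _ w Lo Hi hs hLo
    have hcard := hs.card
    have hsub : ∀ D, D ⊆ (A ∪ B)ᶜ.erase w → Disjoint D A ∧ Disjoint D B ∧ w ∉ D := fun D hD => by
      have hD' : Disjoint D (A ∪ B) := Finset.disjoint_of_subset_left
        (hD.trans (Finset.erase_subset _ _)) disjoint_compl_left
      rw [Finset.disjoint_union_right] at hD'
      exact ⟨hD'.1, hD'.2, fun h => by simpa using hD h⟩
    obtain ⟨l₁, l₂, l₃⟩ := hsub Lo hs.lo_subset
    obtain ⟨m₁, m₂, m₃⟩ := hsub Hi hs.hi_subset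
    have hw := Finset.mem_compl.1 hs.mem
    rw [Finset.mem_union, not_or] at hw
    have c₁ : (Lo ∪ B).card = Lo.card + B.card := Finset.card_union_of_disjoint l₂
    have c₂ : (Hi ∪ A).card = Hi.card + A.card := Finset.card_union_of_disjoint m₁
    -- If the median `w` has the colour of `a₀`, so does everything above it and all of `A`;
    -- otherwise everything below it and all of `B` has the other colour, like `w`.
    refine Reach.of_holds (hasWitness_of_sets hn (w := w) (W := {w}) (D₁ := Lo ∪ B)
      (D₂ := Hi ∪ A) (by simp) ?_ ?_ ?_ ?_ ?_ (by simp) ?_)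
    · simp [l₃, hw.2]
    · simp [m₃, hw.1]
    · rw [Finset.disjoint_union_left, Finset.disjoint_union_right, Finset.disjoint_union_right]
      exact ⟨⟨hs.disj, l₁⟩, m₂.symm, hf.disj.symm⟩
    · rw [Finset.card_singleton]; omega
    · rw [Finset.card_singleton]; omega
    · intro χ hχ
      by_cases hwa : χ w = χ a₀
      · right
        intro x hx
        rcases Finset.mem_union.1 hx with hx | hx
        · exact (hs.hi x hx χ hχ hwa).trans hwa.symm
        · exact (hf.left χ hχ.2 x hx).trans hwa.symm
      · left
        intro x hx
        rcases Finset.mem_union.1 hx with hx | hx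
        · exact hf.two χ hχ.2 x w (fun h => hwa (hs.lo x hx χ hχ h)) hwa
        · exact hf.two χ hχ.2 x w (hf.right χ hχ.2 x hx) hwa
  -- Selection takes at most `200 * n` comparisons at six queries each, and the initial potential is
  -- at most `4 * n`.
  refine Reach.mono_steps (l := 1204 * n) key ?_
  have : unsureCount A B a₀ (OrderDual.ofDual (OrderDual.toDual Γ) ∩ O) ≤ (A ∪ B)ᶜ.card :=
    Finset.card_filter_le _ _
  omega

end IsFrame

end witness

/-! ### From a witness to a ball that is correct for dominated colourings too. -/

section dominated

variable {n c q : ℕ} {ans : BallKind n c} {Γ O : Set (Fin n → Fin c)}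

/-- At most one colour occurs `L` or more times. -/
def IsDominated (L : ℕ) (χ : Fin n → Fin c) : Prop :=
  ∀ d e, L ≤ colourCount χ Finset.univ d → L ≤ colourCount χ Finset.univ e → d = e

/-- The colours other than the frequent one have fewer than `L` balls each, hence at most half of
the balls altogether. -/
theorem IsDominated.le_two_mul {L : ℕ} {χ : Fin n → Fin c} (h : IsDominated L χ)
    (hn : 2 * (c * L) ≤ n) {u : Fin n} (hu : L ≤ colourCount χ Finset.univ (χ u)) :
    n ≤ 2 * colourCount χ Finset.univ (χ u) := by
  have hsum := sum_colourCount (χ := χ) (Q := Finset.univ)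
  rw [Finset.card_univ, Fintype.card_fin, ← Finset.add_sum_erase _ _ (Finset.mem_univ (χ u))] at hsum
  have hle : ∑ d ∈ Finset.univ.erase (χ u), colourCount χ Finset.univ d ≤ c * L := by
    refine (Finset.sum_le_card_nsmul _ _ L fun d hd => ?_).trans ?_
    · by_contra! hlt
      exact (Finset.ne_of_mem_erase hd) (h d (χ u) hlt.le hu)
    · rw [smul_eq_mul]
      refine Nat.mul_le_mul_right _ ((Finset.card_erase_le).trans ?_)
      simp
  omega

theorem isNonMinorityBall_univ {χ : Fin n → Fin c} {u : Fin n}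
    (h : n ≤ 2 * colourCount χ Finset.univ (χ u)) : IsNonMinorityBall χ Finset.univ u :=
  ⟨Finset.mem_univ u, by rwa [Finset.card_univ, Fintype.card_fin]⟩

/-- Some ball is a non-minority ball for all colourings in `Γ`. -/
def HasNonMinorityBall (Γ : Set (Fin n → Fin c)) : Prop :=
  ∃ u, ∀ χ ∈ Γ, IsNonMinorityBall χ Finset.univ u

/-- If all balls of the large set `Z` are known to be non-minority balls for the colourings in `O`,
and all other colourings are dominated, then `2 ^ |Z|` queries suffice. -/
theorem reach_hasNonMinorityBall_of_sure_set (hans : IsAnswerKind ans) (hq : 2 ≤ q) {L : ℕ}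
    (hn : 2 * (c * L) ≤ n) (hdom : ∀ χ ∈ Γ, χ ∉ O → IsDominated L χ) {Z : Finset (Fin n)}
    (hZ : (c * q) * (2 * L + 1) < Z.card)
    (hO : ∀ χ ∈ Γ ∩ O, ∀ x ∈ Z, n ≤ 2 * colourCount χ Finset.univ (χ x)) :
    Reach q ans HasNonMinorityBall (2 ^ Z.card) Γ := by
  refine (Reach.askOn (k := 0) Z fun Γ' hΓ' hres => Reach.of_holds ?_).mono_steps (by omega)
  obtain ⟨u, hu, hL⟩ := exists_heavy hans hq L hres hZ.le (by omega)
  refine ⟨u, fun χ hχ => isNonMinorityBall_univ ?_⟩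
  by_cases hχO : χ ∈ O
  · exact hO χ ⟨hΓ' hχ, hχO⟩ u hu
  · exact (hdom χ (hΓ' hχ) hχO).le_two_mul hn
      ((hL χ hχ).le.trans (colourCount_mono (Finset.subset_univ _) _))

/-- Querying `w` together with parts of two sets, one of which has the colour of `w`, yields either
many balls that have the colour of `w` for the colourings in `O`, or many balls that have the colour
of `w` for all colourings. -/
theorem reach_twins (hans : IsAnswerKind ans) {a : ℕ} (ha : 1 ≤ a)
    {P : Set (Fin n → Fin c) → Prop} {k s t : ℕ} {w : Fin n} {H₁ H₂ V Z : Finset (Fin n)} {j : ℕ}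
    (hH : Disjoint H₁ H₂) (hw₁ : w ∉ H₁) (hw₂ : w ∉ H₂) (hs₁ : s * a ≤ H₁.card)
    (hs₂ : s * a ≤ H₂.card)
    (hsure : ∀ χ ∈ Γ ∩ O, (∀ x ∈ H₁, χ x = χ w) ∨ ∀ x ∈ H₂, χ x = χ w)
    (hV₁ : Disjoint V H₁) (hV₂ : Disjoint V H₂) (hwV : w ∉ V) (hZV : Z ⊆ V)
    (hZ : ∀ χ ∈ Γ ∩ O, ∀ x ∈ Z, χ x = χ w) (hj : ∀ χ ∈ Γ, j ≤ colourCount χ V (χ w))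
    (ht : Z.card + j + s = t)
    (hk : ∀ Γ' ⊆ Γ, ∀ (Z : Finset (Fin n)) (j : ℕ), Z.card + j = t →
      (∀ χ ∈ Γ' ∩ O, ∀ x ∈ Z, χ x = χ w) →
      (∀ χ ∈ Γ', j ≤ colourCount χ Finset.univ (χ w)) → Reach (2 * a + 1) ans P k Γ') :
    Reach (2 * a + 1) ans P (k + s) Γ := by
  induction s generalizing Γ H₁ H₂ V Z j with
  | zero =>
    exact hk Γ subset_rfl Z j ht hZ fun χ hχ =>
      (hj χ hχ).trans (colourCount_mono (Finset.subset_univ _) _)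
  | succ s ih =>
    rw [add_mul, one_mul] at hs₁ hs₂
    obtain ⟨E₁, hE₁, hc₁⟩ := Finset.exists_subset_card_eq (show a ≤ H₁.card by omega)
    obtain ⟨E₂, hE₂, hc₂⟩ := Finset.exists_subset_card_eq (show a ≤ H₂.card by omega)
    have hd₁ := Finset.card_sdiff_add_card_eq_card hE₁
    have hd₂ := Finset.card_sdiff_add_card_eq_card hE₂
    have hE : Disjoint E₁ E₂ := Finset.disjoint_of_subset_left hE₁
      (Finset.disjoint_of_subset_right hE₂ hH)
    have hwE : w ∉ E₁ ∪ E₂ := by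
      rw [Finset.mem_union, not_or]
      exact ⟨fun h => hw₁ (hE₁ h), fun h => hw₂ (hE₂ h)⟩
    have hcE : (E₁ ∪ E₂).card = 2 * a := by rw [Finset.card_union_of_disjoint hE]; omega
    have hVE : Disjoint V (E₁ ∪ E₂) := by
      rw [Finset.disjoint_union_right]
      exact ⟨hV₁.mono_right hE₁, hV₂.mono_right hE₂⟩
    have hcQ : (insert w (E₁ ∪ E₂)).card = 2 * a + 1 := by
      rw [Finset.card_insert_of_notMem hwE, hcE]
    refine Reach.ask (k := k + s) hcQ fun Γ₁ h₁ hres => ?_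
    obtain ⟨r, hr⟩ := hres
    have hi : Γ₁ ∩ O ⊆ Γ ∩ O := Set.inter_subset_inter_left _ h₁
    have hreply : ∀ χ ∈ Γ₁ ∩ O, ∃ u ∈ insert w (E₁ ∪ E₂), r = some u ∧ χ u = χ w := by
      intro χ hχ
      refine hans.reply_of_majority ?_ (hr χ hχ.1)
      rw [hcQ, colourCount_insert_of_notMem hwE, if_pos rfl, colourCount_union_of_disjoint hE]
      rcases hsure χ (hi hχ) with h | h
      · rw [colourCount_eq_card (D := E₁) fun x hx => h x (hE₁ hx)]; omega
      · rw [colourCount_eq_card (D := E₂) fun x hx => h x (hE₂ hx)]; omega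
    have step : ∀ (Z' : Finset (Fin n)) (j' : ℕ), Z' ⊆ V ∪ (E₁ ∪ E₂) →
        (∀ χ ∈ Γ₁ ∩ O, ∀ x ∈ Z', χ x = χ w) →
        (∀ χ ∈ Γ₁, j' ≤ colourCount χ (V ∪ (E₁ ∪ E₂)) (χ w)) → Z'.card + j' + s = t →
        Reach (2 * a + 1) ans P (k + s) Γ₁ := by
      intro Z' j' hZ'V hZ' hj' ht'
      have hdV : ∀ {G H E : Finset (Fin n)}, Disjoint V H → Disjoint G H → E ⊆ H →
          Disjoint (V ∪ (E ∪ G)) (H \ E) := fun h₁ h₂ h₃ => by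
        rw [Finset.disjoint_union_left, Finset.disjoint_union_left]
        exact ⟨h₁.mono_right Finset.sdiff_subset, Finset.disjoint_sdiff,
          h₂.mono_right Finset.sdiff_subset⟩
      refine ih (H₁ := H₁ \ E₁) (H₂ := H₂ \ E₂) (V := V ∪ (E₁ ∪ E₂)) (Z := Z') (j := j')
        (Finset.disjoint_of_subset_left Finset.sdiff_subset
          (Finset.disjoint_of_subset_right Finset.sdiff_subset hH))
        (fun h => hw₁ (Finset.sdiff_subset h)) (fun h => hw₂ (Finset.sdiff_subset h))
        (by omega) (by omega)
        (fun χ hχ => (hsure χ (hi hχ)).imp (fun h x hx => h x (Finset.sdiff_subset hx))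
          fun h x hx => h x (Finset.sdiff_subset hx))
        (hdV hV₁ (hH.symm.mono_left hE₂) hE₁) ?_ ?_ hZ'V hZ' hj' ht'
        fun Γ₂ h₂ => hk Γ₂ (h₂.trans h₁)
      · rw [Finset.union_comm E₁ E₂]
        exact hdV hV₂ (hH.mono_left hE₁) hE₂
      · rw [Finset.mem_union, not_or]
        exact ⟨hwV, hwE⟩
    have hnew : ∀ u ∈ E₁ ∪ E₂, (∀ χ ∈ Γ₁ ∩ O, χ u = χ w) →
        Reach (2 * a + 1) ans P (k + s) Γ₁ := by
      intro u hu hsame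
      have huZ : u ∉ Z := fun h => Finset.disjoint_left.1 hVE (hZV h) hu
      refine step (insert u Z) j ?_ ?_ ?_ ?_
      · exact Finset.insert_subset (Finset.mem_union_right _ hu)
          (hZV.trans Finset.subset_union_left)
      · intro χ hχ x hx
        rcases Finset.mem_insert.1 hx with rfl | hx
        · exact hsame χ hχ
        · exact hZ χ (hi hχ) x hx
      · exact fun χ hχ => (hj χ (h₁ hχ)).trans (colourCount_mono Finset.subset_union_left _)
      · rw [Finset.card_insert_of_notMem huZ]; omega
    -- The reply `w` shows, for all colourings, that a fresh ball has the colour of `w`, though not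
    -- which one. Any other reply is a fresh ball that has the colour of `w` on `O`.
    by_cases hrw : r = some w
    · refine step Z (j + 1) (hZV.trans Finset.subset_union_left) (fun χ hχ => hZ χ (hi hχ)) ?_
        (by omega)
      intro χ hχ
      have hrχ := hr χ hχ
      rw [hrw] at hrχ
      obtain ⟨y, hy, hyw, hyc⟩ := hans.exists_ne_of_reply (by omega) hrχ
      have hy' := (Finset.mem_insert.1 hy).resolve_left hyw
      have hpos := colourCount_pos.2 ⟨y, hy', hyc⟩
      have := hj χ (h₁ hχ)
      rw [colourCount_union_of_disjoint hVE]
      omega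
    · by_cases hne : (Γ₁ ∩ O).Nonempty
      · obtain ⟨χ₀, hχ₀⟩ := hne
        obtain ⟨u, hu, hru, -⟩ := hreply χ₀ hχ₀
        have huw : u ≠ w := fun h => hrw (h ▸ hru)
        refine hnew u ((Finset.mem_insert.1 hu).resolve_left huw) fun χ hχ => ?_
        obtain ⟨u', -, hru', h⟩ := hreply χ hχ
        rwa [Option.some.inj (hru.symm.trans hru')]
      · obtain ⟨e, he⟩ := Finset.card_pos.1 (show 0 < E₁.card by omega)
        exact hnew e (Finset.mem_union_left _ he) fun χ hχ => absurd ⟨χ, hχ⟩ hne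

/-- A witness for the colourings in `O` leads to a non-minority ball, if all other colourings are
dominated. -/
theorem HasWitness.reach_hasNonMinorityBall (hans : IsAnswerKind ans) {a : ℕ} (ha : 1 ≤ a) {L t : ℕ}
    (ht : t = (c * (2 * a + 1)) * (2 * L + 1) + 1 + L) (hn : 2 * (c * L) ≤ n)
    (hdom : ∀ χ ∈ Γ, χ ∉ O → IsDominated L χ) (h : HasWitness (t * a) O Γ) :
    Reach (2 * a + 1) ans HasNonMinorityBall (2 ^ t + t) Γ := by
  obtain ⟨w, H₁, H₂, hH, hw₁, hw₂, hc₁, hc₂, hw⟩ := h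
  refine reach_twins hans ha (V := ∅) (Z := ∅) (j := 0) (t := t) hH hw₁ hw₂ hc₁ hc₂
    (fun χ hχ => (hw χ hχ).1) (by simp) (by simp) (by simp) (by simp) (by simp) (by simp) (by simp) ?_
  intro Γ' hΓ' Z j hZj hZ hj
  have hi : Γ' ∩ O ⊆ Γ ∩ O := Set.inter_subset_inter_left _ hΓ'
  -- Of the `t` queries, either at least `L` returned `w`, whose colour is then the frequent one in
  -- every dominated colouring, or more than `(c * q) * (2 * L + 1)` balls were collected, enough
  -- for a heavy ball among them.
  by_cases hLj : L ≤ j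
  · refine Reach.of_holds ⟨w, fun χ hχ => isNonMinorityBall_univ ?_⟩
    by_cases hχO : χ ∈ O
    · exact (hw χ ⟨hΓ' hχ, hχO⟩).2
    · exact (hdom χ (hΓ' hχ) hχO).le_two_mul hn (hLj.trans (hj χ hχ))
  · refine (reach_hasNonMinorityBall_of_sure_set (O := O) (Z := Z) hans (by omega) hn
      (fun χ hχ => hdom χ (hΓ' hχ)) (by omega) fun χ hχ x hx => ?_).mono_steps
      (Nat.pow_le_pow_right (by norm_num) (by omega))
    rw [hZ χ hχ x hx]
    exact (hw χ (hi hχ)).2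

end dominated

/-! ### Colourings with exactly two colours and their frames. -/

section twoFrequent

variable {n c q : ℕ} {ans : BallKind n c} {Γ : Set (Fin n → Fin c)}

/-- Two colours occur `L` or more times in `S`. -/
def HasTwoFrequent (L : ℕ) (S : Finset (Fin n)) (χ : Fin n → Fin c) : Prop :=
  ∃ r b, r ≠ b ∧ L ≤ colourCount χ S r ∧ L ≤ colourCount χ S b

theorem isDominated_of_not_hasTwoFrequent {L : ℕ} {S : Finset (Fin n)}
    (hcore : IsCore L Γ S Finset.univ) {χ : Fin n → Fin c} (hχ : χ ∈ Γ)
    (h : ¬ HasTwoFrequent L S χ) : IsDominated L χ := by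
  intro d e hd he
  by_contra hde
  have h₁ := hcore χ hχ d
  have h₂ := hcore χ hχ e
  exact h ⟨d, e, hde, by omega, by omega⟩

/-- For odd `q`, a colouring with two frequent colours that is not rich has no other colours. -/
theorem exists_two_colours {L : ℕ} (hL : 0 < L) {S : Finset (Fin n)}
    (hcore : IsCore L Γ S Finset.univ) {χ : Fin n → Fin c} (hχ : χ ∈ Γ)
    (h : HasTwoFrequent L S χ) (hrich : ¬ IsRich q L S χ) :
    ∃ r b, r ≠ b ∧ L ≤ colourCount χ S r ∧ L ≤ colourCount χ S b ∧ ∀ x, χ x = r ∨ χ x = b := by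
  obtain ⟨r, b, hrb, hr, hb⟩ := h
  refine ⟨r, b, hrb, hr, hb, fun x => ?_⟩
  by_contra hx
  rw [not_or] at hx
  have h₁ := hcore χ hχ (χ x)
  have h₂ : 0 < colourCount χ Finset.univ (χ x) := colourCount_pos.2 ⟨x, Finset.mem_univ x, rfl⟩
  obtain ⟨g, hg, hgx⟩ := colourCount_pos.1 (show 0 < colourCount χ S (χ x) by omega)
  exact hrich ⟨r, b, hrb, hr, hb, fun _ => ⟨g, hg, hgx ▸ hx.1, hgx ▸ hx.2⟩⟩

/-- With only two colours every query of odd size has a majority, so each resolved query has a ball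
that is a majority ball under all colourings in `Γ`. The theorem on opposite sets then applies to
the family of 0-1 functions given by the colourings. -/
theorem exists_isFrame (hans : IsAnswerKind ans) {a L : ℕ} (ha : 1 ≤ a) (hL : 5 * a ≤ L)
    {S : Finset (Fin n)} (hres : ResolvedOn (2 * a + 1) ans Γ S) (hne : Γ.Nonempty)
    (htwo : ∀ χ ∈ Γ, ∃ r b, r ≠ b ∧ L ≤ colourCount χ S r ∧ L ≤ colourCount χ S b ∧
      ∀ x, χ x = r ∨ χ x = b) :
    ∃ A B a₀ b₀, IsFrame Γ A B a₀ b₀ ∧ A.card = a := by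
  classical
  obtain ⟨χ₀, hχ₀⟩ := hne
  have hScard : 10 * a ≤ S.card := by
    obtain ⟨r, b, hrb, hr, hb, -⟩ := htwo χ₀ hχ₀
    have := colourCount_add_colourCount_le (χ := χ₀) (Q := S) hrb
    omega
  obtain ⟨x₀, -⟩ := Finset.card_pos.1 (show 0 < S.card by omega)
  -- The names of the two colours may vary with `χ`; comparing with the fixed ball `x₀` encodes only
  -- the partition.
  set v : Γ → Fin n → Bool := fun χ x => decide (χ.1 x = χ.1 x₀) with hv
  have hiff : ∀ χ : Γ, ∀ x y, v χ x = v χ y ↔ χ.1 x = χ.1 y := by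
    intro χ x y
    obtain ⟨r, b, hrb, -, -, h⟩ := htwo χ.1 χ.2
    simp only [hv, decide_eq_decide]
    rcases h x with hx | hx <;> rcases h y with hy | hy <;> rcases h x₀ with h₀ | h₀ <;>
      simp [hx, hy, h₀, hrb, hrb.symm]
  have hcount : ∀ χ : Γ, ∀ (Q : Finset (Fin n)) u,
      boolCount (v χ) Q (v χ u) = colourCount χ.1 Q (χ.1 u) := by
    intro χ Q u
    unfold boolCount colourCount
    simp only [hiff]
  have hmaj : HasMajorities v a S := by
    intro Q hQ hQc
    obtain ⟨r, hr⟩ := hres Q hQ hQc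
    have hreply : ∀ χ ∈ Γ, ∃ u ∈ Q, r = some u ∧ Q.card < 2 * colourCount χ Q (χ u) := by
      intro χ hχ
      obtain ⟨d, hd⟩ : ∃ d, Q.card < 2 * colourCount χ Q d := by
        obtain ⟨d, e, hde, -, -, h⟩ := htwo χ hχ
        have hsum : Q.card = colourCount χ Q d + colourCount χ Q e := by
          unfold colourCount
          rw [← Finset.card_filter_add_card_filter_not (s := Q) (fun y => χ y = d)]
          congr 2
          ext y
          simp only [Finset.mem_filter, and_congr_right_iff]
          intro _
          rcases h y with hy | hy <;> simp [hy, hde, hde.symm]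
        by_contra! hcon
        have h₁ := hcon d
        have h₂ := hcon e
        omega
      obtain ⟨u, hu, hru, hud⟩ := hans.reply_of_majority hd (hr χ hχ)
      exact ⟨u, hu, hru, by rwa [hud]⟩
    obtain ⟨u, hu, rfl, -⟩ := hreply χ₀ hχ₀
    refine ⟨u, hu, fun χ => ?_⟩
    obtain ⟨u', -, hru', h⟩ := hreply χ.1 χ.2
    rw [hcount, Option.some.inj hru']
    exact h
  have hmany : ∀ (χ : Γ) b, 5 * a ≤ boolCount (v χ) S b := by
    intro χ s
    obtain ⟨r, b, hrb, hr, hb, h⟩ := htwo χ.1 χ.2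
    obtain ⟨x, -, hx⟩ := colourCount_pos.1 (show 0 < colourCount χ.1 S r by omega)
    obtain ⟨y, -, hy⟩ := colourCount_pos.1 (show 0 < colourCount χ.1 S b by omega)
    have hxy : v χ x ≠ v χ y := fun e => hrb (by rw [← hx, ← hy]; exact (hiff χ x y).1 e)
    have hs : s = v χ x ∨ s = v χ y := by
      cases s <;> cases hvx : v χ x <;> cases hvy : v χ y <;> simp_all
    rcases hs with rfl | rfl
    · rw [hcount, hx]; omega
    · rw [hcount, hy]; omega
  have : Nonempty Γ := ⟨⟨χ₀, hχ₀⟩⟩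
  obtain ⟨A, -, B, -, hAc, hBc, hAB, hA, hB⟩ := hmaj.exists_opposite_sets ha hScard hmany
  obtain ⟨a₀, ha₀⟩ := Finset.card_pos.1 (show 0 < A.card by omega)
  obtain ⟨b₀, hb₀⟩ := Finset.card_pos.1 (show 0 < B.card by omega)
  refine ⟨A, B, a₀, b₀, ⟨ha₀, hb₀, by omega, hAB, ?_, ?_, ?_⟩, hAc⟩
  · exact fun χ hχ x hx => (hiff ⟨χ, hχ⟩ x a₀).1 (hA ⟨χ, hχ⟩ x hx a₀ ha₀)
  · exact fun χ hχ x hx e => hB ⟨χ, hχ⟩ a₀ ha₀ x hx ((hiff ⟨χ, hχ⟩ a₀ x).2 e.symm)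
  · intro χ hχ x y hx hy
    obtain ⟨r, b, -, -, -, h⟩ := htwo χ hχ
    rcases h x with h₁ | h₁ <;> rcases h y with h₂ | h₂ <;> rcases h a₀ with h₃ | h₃ <;>
      simp_all

end twoFrequent

/-! ### Assembling the strategy. -/

section main

variable {n c q : ℕ} {ans goal : BallKind n c} {Γ : Set (Fin n → Fin c)}

/-- Two frequent colours without richness force `q` to be odd and all other colours to be absent. A
frame then gives a witness for these colourings, and the remaining ones are dominated. -/
theorem reach_hasNonMinorityBall_of_not_isRich (hans : IsAnswerKind ans) (hq : 2 ≤ q) {L t : ℕ}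
    (hL : 5 * q < L) (ht : t = (c * q) * (2 * L + 1) + 1 + L) (hn : 2 * (c * L) ≤ n)
    (hn' : 6 * (t * q) ≤ n) {S : Finset (Fin n)} (hcore : IsCore L Γ S Finset.univ)
    (hres : ResolvedOn q ans Γ S) (hrich : ∀ χ ∈ Γ, ¬ IsRich q L S χ) :
    Reach q ans HasNonMinorityBall (1204 * n + (2 ^ t + t)) Γ := by
  have htq : t * 2 ≤ t * q := Nat.mul_le_mul_left t hq
  by_cases hO : ∃ χ ∈ Γ, HasTwoFrequent L S χ
  · obtain ⟨χ₀, hχ₀, hO⟩ := hO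
    have hodd : Odd q := by
      by_contra hodd
      obtain ⟨r, b, hrb, hr, hb⟩ := hO
      exact hrich χ₀ hχ₀ ⟨r, b, hrb, hr, hb, fun h => absurd h hodd⟩
    obtain ⟨a, rfl⟩ := id hodd
    set O := Γ ∩ {χ | HasTwoFrequent L S χ} with hOdef
    obtain ⟨A, B, a₀, b₀, hf, hAc⟩ := exists_isFrame (Γ := O) hans (a := a) (L := L) (by omega)
      (by omega) (hres.mono Set.inter_subset_left) ⟨χ₀, hχ₀, hO⟩ fun χ hχ =>
        exists_two_colours (by omega) hcore hχ.1 hχ.2 (hrich χ hχ.1)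
    have hta : t * a ≤ t * (2 * a + 1) := Nat.mul_le_mul_left t (by omega)
    have := Nat.le_mul_of_pos_left (2 * a + 1) (show 0 < t by omega)
    refine (hf.reach_hasWitness (N := t * a) hans (by rw [hAc]) (by omega) (by omega)).bind
      fun Γ' hΓ' hw => hw.reach_hasNonMinorityBall (O := O) hans (by omega) ht hn ?_
    intro χ hχ hχO
    exact isDominated_of_not_hasTwoFrequent hcore (hΓ' hχ) fun h => hχO ⟨hΓ' hχ, h⟩
  -- All colourings are dominated, so with `O = ∅` any `t` balls contain a heavy ball that is a
  -- non-minority ball.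
  · have hcard : (Finset.univ : Finset (Fin n)).card = n := by simp
    obtain ⟨Z, -, hZ⟩ := Finset.exists_subset_card_eq (show t ≤ (Finset.univ : Finset (Fin n)).card by
      omega)
    refine (reach_hasNonMinorityBall_of_sure_set (O := ∅) (Z := Z) hans hq hn (fun χ hχ _ =>
      isDominated_of_not_hasTwoFrequent hcore hχ fun h => hO ⟨χ, hχ, h⟩) (by omega)
      (by simp)).mono_steps (by rw [hZ]; omega)

theorem reach_hasClaim (hans : ans = IsMajorityBall ∨ ans = IsPluralityBall) (hq : 2 ≤ q)
    {L t : ℕ} (hL : L = c * (q + 1) + 5 * q + 1) (ht : t = (c * q) * (2 * L + 1) + 1 + L)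
    (hn : 2 * (c * L) ≤ n) (hn' : 6 * (t * q) ≤ n)
    (hgoal : ∀ χ x, IsNonMinorityBall χ Finset.univ x → goal χ Finset.univ x)
    (hagree : ∀ Γ : Set (Fin n → Fin c), Agree L Γ → HasClaim goal Γ) :
    Reach q ans (HasClaim goal) ((1204 + 4 * 2 ^ t + (2 ^ t + t)) * n) Γ := by
  have hkind := isAnswerKind_of_eq hans
  have htq : t * 2 ≤ t * q := Nat.mul_le_mul_left t hq
  have hpos : 1 ≤ n := by omega
  have hcard : (Finset.univ : Finset (Fin n)).card = n := by simp
  have key : Reach q ans (HasClaim goal) (1204 * n + (2 ^ t + t) + n * 2 ^ (t + 1) +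
      (Finset.univ : Finset (Fin n)).card * 2 ^ (t + 1)) Γ := by
    refine reach_isCore hkind hq (L := L) (by omega) Finset.univ fun Γ₁ h₁ S hS _ hcore => ?_
    refine Reach.mono_steps (k := 1204 * n + (2 ^ t + t) +
      (Finset.univ : Finset (Fin n)).card * 2 ^ (S.card + 1)) ?_ ?_
    · refine Reach.askOnStar S Finset.univ fun Γ₂ h₂ hres => ?_
      by_cases hrich : ∃ χ ∈ Γ₂, IsRich q L S χ
      · obtain ⟨χ₀, hχ₀, hrich⟩ := hrich
        exact Reach.of_holds (hagree Γ₂ (agree_of_isRich hans hq (by omega) (by omega)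
          (hcore.mono h₂) (fun x => hres x (Finset.mem_univ x)) hχ₀ hrich))
      · have hS' : ResolvedOn q ans Γ₂ S :=
          (hres ⟨0, hpos⟩ (Finset.mem_univ _)).subset (Finset.subset_insert _ _)
        refine (reach_hasNonMinorityBall_of_not_isRich hkind hq (L := L) (by omega) ht hn hn'
          (hcore.mono h₂) hS' fun χ hχ h => hrich ⟨χ, hχ, h⟩).bind (l := 0) fun Γ₃ _ h₃ => ?_
        obtain ⟨u, hu⟩ := h₃
        exact Reach.of_holds ⟨some u, fun χ hχ => hgoal χ u (hu χ hχ)⟩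
    · rw [hcard]
      have : 2 ^ (S.card + 1) ≤ 2 ^ (t + 1) := Nat.pow_le_pow_right (by norm_num) (by omega)
      have := Nat.mul_le_mul_left n this
      omega
  refine key.mono_steps ?_
  rw [hcard, pow_succ]
  have : 2 ^ t + t ≤ (2 ^ t + t) * n := Nat.le_mul_of_pos_right _ hpos
  calc _ ≤ 1204 * n + (2 ^ t + t) * n + n * (2 ^ t * 2) + n * (2 ^ t * 2) := by omega
    _ = _ := by ring

end main

theorem theorem1 (q c : ℕ) (hq : 2 ≤ q) :
    ∃ n₀ K : ℕ, ∀ n : ℕ, n₀ ≤ n →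
      MB n q c ≤ (K : ℕ∞) * (n : ℕ∞) ∧ MC n q c ≤ (K : ℕ∞) * (n : ℕ∞) ∧
        PB n q c ≤ (K : ℕ∞) * (n : ℕ∞) ∧ PC n q c ≤ (K : ℕ∞) * (n : ℕ∞) := by
  -- The summands serve the pigeonhole for blocks, the opposite sets of a frame, and positivity. In
  -- `t`, the threshold for heavy balls is increased by the `L` replies that may return the witness
  -- itself.
  set L := c * (q + 1) + 5 * q + 1 with hL
  set t := (c * q) * (2 * L + 1) + 1 + L with ht
  -- The first summand of `n₀` is for dominated colourings and plurality classes, the second for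
  -- non-minority classes, the third for the reservoirs of a witness.
  refine ⟨2 * (c * L) + 2 * L + 6 * (t * q), 1204 + 4 * 2 ^ t + (2 ^ t + t), fun n hn => ?_⟩
  have hB : ∀ ans : BallKind n c, ans = IsMajorityBall ∨ ans = IsPluralityBall →
      queryComplexity n q c ans IsNonMinorityBall ≤
        ((1204 + 4 * 2 ^ t + (2 ^ t + t) : ℕ) : ℕ∞) * (n : ℕ∞) := by
    intro ans hans
    rw [← Nat.cast_mul]
    exact queryComplexity_le (reach_hasClaim hans hq hL ht (by omega) (by omega)
      (fun _ _ h => h) fun Γ h => h.hasClaim_nonMinority (by omega))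
  have hC : ∀ ans : BallKind n c, ans = IsMajorityBall ∨ ans = IsPluralityBall →
      queryComplexity n q c ans IsAlmostPluralityBall ≤
        ((1204 + 4 * 2 ^ t + (2 ^ t + t) : ℕ) : ℕ∞) * (n : ℕ∞) := by
    intro ans hans
    rw [← Nat.cast_mul]
    exact queryComplexity_le (reach_hasClaim hans hq hL ht (by omega) (by omega)
      (fun _ _ h => Or.inr h) fun Γ h => h.hasClaim_almostPlurality (by omega) (by omega))
  exact ⟨hB _ (Or.inl rfl), hC _ (Or.inl rfl), hB _ (Or.inr rfl), hC _ (Or.inr rfl)⟩
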